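/- Let $\phi=\frac{1+\sqrt5}{2}$. The kite is the convex quadrilateral with angles $72^\circ,72^\circ,144^\circ,72^\circ$ in cyclic order, and the dart is the non-convex quadrilateral with angles $72^\circ,36^\circ,216^\circ,36^\circ$ in cyclic order; each has two long edges of length $\phi$, which meet at the first angle listed, and two short edges of length $1$, which meet at the third, and is symmetric about the line (the axis) through the corners of these two angles. Colour the two corners of the kite on its axis and the two corners of the dart off its axis white, and the other two corners of each tile black. A Penrose tiling (by kites and darts) is a set of congruent copies of these two coloured tiles that cover $\mathbb{R}^2$, have pairwise disjoint interiors, meet edge-to-edge, and obey the matching rule that corners of tiles that coincide have the same colour. Let $\tau_1$ be any Penrose tiling of $\mathbb{R}^2$, and let $Y$ be a separated net created by $\tau_1$: $Y$ is obtained by placing one point in each (closed) tile of $\tau_1$, different points in different tiles, in such a way that for some $c_1,c_2>0$ any two distinct points of $Y$ are at distance at least $c_1$ and every point of $\mathbb{R}^2$ is within distance $c_2$ of some point of $Y$. Let $i\ge 50$, $j_1,j_2\in\mathbb{N}$, $l=2^i$, and $\mathcal{U}=[j_1,j_1+l]\times[j_2,j_2+l]$. Let $K$ and $D$ be the numbers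 of points of $\mathcal{U}\cap Y$ that are obtained from kites and from darts, respectively. Then $$\left|\frac{K}{D}-\phi\right|\le\phi^{-i/3}.$$ -/

import Mathlib

noncomputable section

namespace Penrose

/- The plane ℝ² is modelled by `ℂ`, with its Euclidean distance. -/

/-- The two prototiles. -/
inductive Kind
  | kite
  | dart

/-- The four corners of a tile. `tail` and `front` lie on the symmetry axis, `left` and `right` are
exchanged by the reflection in that axis. The long edges join `tail` to `left` and to `right`, the
short edges join `front` to `left` and to `right`. -/
inductive Corner
  | tail
  | left
  | front
  | right

/-- The corners of the prototiles, with symmetry axis on the real line and `tail` at the origin.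
The long edges have length `φ` and the short ones have length `1`. The kite has the angles
72°, 72°, 144°, 72° at `tail, left, front, right`, and the dart has 72°, 36°, 216°, 36°. -/
def protoCorner : Kind → Corner → ℂ
  | _, .tail => 0
  | _, .left => Real.goldenRatio * Complex.exp (((Real.pi / 5 : ℝ) : ℂ) * Complex.I)
  | _, .right => Real.goldenRatio * Complex.exp (((-(Real.pi / 5) : ℝ) : ℂ) * Complex.I)
  | .kite, .front => Real.goldenRatio
  | .dart, .front => 1

/-- The two-colouring of the corners that encodes the matching rule of kites and darts
(Conway's letters `H` and `T`): the kite has one letter on its axis and the other one on its side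
corners, and the dart has them the other way around. -/
def color : Kind → Corner → Bool
  | .kite, .tail => false
  | .kite, .front => false
  | .kite, .left => true
  | .kite, .right => true
  | .dart, .tail => true
  | .dart, .front => true
  | .dart, .left => false
  | .dart, .right => false

/-- A tile of the plane: a prototile moved by the rotation `rot` followed by the translation by
`shift`. (As the prototiles are mirror symmetric, these are all their congruent copies.) -/
structure Tile where
  kind : Kind
  rot : Circle
  shift : ℂ

namespace Tile

/-- The position of a corner of a tile. -/
def corner (t : Tile) (c : Corner) : ℂ :=
  (t.rot : ℂ) * protoCorner t.kind c + t.shift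

/-- The closed region covered by a tile: the union of its two closed halves, which are triangles
with the symmetry axis as a common side. -/
def region (t : Tile) : Set ℂ :=
  convexHull ℝ {t.corner .tail, t.corner .left, t.corner .front} ∪
    convexHull ℝ {t.corner .tail, t.corner .right, t.corner .front}

end Tile

/-- A set of tiles is a Penrose tiling of the plane by kites and darts: the tiles cover the plane,
different tiles have disjoint interiors, the tiling is edge-to-edge, and the matching rule holds
(corners that come together have the same colour). -/
structure IsPenroseTiling (T : Set Tile) : Prop where
  cover : ⋃ t ∈ T, t.region = Set.univ
  disjoint_interior : ∀ s ∈ T, ∀ t ∈ T, s ≠ t → Disjoint (interior s.region) (interior t.region)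
  edge_to_edge : ∀ s ∈ T, ∀ t ∈ T, ∀ c : Corner, s.corner c ∈ t.region →
    ∃ d : Corner, t.corner d = s.corner c
  matching : ∀ s ∈ T, ∀ t ∈ T, ∀ c d : Corner, s.corner c = t.corner d →
    color s.kind c = color t.kind d

/-- A separated net (Delone set) in the plane. -/
def IsSeparatedNet (Y : Set ℂ) : Prop :=
  ∃ c₁ > (0 : ℝ), ∃ c₂ > (0 : ℝ),
    (∀ x ∈ Y, ∀ y ∈ Y, x ≠ y → c₁ ≤ dist x y) ∧ ∀ x : ℂ, ∃ y ∈ Y, dist x y ≤ c₂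

/-- `p` places one point `p t` in each tile `t` of `T`, different points in different tiles, so that
the resulting set of points `p '' T` is a separated net. -/
structure IsNetOfTiling (T : Set Tile) (p : Tile → ℂ) : Prop where
  mem_region : ∀ t ∈ T, p t ∈ t.region
  injOn : Set.InjOn p T
  separatedNet : IsSeparatedNet (p '' T)

/-- The closed square `[j₁, j₁ + l] × [j₂, j₂ + l]`. -/
def square (j₁ j₂ l : ℝ) : Set ℂ :=
  {z | z.re ∈ Set.Icc j₁ (j₁ + l) ∧ z.im ∈ Set.Icc j₂ (j₂ + l)}

/-- The number of net points in `U` that are obtained from the tiles of kind `k` of `T`. -/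
def netCount (T : Set Tile) (p : Tile → ℂ) (k : Kind) (U : Set ℂ) : ℕ :=
  (U ∩ p '' {t ∈ T | t.kind = k}).ncard

end Penrose

end

noncomputable section

namespace Penrose

open Real Filter Topology MeasureTheory

/-! The area of the kite is `φ` times that of the dart, and the Galois conjugate of `φ` is `-1/φ`.
So if every tile is given the Galois conjugate of its oriented area, a patch with `K` kites and `D`
darts has total conjugate area a positive constant times `K - φ D`. By the shoelace formula
(`edgeSum_cross`) the conjugate area of a tile is a sum over its edges of terms that change sign
between the two sides of an edge, so in a patch only the boundary edges survive
(`abs_sum_edgeSum_le`). If these terms are bounded, `|K - φ D|` is at most a constant times the side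
`l` of the square. Since the number of tiles is at least of order `l²`, this gives `|K/D - φ| =
O(1/l)`, and for `i ≥ 50` that is below the required bound.

To have conjugates, the corners are lifted to integer vectors, one coordinate for each of the ten
directions, opposite ones being negatives. The lift of a point is unique once its index (the sum of
the coordinates in the five even directions) lies in `{0, 1, 2, 3}`, by `lift_unique`. The matching
rule orients the edges from white to black, and the index of the white end depends only on the
length and the direction of the edge (`idx_white`). Hence a lift passes from tile to tile through
common edges (`Placed.of_shares`), and edge connectedness (`tile_induction`) reaches all tiles.

What remains is that the conjugate positions are bounded (`norm_Ls_le_of_placed`). Each tile carries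
signed jump lines perpendicular to each of the ten directions, in the spirit of Ammann bars, which
agree along common edges (`edgeProfile`, `height_eq`). For each direction `m` they fit together to a
height `F m` on the plane that depends only on the coordinate in that direction (`exists_height`)
and is within 4 of the `m`-th lift coordinate. The linear relation between lift coordinates and
position (`lift_relation`) becomes an approximate functional equation linking `F m` at scale `φ` to
`F (m + 2)` and `F (m - 2)`. It forces `F m s = 2/5 * s + O(1)`, by a contraction argument
(`bounded_of_functional_equation`). As the linear part is killed by the conjugate embedding
(`norm_Ls_le`), the conjugate positions are bounded. No inflation or deflation of tilings is used.
-/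

/-- The golden ratio, as a constant that the arithmetic tactics do not unfold. -/
def gold : ℝ := Real.goldenRatio

local notation "φ" => gold

/-! ### Tenth roots of unity -/

/-- The tenth root of unity `exp (2 π i m / 10)`. -/
def om (m : ZMod 10) : ℂ := (ZMod.toCircle m : ℂ)

lemma om_add (a b : ZMod 10) : om (a + b) = om a * om b := by
  simp [om, AddChar.map_add_eq_mul]

lemma om_zero : om 0 = 1 := by simp [om]

lemma norm_om (m : ZMod 10) : ‖om m‖ = 1 := Circle.norm_coe _

lemma om_neg_mul (m : ZMod 10) : om (-m) * om m = 1 := by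
  rw [← om_add, neg_add_cancel, om_zero]

lemma om_mul_neg (m : ZMod 10) : om m * om (-m) = 1 := by
  rw [mul_comm, om_neg_mul]

lemma forall_zmod_ten {P : ZMod 10 → Prop} (h0 : P 0) (h1 : P 1) (h2 : P 2) (h3 : P 3) (h4 : P 4)
    (h5 : P 5) (h6 : P 6) (h7 : P 7) (h8 : P 8) (h9 : P 9) (m : ZMod 10) : P m := by
  fin_cases m <;> assumption

/-- The sine of 72°. -/
def sg : ℝ := φ * sin (π / 5)

lemma phi_pos : 0 < φ := goldenRatio_pos

lemma phi_sq : φ * φ = φ + 1 := by rw [← pow_two, gold, goldenRatio_sq]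

lemma phi_gt : 1.618 < φ := by
  have := phi_sq; have := phi_pos; nlinarith

lemma phi_lt : φ < 1.6181 := by
  have := phi_sq; have := phi_pos; nlinarith

lemma cos_pi_div_five_eq : cos (π / 5) = φ / 2 := by
  rw [cos_pi_div_five, gold, goldenRatio]; ring

lemma sg_pos : 0 < sg :=
  mul_pos phi_pos (sin_pos_of_pos_of_lt_pi (by positivity) (by linarith [pi_pos]))

lemma sin_pi_div_five_eq : sin (π / 5) = (φ - 1) * sg := by
  unfold sg; linear_combination (-sin (π / 5)) * phi_sq

lemma sg_sq : sg * sg = (φ + 2) / 4 := by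
  have h := sin_sq_add_cos_sq (π / 5)
  rw [cos_pi_div_five_eq] at h
  unfold sg
  linear_combination (φ * φ) * h + (1 / 2 - (φ * φ + φ) / 4) * phi_sq

lemma sg_gt : 0.951 < sg := by
  have := sg_sq; have := sg_pos; have := phi_gt; nlinarith

lemma sg_lt : sg < 0.9511 := by
  have := sg_sq; have := sg_pos; have := phi_lt; nlinarith

lemma om_one : om 1 = ⟨φ / 2, (φ - 1) * sg⟩ := by
  have h := ZMod.toCircle_intCast (N := 10) 1
  have h2 : (2 * π * Complex.I * ((1 : ℤ) : ℂ) / ((10 : ℕ) : ℂ)) = ((π / 5 : ℝ) : ℂ) * Complex.I := by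
    push_cast; ring
  rw [h2, Complex.exp_mul_I, ← Complex.ofReal_cos, ← Complex.ofReal_sin, cos_pi_div_five_eq,
    sin_pi_div_five_eq] at h
  simp only [Int.cast_one] at h
  rw [om, h]
  apply Complex.ext <;> simp

lemma om_two : om 2 = ⟨(φ - 1) / 2, sg⟩ := by
  rw [show (2 : ZMod 10) = 1 + 1 by decide, om_add, om_one]
  apply Complex.ext
  · simp only [Complex.mul_re]
    linear_combination (-φ / 4) * phi_sq - (φ - 1) ^ 2 * sg_sq
  · simp only [Complex.mul_im]
    linear_combination sg * phi_sq

lemma om_five : om 5 = -1 := by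
  have h := ZMod.toCircle_intCast (N := 10) 5
  have h2 : (2 * π * Complex.I * ((5 : ℤ) : ℂ) / ((10 : ℕ) : ℂ)) = π * Complex.I := by
    push_cast; ring
  rw [h2, Complex.exp_pi_mul_I] at h
  exact h

lemma om_add_five (m : ZMod 10) : om (m + 5) = -om m := by
  rw [om_add, om_five]; ring

lemma om_four : om 4 = ⟨-φ / 2, (φ - 1) * sg⟩ := by
  rw [show (4 : ZMod 10) = 2 + 2 by decide, om_add, om_two]
  apply Complex.ext
  · simp only [Complex.mul_re]
    linear_combination (1 / 4 : ℝ) * phi_sq - sg_sq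
  · simp only [Complex.mul_im]
    ring

lemma om_three : om 3 = ⟨-(φ - 1) / 2, sg⟩ := by
  rw [show (3 : ZMod 10) = 1 + 2 by decide, om_add, om_one, om_two]
  apply Complex.ext
  · simp only [Complex.mul_re]
    linear_combination (1 / 4 : ℝ) * phi_sq - (φ - 1) * sg_sq - (1 / 4 : ℝ) * phi_sq
  · simp only [Complex.mul_im]
    linear_combination (1 / 2 : ℝ) * sg * phi_sq

lemma om_six : om 6 = ⟨-φ / 2, -((φ - 1) * sg)⟩ := by
  rw [show (6 : ZMod 10) = 1 + 5 by decide, om_add_five, om_one]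
  apply Complex.ext <;> simp <;> ring

lemma om_seven : om 7 = ⟨-(φ - 1) / 2, -sg⟩ := by
  rw [show (7 : ZMod 10) = 2 + 5 by decide, om_add_five, om_two]
  apply Complex.ext <;> simp <;> ring

lemma om_eight : om 8 = ⟨(φ - 1) / 2, -sg⟩ := by
  rw [show (8 : ZMod 10) = 3 + 5 by decide, om_add_five, om_three]
  apply Complex.ext <;> simp <;> ring

lemma om_nine : om 9 = ⟨φ / 2, -((φ - 1) * sg)⟩ := by
  rw [show (9 : ZMod 10) = 4 + 5 by decide, om_add_five, om_four]
  apply Complex.ext <;> simp <;> ring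

lemma conj_om (m : ZMod 10) : (starRingEnd ℂ) (om m) = om (-m) := by
  have h : om m * (starRingEnd ℂ) (om m) = 1 := by
    rw [Complex.mul_conj, Complex.normSq_eq_norm_sq, norm_om]; simp
  calc (starRingEnd ℂ) (om m) = om (-m) * om m * (starRingEnd ℂ) (om m) := by
        rw [om_neg_mul, one_mul]
    _ = om (-m) := by rw [mul_assoc, h, mul_one]

lemma sum_fin_ten {M : Type*} [AddCommMonoid M] (f : Fin 10 → M) :
    ∑ m, f m = f 0 + f 1 + f 2 + f 3 + f 4 + f 5 + f 6 + f 7 + f 8 + f 9 := by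
  simp only [Fin.sum_univ_succ, Fin.sum_univ_zero, add_zero, ← add_assoc]
  rfl

lemma sum_zmod_ten {M : Type*} [AddCommMonoid M] (f : ZMod 10 → M) :
    ∑ m, f m = f 0 + f 1 + f 2 + f 3 + f 4 + f 5 + f 6 + f 7 + f 8 + f 9 :=
  sum_fin_ten f

/-! ### Lifts -/

/-- The lift of the unit vector `om d`. -/
def dir (d m : ZMod 10) : ℤ := if m = d then 1 else if m = d + 5 then -1 else 0

/-- Lifts are antisymmetric functions on the ten directions. -/
def Anti (n : ZMod 10 → ℤ) : Prop := ∀ m, n (m + 5) = -n m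

lemma anti_dir (d : ZMod 10) : Anti (dir d) := by unfold Anti dir; revert d; decide

lemma Anti.add {n n' : ZMod 10 → ℤ} (h : Anti n) (h' : Anti n') : Anti (n + n') := fun m => by
  simp only [Pi.add_apply, h m, h' m]; ring

lemma Anti.sub {n n' : ZMod 10 → ℤ} (h : Anti n) (h' : Anti n') : Anti (n - n') := fun m => by
  simp only [Pi.sub_apply, h m, h' m]; ring

lemma anti_zero : Anti 0 := fun m => by simp

/-- The complex number represented by a lift. -/
def L (n : ZMod 10 → ℤ) : ℂ := (∑ m, (n m : ℂ) * om m) / 2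

/-- The Galois conjugate of the complex number represented by a lift. -/
def Ls (n : ZMod 10 → ℤ) : ℂ := (∑ m, (n m : ℂ) * om (3 * m)) / 2

/-- The sum of the coordinates of a lift in the directions of the parity of `m`. -/
def idx (n : ZMod 10 → ℤ) (m : ZMod 10) : ℤ := n m + n (m + 2) + n (m + 4) + n (m + 6) + n (m + 8)

lemma L_add (n n' : ZMod 10 → ℤ) : L (n + n') = L n + L n' := by
  simp only [L, Pi.add_apply, Int.cast_add, add_mul, Finset.sum_add_distrib, add_div]

lemma L_sub (n n' : ZMod 10 → ℤ) : L (n - n') = L n - L n' := by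
  simp only [L, Pi.sub_apply, Int.cast_sub, sub_mul, Finset.sum_sub_distrib, sub_div]

lemma L_zero : L 0 = 0 := by simp [L]

lemma Ls_add (n n' : ZMod 10 → ℤ) : Ls (n + n') = Ls n + Ls n' := by
  simp only [Ls, Pi.add_apply, Int.cast_add, add_mul, Finset.sum_add_distrib, add_div]

lemma Ls_zero : Ls 0 = 0 := by simp [Ls]

lemma idx_add (n n' : ZMod 10 → ℤ) (m : ZMod 10) : idx (n + n') m = idx n m + idx n' m := by
  simp only [idx, Pi.add_apply]; ring

lemma idx_sub (n n' : ZMod 10 → ℤ) (m : ZMod 10) : idx (n - n') m = idx n m - idx n' m := by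
  simp only [idx, Pi.sub_apply]; ring

lemma sum_dir (d : ZMod 10) (f : ZMod 10 → ℂ) :
    ∑ m, (dir d m : ℂ) * f m = f d - f (d + 5) := by
  have h : ∀ m, (dir d m : ℂ) * f m
      = (if m = d then f d else 0) - (if m = d + 5 then f (d + 5) else 0) := by
    intro m
    have hd : d ≠ d + 5 := by revert d; decide
    unfold dir
    by_cases h1 : m = d
    · subst h1; simp [hd]
    · by_cases h2 : m = d + 5
      · subst h2; simp [h1]
      · simp [h1, h2]
  simp only [h, Finset.sum_sub_distrib]
  simp

lemma L_dir (d : ZMod 10) : L (dir d) = om d := by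
  rw [L, sum_dir, om_add_five]; ring

lemma Ls_dir (d : ZMod 10) : Ls (dir d) = om (3 * d) := by
  rw [Ls, sum_dir, mul_add, show (3 * 5 : ZMod 10) = 5 by decide, om_add_five]; ring

/-- Turning by `-m` shifts the indices, and antisymmetry folds the ten terms into five, whose real
parts are the cosines of 0°, 72° and 144°. -/
lemma re_L_mul_om {n : ZMod 10 → ℤ} (h : Anti n) (m : ZMod 10) :
    (L n * om (-m)).re = n m + (n (m + 2) + n (m - 2)) * ((φ - 1) / 2)
      - (n (m + 4) + n (m - 4)) * (φ / 2) := by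
  have h1 : L n * om (-m) = (∑ k, (n (m + k) : ℂ) * om k) / 2 := by
    rw [L, div_mul_eq_mul_div, Finset.sum_mul]
    congr 1
    rw [← Equiv.sum_comp (Equiv.addLeft m)]
    refine Finset.sum_congr rfl fun k _ => ?_
    rw [Equiv.coe_addLeft, mul_assoc, ← om_add]
    congr 2; ring
  have e5 := h m
  have e6 : n (m + 6) = -n (m + 1) := by
    rw [← h]; congr 1; rw [add_assoc]; congr 1
  have e7 : n (m + 7) = -n (m + 2) := by
    rw [← h]; congr 1; rw [add_assoc]; congr 1
  have e8 : n (m + 8) = -n (m + 3) := by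
    rw [← h]; congr 1; rw [add_assoc]; congr 1
  have e9 : n (m + 9) = -n (m + 4) := by
    rw [← h]; congr 1; rw [add_assoc]; congr 1
  have e8' : m - 2 = m + 8 := by rw [sub_eq_add_neg]; congr 1
  have e6' : m - 4 = m + 6 := by rw [sub_eq_add_neg]; congr 1
  rw [h1, sum_zmod_ten, om_zero, om_one, om_two, om_three, om_four, om_five, om_six, om_seven,
    om_eight, om_nine, add_zero, e8', e6', e5, e6, e7, e8, e9]
  have h2 : ∀ z : ℂ, (z / 2).re = z.re / 2 := fun z => by
    rw [show (2 : ℂ) = ((2 : ℝ) : ℂ) by norm_num, Complex.div_ofReal_re]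
  rw [h2]
  simp
  ring

/-- The coordinates at `m ± 4` are eliminated through the index, so that three coordinates are tied
to the position alone, up to a bounded index term. Here `2 * φ - 1 = √5`. This is the source of both
`lift_unique` and the functional equation for the heights. -/
lemma lift_relation {n : ZMod 10 → ℤ} (h : Anti n) (m : ZMod 10) :
    (2 * φ - 1) * (φ * n m + n (m + 2) + n (m - 2)) = 2 * (L n * om (-m)).re + φ * idx n m := by
  have e8' : m - 2 = m + 8 := by rw [sub_eq_add_neg]; congr 1
  have e6' : m - 4 = m + 6 := by rw [sub_eq_add_neg]; congr 1
  rw [re_L_mul_om h, idx, e8', e6']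
  push_cast
  linear_combination (2 * (n m : ℝ)) * phi_sq

lemma int_eq_of_phi {a b : ℤ} (h : φ * a + b = 0) : a = 0 ∧ b = 0 := by
  have ha : a = 0 := by
    by_contra ha
    have ha' : (a : ℝ) ≠ 0 := by exact_mod_cast ha
    have h2 : Irrational φ := goldenRatio_irrational
    apply h2
    refine ⟨-(b : ℚ) / a, ?_⟩
    push_cast
    field_simp
    linarith
  subst ha
  refine ⟨rfl, ?_⟩
  simpa using h

/-- A lift whose index is in `{0, 1, 2, 3}` is determined by the complex number. -/
lemma lift_unique {n n' : ZMod 10 → ℤ} (h : Anti n) (h' : Anti n') (hL : L n = L n')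
    (hi : 0 ≤ idx n 0 ∧ idx n 0 ≤ 3) (hi' : 0 ≤ idx n' 0 ∧ idx n' 0 ≤ 3) : n = n' := by
  have hd : Anti (n - n') := h.sub h'
  have hz : L (n - n') = 0 := by rw [L_sub, hL, sub_self]
  -- For a difference `d` with `L d = 0` the relation reads `φ * A + B = 0` with integers `A`, `B`;
  -- irrationality makes both vanish, whence `5 * d m = idx d m`.
  have key : ∀ m, 5 * (n - n') m = idx (n - n') m := by
    intro m
    have := lift_relation hd m
    rw [hz, zero_mul, Complex.zero_re] at this
    have h2 : φ * ((((n - n') m + 2 * ((n - n') (m + 2) + (n - n') (m - 2)) - idx (n - n') m : ℤ)) : ℝ)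
        + ((2 * (n - n') m - ((n - n') (m + 2) + (n - n') (m - 2)) : ℤ) : ℝ) = 0 := by
      push_cast
      linear_combination this - 2 * (((n - n') m : ℤ) : ℝ) * phi_sq
    obtain ⟨e1, e2⟩ := int_eq_of_phi h2
    omega
  have hev : ∀ m, idx (n - n') (m + 2) = idx (n - n') m := by
    intro m
    have : m + 2 + 8 = m := by rw [add_assoc]; simp [show (2 + 8 : ZMod 10) = 0 from rfl]
    simp only [idx, this, add_assoc]
    norm_num
    ring
  have h0 := key 0
  have hi0 : idx (n - n') 0 = idx n 0 - idx n' 0 := idx_sub _ _ _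
  -- The index is divisible by 5 and at most 3 in absolute value.
  have hz0 : idx (n - n') 0 = 0 := by omega
  have h2 : idx (n - n') 2 = 0 := by rw [← hz0, ← hev 0]; rfl
  have h4 : idx (n - n') 4 = 0 := by rw [← h2, ← hev 2]; rfl
  have h6 : idx (n - n') 6 = 0 := by rw [← h4, ← hev 4]; rfl
  have h8 : idx (n - n') 8 = 0 := by rw [← h6, ← hev 6]; rfl
  have k0 := key 0
  have k2 := key 2
  have k4 := key 4
  have k6 := key 6
  have k8 := key 8
  have a0 : (n - n') 5 = -(n - n') 0 := hd 0
  have a2 : (n - n') 7 = -(n - n') 2 := hd 2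
  have a4 : (n - n') 9 = -(n - n') 4 := hd 4
  have a6 : (n - n') 1 = -(n - n') 6 := hd 6
  have a8 : (n - n') 3 = -(n - n') 8 := hd 8
  have : n - n' = 0 := by
    funext m
    simp only [Pi.zero_apply]
    revert m
    apply forall_zmod_ten <;> omega
  exact sub_eq_zero.mp this

/-- The vectors `m ↦ Re (z * om (-m))` lie in the kernel of the conjugate embedding, so only the
deviation from such a vector counts; ten terms, halved, give `5 * C`. -/
lemma norm_Ls_le {n : ZMod 10 → ℤ} {z : ℂ} {C : ℝ}
    (h : ∀ m, |(n m : ℝ) - 2 / 5 * (z * om (-m)).re| ≤ C) : ‖Ls n‖ ≤ 5 * C := by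
  have h0 : ∑ m, (((z * om (-m)).re : ℝ) : ℂ) * om (3 * m) = 0 := by
    rw [sum_zmod_ten]
    have e : ∀ a b : ZMod 10, a = b → om a = om b := fun a b h => by rw [h]
    rw [e (-0) 0 rfl, e (-1) 9 rfl, e (-2) 8 rfl, e (-3) 7 rfl, e (-4) 6 rfl, e (-5) 5 rfl,
      e (-6) 4 rfl, e (-7) 3 rfl, e (-8) 2 rfl, e (-9) 1 rfl, e (3 * 0) 0 rfl, e (3 * 1) 3 rfl,
      e (3 * 2) 6 rfl, e (3 * 3) 9 rfl, e (3 * 4) 2 rfl, e (3 * 5) 5 rfl, e (3 * 6) 8 rfl,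
      e (3 * 7) 1 rfl, e (3 * 8) 4 rfl, e (3 * 9) 7 rfl, om_zero, om_one, om_two, om_three,
      om_four, om_five, om_six, om_seven, om_eight, om_nine]
    apply Complex.ext
    · simp [Complex.mul_re]
      linear_combination (-2 * z.re) * phi_sq
    · simp [Complex.mul_im]
      linear_combination (0 : ℝ) * phi_sq
  have h1 : Ls n = (∑ m, (((n m : ℝ) - 2 / 5 * (z * om (-m)).re : ℝ) : ℂ) * om (3 * m)) / 2 := by
    have : ∑ m, (((n m : ℝ) - 2 / 5 * (z * om (-m)).re : ℝ) : ℂ) * om (3 * m)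
        = ∑ m, (n m : ℂ) * om (3 * m)
          - 2 / 5 * ∑ m, (((z * om (-m)).re : ℝ) : ℂ) * om (3 * m) := by
      rw [Finset.mul_sum, ← Finset.sum_sub_distrib]
      refine Finset.sum_congr rfl fun m _ => ?_
      push_cast; ring
    rw [this, h0, Ls]; ring
  rw [h1, norm_div]
  have h2 : ‖∑ m, (((n m : ℝ) - 2 / 5 * (z * om (-m)).re : ℝ) : ℂ) * om (3 * m)‖ ≤ 10 * C := by
    refine (norm_sum_le _ _).trans ?_
    have : ∀ m ∈ (Finset.univ : Finset (ZMod 10)),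
        ‖(((n m : ℝ) - 2 / 5 * (z * om (-m)).re : ℝ) : ℂ) * om (3 * m)‖ ≤ C := fun m _ => by
      rw [norm_mul, norm_om, mul_one, Complex.norm_real]; exact h m
    refine (Finset.sum_le_card_nsmul _ _ _ this).trans ?_
    simp
  simp only [RCLike.norm_ofNat]
  linarith

/-! ### Edges and corners of tiles -/

/-- The edges of a tile: long or short, to the left or to the right of the axis. -/
inductive Edge
  | longLeft
  | longRight
  | shortLeft
  | shortRight

/-- Whether an edge is long. -/
def Edge.isLong : Edge → Bool
  | .longLeft => true
  | .longRight => true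
  | .shortLeft => false
  | .shortRight => false

/-- The white end of an edge. -/
def whiteC : Kind → Edge → Corner
  | .kite, .longLeft => .tail
  | .kite, .longRight => .tail
  | .kite, .shortLeft => .front
  | .kite, .shortRight => .front
  | .dart, .longLeft => .left
  | .dart, .longRight => .right
  | .dart, .shortLeft => .left
  | .dart, .shortRight => .right

/-- The black end of an edge. -/
def blackC : Kind → Edge → Corner
  | .kite, .longLeft => .left
  | .kite, .longRight => .right
  | .kite, .shortLeft => .left
  | .kite, .shortRight => .right
  | .dart, .longLeft => .tail
  | .dart, .longRight => .tail
  | .dart, .shortLeft => .front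
  | .dart, .shortRight => .front

/-- The direction of an edge of a prototile, from its white to its black end. -/
def off : Kind → Edge → ZMod 10
  | .kite, .longLeft => 1
  | .kite, .longRight => 9
  | .kite, .shortLeft => 3
  | .kite, .shortRight => 7
  | .dart, .longLeft => 6
  | .dart, .longRight => 4
  | .dart, .shortLeft => 7
  | .dart, .shortRight => 3

/-- The side of the edge, directed from white to black, on which the tile lies: `1` for left. -/
def sgn : Kind → Edge → ℤ
  | .kite, .longLeft => -1
  | .kite, .longRight => 1
  | .kite, .shortLeft => 1
  | .kite, .shortRight => -1
  | .dart, .longLeft => 1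
  | .dart, .longRight => -1
  | .dart, .shortLeft => -1
  | .dart, .shortRight => 1

/-- The lift of a corner of a prototile rotated by `om k`. -/
def cl : Kind → Corner → ZMod 10 → ZMod 10 → ℤ
  | _, .tail, _ => 0
  | _, .left, k => dir k + dir (k + 2)
  | _, .right, k => dir k + dir (k + 8)
  | .kite, .front, k => dir k + dir (k + 2) + dir (k + 8)
  | .dart, .front, k => dir k

/-- The lift of a long or short edge of direction `d`. -/
def inc : Bool → ZMod 10 → ZMod 10 → ℤ
  | true, d => dir (d + 1) + dir (d + 9)
  | false, d => dir d

/-- The length of a long or short edge. -/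
def len : Bool → ℝ
  | true => φ
  | false => 1

/-- The index of the white end of an edge of direction `d`. -/
def wIdx : Bool → ZMod 10 → ℤ
  | true, d => if d.val % 2 = 0 then 3 else 0
  | false, d => if d.val % 2 = 0 then 0 else 3

/-- The index of the tail of a tile rotated by `om k`. -/
def tailIdx : Kind → ZMod 10 → ℤ
  | .kite, k => if k.val % 2 = 0 then 0 else 3
  | .dart, k => if k.val % 2 = 0 then 1 else 2

lemma color_white (κ : Kind) (e : Edge) : color κ (whiteC κ e) = false := by
  cases κ <;> cases e <;> rfl

lemma color_black (κ : Kind) (e : Edge) : color κ (blackC κ e) = true := by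
  cases κ <;> cases e <;> rfl

lemma sgn_eq (κ : Kind) (e : Edge) : sgn κ e = 1 ∨ sgn κ e = -1 := by
  cases κ <;> cases e <;> simp [sgn]

lemma len_pos (b : Bool) : 0 < len b := by
  cases b
  · simp [len]
  · exact phi_pos

lemma len_injective {b b' : Bool} (h : len b = len b') : b = b' := by
  have := phi_gt
  cases b <;> cases b' <;> simp only [len] at h ⊢ <;> linarith

lemma anti_cl (κ : Kind) (c : Corner) (k : ZMod 10) : Anti (cl κ c k) := by
  cases c
  · cases κ <;> exact anti_zero
  · cases κ <;> exact (anti_dir _).add (anti_dir _)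
  · cases κ
    · exact ((anti_dir _).add (anti_dir _)).add (anti_dir _)
    · exact anti_dir _
  · cases κ <;> exact (anti_dir _).add (anti_dir _)

/-- The chosen corner lifts close up around the tile: `φ * om d = om (d + 1) + om (d + 9)` is the
lift of every long edge. -/
lemma cl_black (κ : Kind) (e : Edge) (k : ZMod 10) :
    cl κ (blackC κ e) k = cl κ (whiteC κ e) k + inc e.isLong (k + off κ e) := by
  funext m
  cases κ <;> cases e <;> simp only [blackC, whiteC, cl, inc, Edge.isLong, off, Pi.add_apply, dir,
    Pi.zero_apply] <;> revert k m <;> decide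

/-- The right side does not see the tile, only the length and direction of the edge. So both tiles
at a common edge assign the same index to its white end. -/
lemma idx_white (κ : Kind) (e : Edge) (k : ZMod 10) :
    tailIdx κ k + idx (cl κ (whiteC κ e) k) 0 = wIdx e.isLong (k + off κ e) := by
  cases κ <;> cases e <;> simp only [whiteC, cl, Edge.isLong, off, Pi.add_apply, dir,
    Pi.zero_apply, idx, tailIdx, wIdx] <;> revert k <;> decide

/-- This is the range in which `lift_unique` applies. -/
lemma idx_corner (κ : Kind) (c : Corner) (k : ZMod 10) :
    0 ≤ tailIdx κ k + idx (cl κ c k) 0 ∧ tailIdx κ k + idx (cl κ c k) 0 ≤ 3 := by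
  cases κ <;> cases c <;> simp only [cl, Pi.add_apply, dir,
    Pi.zero_apply, idx, tailIdx] <;> revert k <;> decide

lemma om_eq_of_eq {a b : ZMod 10} (h : a = b) : om a = om b := by rw [h]

lemma om_one_add_om_nine : om 1 + om 9 = φ := by
  rw [om_one, om_nine]
  apply Complex.ext <;> simp

lemma om_three_add_om_seven : om 3 + om 7 = ((1 - φ : ℝ) : ℂ) := by
  rw [om_three, om_seven]
  apply Complex.ext <;> simp

lemma L_inc (b : Bool) (d : ZMod 10) : L (inc b d) = len b * om d := by
  cases b
  · simp [inc, len, L_dir]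
  · rw [inc, len, L_add, L_dir, L_dir, om_add, om_add, ← mul_add, om_one_add_om_nine, mul_comm]

/-- Conjugation replaces the length `φ` by `|1 - φ| < 1` and keeps the length 1. -/
lemma norm_Ls_inc (b : Bool) (d : ZMod 10) : ‖Ls (inc b d)‖ ≤ 1 := by
  have := phi_gt; have := phi_lt
  cases b
  · simp [inc, Ls_dir, norm_om]
  · rw [inc, Ls_add, Ls_dir, Ls_dir, mul_add, mul_add, om_add, om_add, ← mul_add,
      om_eq_of_eq (show (3 * 1 : ZMod 10) = 3 by decide),
      om_eq_of_eq (show (3 * 9 : ZMod 10) = 7 by decide), om_three_add_om_seven, norm_mul, norm_om,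
      one_mul, Complex.norm_real, Real.norm_eq_abs, abs_le]
    constructor <;> linarith

lemma exp_pi_div_five : Complex.exp (((π / 5 : ℝ) : ℂ) * Complex.I) = om 1 := by
  rw [Complex.exp_mul_I, ← Complex.ofReal_cos, ← Complex.ofReal_sin, cos_pi_div_five_eq,
    sin_pi_div_five_eq, om_one]
  apply Complex.ext <;> simp

lemma exp_neg_pi_div_five : Complex.exp (((-(π / 5) : ℝ) : ℂ) * Complex.I) = om 9 := by
  rw [Complex.exp_mul_I, ← Complex.ofReal_cos, ← Complex.ofReal_sin, cos_neg, sin_neg,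
    cos_pi_div_five_eq, sin_pi_div_five_eq, om_nine]
  apply Complex.ext <;> simp

lemma protoCorner_tail (κ : Kind) : protoCorner κ .tail = 0 := by cases κ <;> rfl

lemma protoCorner_left (κ : Kind) : protoCorner κ .left = ⟨(φ + 1) / 2, sg⟩ := by
  have : protoCorner κ .left = φ * om 1 := by
    rw [← exp_pi_div_five]; cases κ <;> rfl
  rw [this, om_one]
  apply Complex.ext
  · simp; linear_combination (1 / 2 : ℝ) * phi_sq
  · simp; linear_combination sg * phi_sq

lemma protoCorner_right (κ : Kind) : protoCorner κ .right = ⟨(φ + 1) / 2, -sg⟩ := by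
  have : protoCorner κ .right = φ * om 9 := by
    rw [← exp_neg_pi_div_five]; cases κ <;> rfl
  rw [this, om_nine]
  apply Complex.ext
  · simp; linear_combination (1 / 2 : ℝ) * phi_sq
  · simp; linear_combination sg * phi_sq

/-- The length of the axis of a tile. -/
def axis : Kind → ℝ
  | .kite => φ
  | .dart => 1

lemma protoCorner_front (κ : Kind) : protoCorner κ .front = (axis κ : ℂ) := by
  cases κ
  · rfl
  · simp [protoCorner, axis]

lemma L_cl (κ : Kind) (c : Corner) (k : ZMod 10) : L (cl κ c k) = om k * protoCorner κ c := by
  have e1 : (1 : ℂ) + om 2 = ⟨(φ + 1) / 2, sg⟩ := by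
    rw [om_two]; apply Complex.ext
    · simp; ring
    · simp
  have e2 : (1 : ℂ) + om 8 = ⟨(φ + 1) / 2, -sg⟩ := by
    rw [om_eight]; apply Complex.ext
    · simp; ring
    · simp
  have e3 : (1 : ℂ) + om 2 + om 8 = φ := by
    rw [om_two, om_eight]; apply Complex.ext
    · simp; ring
    · simp
  cases c
  · cases κ <;> simp [cl, L_zero, protoCorner_tail]
  · rw [protoCorner_left, ← e1]
    cases κ <;> simp [cl, L_add, L_dir, om_add, mul_add]
  · rw [protoCorner_front]
    cases κ
    · rw [axis, ← e3]; simp [cl, L_add, L_dir, om_add, mul_add]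
    · simp [cl, L_dir, axis]
  · rw [protoCorner_right, ← e2]
    cases κ <;> simp [cl, L_add, L_dir, om_add, mul_add]

/-- The edge vector of a prototile. -/
lemma protoCorner_black (κ : Kind) (e : Edge) :
    protoCorner κ (blackC κ e) = protoCorner κ (whiteC κ e) + len e.isLong * om (off κ e) := by
  have h := congrArg L (cl_black κ e 0)
  rwa [L_add, L_cl, L_cl, L_inc, om_zero, one_mul, one_mul, zero_add] at h

/-! ### The conjugate area -/

/-- The oriented area of the parallelogram spanned by two vectors. -/
def cross (z w : ℂ) : ℝ := z.re * w.im - z.im * w.re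

/-- Twice the oriented conjugate area of a tile. -/
def conjArea : Kind → ℝ
  | .kite => 2 * (φ - 1) * ((φ - 1) * sg)
  | .dart => -2 * ((φ - 1) * sg)

/-- The sum of a function over the edges of a tile. -/
def edgeSum {M : Type*} [AddCommMonoid M] (f : Edge → M) : M :=
  f .longLeft + f .longRight + f .shortLeft + f .shortRight

/-- This is the shoelace formula for the conjugate quadrilateral, hence independent of position and
rotation. The value is twice the area, `2 * axis * sin 72°`, with `φ` replaced by `1 - φ` and `sin
72°` by `sin 216°`. -/
lemma edgeSum_cross (κ : Kind) (k : ZMod 10) (n : ZMod 10 → ℤ) :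
    edgeSum (fun e => (sgn κ e : ℝ) *
      cross (Ls (n + cl κ (whiteC κ e) k)) (Ls (n + cl κ (blackC κ e) k))) = conjArea κ := by
  have hu : (om (3 * k)).re * (om (3 * k)).re + (om (3 * k)).im * (om (3 * k)).im = 1 := by
    have h := norm_om (3 * k)
    rw [← Complex.normSq_apply, Complex.normSq_eq_norm_sq, h]; norm_num
  have hl : Ls (dir k + dir (k + 2)) = om (3 * k) * (1 + om 6) := by
    rw [Ls_add, Ls_dir, Ls_dir, mul_add, om_add, mul_add, mul_one]; rfl
  have hr : Ls (dir k + dir (k + 8)) = om (3 * k) * (1 + om 4) := by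
    rw [Ls_add, Ls_dir, Ls_dir, mul_add, om_add, mul_add, mul_one]; rfl
  have hf : Ls (dir k + dir (k + 2) + dir (k + 8)) = om (3 * k) * (1 + om 6 + om 4) := by
    rw [Ls_add, hl, Ls_dir, mul_add 3 k 8, om_add, mul_add _ _ (om 4)]; rfl
  generalize Ls n = z at *
  cases κ
  · simp only [edgeSum, sgn, whiteC, blackC, cl, Ls_add n, hl, hr, hf, Ls_zero, cross, conjArea,
      om_six, om_four]
    generalize om (3 * k) = u at *
    simp
    linear_combination (2 * (φ - 1) * ((φ - 1) * sg)) * hu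
  · simp only [edgeSum, sgn, whiteC, blackC, cl, Ls_add n, hl, hr, Ls_dir, Ls_zero, cross, conjArea,
      om_six, om_four]
    generalize om (3 * k) = u at *
    simp
    linear_combination (-2 * ((φ - 1) * sg)) * hu

/-! ### Step functions constant along lines -/

/-- The unit step at the origin, with the symmetric value at the jump. -/
def st (x : ℝ) : ℝ := (1 + Real.sign x) / 2

lemma st_one {x : ℝ} (h : 0 < x) : st x = 1 := by rw [st, Real.sign_of_pos h]; norm_num

lemma st_zero {x : ℝ} (h : x < 0) : st x = 0 := by rw [st, Real.sign_of_neg h]; norm_num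

lemma st_congr {x y : ℝ} (h : x = y) : st x = st y := by rw [h]

lemma st_flip {x y : ℝ} (h : x + y = 0) : st x = 1 - st y := by
  rw [eq_neg_of_add_eq_zero_left h, st, st, Real.sign_neg]; ring

lemma st_mem (x : ℝ) : 0 ≤ st x ∧ st x ≤ 1 := by
  rcases lt_trichotomy x 0 with h | h | h
  · rw [st_zero h]; norm_num
  · rw [h, st, Real.sign_zero]; norm_num
  · rw [st_one h]; norm_num

/-- The four profiles give the jumps met along an edge, by the coordinate gained from its white end.
`profParallel` is for a long edge at 0°, `profLong` for a long edge at 36° or a short one at 0°,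
`profShort` for a long edge at 72° or a short one at 36°, and `profCross` for a short edge at 72°.
Apart from the unit jump at `3/8` in `profLong`, the jumps are cancelling pairs `1/8` apart. The
positions are a solution of the compatibility conditions checked below. -/
def profParallel (x : ℝ) : ℝ :=
  st (x - (-φ / 2 + 9 / 8)) - st (x - (-φ / 2 + 5 / 4)) - st (x - (φ - 3 / 4))
    + st (x - (φ - 5 / 8)) + st (x - (φ / 2 + 5 / 8)) - st (x - (φ / 2 + 3 / 4))

def profLong (x : ℝ) : ℝ :=
  st (x - (1 / 8)) - st (x - (1 / 4)) + st (x - (3 / 8)) + st (x - (-φ / 2 + 13 / 8))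
    - st (x - (-φ / 2 + 7 / 4))

def profShort (x : ℝ) : ℝ :=
  st (x - (-φ / 2 + 9 / 8)) - st (x - (-φ / 2 + 5 / 4))

def profCross (x : ℝ) : ℝ :=
  st (x - (1 / 8)) - st (x - (1 / 4))

/-- The jump lines of the tiles perpendicular to the directions 0°, 36° and 72° from the axis, with
the coordinate measured from the tail. The kite at 36° needs no function of its own: a long edge
from its tail is parallel to that direction, so `profParallel` serves. -/
def kiteStep0 (x : ℝ) : ℝ :=
  st (x - (1 / 8)) - st (x - (1 / 4)) + st (x - (3 / 8)) + st (x - (-φ / 2 + 13 / 8))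
    - st (x - (-φ / 2 + 7 / 4)) - st (x - (φ - 1 / 4)) + st (x - (φ - 1 / 8))

def kiteStep2 (x : ℝ) : ℝ :=
  st (x - (1 / 8)) - st (x - (1 / 4)) + st (x - (3 / 8)) + st (x - (-φ / 2 + 13 / 8))
    - st (x - (-φ / 2 + 7 / 4)) + st (x - (φ / 2 - 9 / 8)) - st (x - (φ / 2 - 5 / 4))

def dartStep0 (x : ℝ) : ℝ :=
  -st (x - (φ - 5 / 4)) + st (x - (φ - 9 / 8)) + st (x - (φ / 2 + 1 / 8))
    - st (x - (φ / 2 + 1 / 4)) + st (x - (φ / 2 + 3 / 8))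

def dartStep1 (x : ℝ) : ℝ :=
  -st (x - (φ / 2 - 3 / 4)) + st (x - (φ / 2 - 5 / 8)) + st (x - (5 / 8)) - st (x - (3 / 4))
    - st (x - (3 * φ / 2 - 5 / 4)) + st (x - (3 * φ / 2 - 9 / 8))

def dartStep2 (x : ℝ) : ℝ :=
  -st (x - (φ - 5 / 4)) + st (x - (φ - 9 / 8)) + st (x - (φ / 2 + 1 / 8))
    - st (x - (φ / 2 + 1 / 4)) + st (x - (φ / 2 + 3 / 8)) + st (x - (-φ / 2 + 5 / 8))
    - st (x - (-φ / 2 + 3 / 4))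

/-- In this and the next nineteen lemmas, the suffix is the direction and `v` is the distance in
that direction from the white end of the edge. Jumps of the tile step and of the profile correspond
one by one, through `st_flip` where the edge runs backwards, and the others lie outside the range of
the edge or cancel in pairs. Left edges and the directions 0, 1, 2, 8, 9 suffice by symmetry. -/
lemma kite_longLeft_0 {v : ℝ} (h1 : v ≤ φ / 2 + 1 / 2) :
    kiteStep0 (0 + v) = 0 + profLong v := by
  have := phi_gt; have := phi_lt
  simp only [kiteStep0, profLong]
  linarith [st_congr (show 0 + v - (1 / 8) = v - (1 / 8) by ring),
    st_congr (show 0 + v - (1 / 4) = v - (1 / 4) by ring),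
    st_congr (show 0 + v - (3 / 8) = v - (3 / 8) by ring),
    st_congr (show 0 + v - (-φ / 2 + 13 / 8) = v - (-φ / 2 + 13 / 8) by ring),
    st_congr (show 0 + v - (-φ / 2 + 7 / 4) = v - (-φ / 2 + 7 / 4) by ring),
    st_zero (show 0 + v - (φ - 1 / 4) < 0 by linarith),
    st_zero (show 0 + v - (φ - 1 / 8) < 0 by linarith)]

lemma kite_longLeft_1 {v : ℝ} :
    profParallel (0 + v) = 0 + profParallel v := by
  have := phi_gt; have := phi_lt
  simp only [profParallel]
  linarith [st_congr (show 0 + v - (-φ / 2 + 9 / 8) = v - (-φ / 2 + 9 / 8) by ring),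
    st_congr (show 0 + v - (-φ / 2 + 5 / 4) = v - (-φ / 2 + 5 / 4) by ring),
    st_congr (show 0 + v - (φ - 3 / 4) = v - (φ - 3 / 4) by ring),
    st_congr (show 0 + v - (φ - 5 / 8) = v - (φ - 5 / 8) by ring),
    st_congr (show 0 + v - (φ / 2 + 5 / 8) = v - (φ / 2 + 5 / 8) by ring),
    st_congr (show 0 + v - (φ / 2 + 3 / 4) = v - (φ / 2 + 3 / 4) by ring)]

lemma kite_longLeft_2 {v : ℝ} (h0 : 0 ≤ v) :
    kiteStep2 (0 + v) = 0 + profLong v := by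
  have := phi_gt; have := phi_lt
  simp only [kiteStep2, profLong]
  linarith [st_congr (show 0 + v - (1 / 8) = v - (1 / 8) by ring),
    st_congr (show 0 + v - (1 / 4) = v - (1 / 4) by ring),
    st_congr (show 0 + v - (3 / 8) = v - (3 / 8) by ring),
    st_congr (show 0 + v - (-φ / 2 + 13 / 8) = v - (-φ / 2 + 13 / 8) by ring),
    st_congr (show 0 + v - (-φ / 2 + 7 / 4) = v - (-φ / 2 + 7 / 4) by ring),
    st_one (show 0 < 0 + v - (φ / 2 - 9 / 8) by linarith),
    st_one (show 0 < 0 + v - (φ / 2 - 5 / 4) by linarith)]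

lemma kite_longLeft_8 {v : ℝ} (h0 : 0 ≤ v) :
    kiteStep2 (0 - v) = 0 - profShort v := by
  have := phi_gt; have := phi_lt
  simp only [kiteStep2, profShort]
  linarith [st_zero (show 0 - v - (1 / 8) < 0 by linarith),
    st_zero (show 0 - v - (1 / 4) < 0 by linarith),
    st_zero (show 0 - v - (3 / 8) < 0 by linarith),
    st_zero (show 0 - v - (-φ / 2 + 13 / 8) < 0 by linarith),
    st_zero (show 0 - v - (-φ / 2 + 7 / 4) < 0 by linarith),
    st_flip (show 0 - v - (φ / 2 - 9 / 8) + (v - (-φ / 2 + 9 / 8)) = 0 by ring),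
    st_flip (show 0 - v - (φ / 2 - 5 / 4) + (v - (-φ / 2 + 5 / 4)) = 0 by ring)]

lemma kite_longLeft_9 {v : ℝ} (h1 : v ≤ 1 / 2) :
    profParallel (0 + v) = 0 + profShort v := by
  have := phi_gt; have := phi_lt
  simp only [profParallel, profShort]
  linarith [st_congr (show 0 + v - (-φ / 2 + 9 / 8) = v - (-φ / 2 + 9 / 8) by ring),
    st_congr (show 0 + v - (-φ / 2 + 5 / 4) = v - (-φ / 2 + 5 / 4) by ring),
    st_zero (show 0 + v - (φ - 3 / 4) < 0 by linarith),
    st_zero (show 0 + v - (φ - 5 / 8) < 0 by linarith),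
    st_zero (show 0 + v - (φ / 2 + 5 / 8) < 0 by linarith),
    st_zero (show 0 + v - (φ / 2 + 3 / 4) < 0 by linarith)]

lemma kite_shortLeft_0 {v : ℝ} (h1 : v ≤ φ / 2 - 1 / 2) :
    kiteStep0 (φ - v) = 1 - profCross v := by
  have := phi_gt; have := phi_lt
  simp only [kiteStep0, profCross]
  linarith [st_one (show 0 < φ - v - (1 / 8) by linarith),
    st_one (show 0 < φ - v - (1 / 4) by linarith),
    st_one (show 0 < φ - v - (3 / 8) by linarith),
    st_one (show 0 < φ - v - (-φ / 2 + 13 / 8) by linarith),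
    st_one (show 0 < φ - v - (-φ / 2 + 7 / 4) by linarith),
    st_flip (show φ - v - (φ - 1 / 4) + (v - (1 / 4)) = 0 by ring),
    st_flip (show φ - v - (φ - 1 / 8) + (v - (1 / 8)) = 0 by ring)]

lemma kite_shortLeft_1 {v : ℝ} (h0 : 0 ≤ v) :
    profParallel (φ / 2 + 1 / 2 + v) = 0 + profCross v := by
  have := phi_gt; have := phi_lt
  simp only [profParallel, profCross]
  linarith [st_one (show 0 < φ / 2 + 1 / 2 + v - (-φ / 2 + 9 / 8) by linarith),
    st_one (show 0 < φ / 2 + 1 / 2 + v - (-φ / 2 + 5 / 4) by linarith),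
    st_one (show 0 < φ / 2 + 1 / 2 + v - (φ - 3 / 4) by linarith),
    st_one (show 0 < φ / 2 + 1 / 2 + v - (φ - 5 / 8) by linarith),
    st_congr (show φ / 2 + 1 / 2 + v - (φ / 2 + 5 / 8) = v - (1 / 8) by ring),
    st_congr (show φ / 2 + 1 / 2 + v - (φ / 2 + 3 / 4) = v - (1 / 4) by ring)]

lemma kite_shortLeft_2 {v : ℝ} (h0 : 0 ≤ v) :
    kiteStep2 (1 / 2 + v) = 1 + profShort v := by
  have := phi_gt; have := phi_lt
  simp only [kiteStep2, profShort]
  linarith [st_one (show 0 < 1 / 2 + v - (1 / 8) by linarith),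
    st_one (show 0 < 1 / 2 + v - (1 / 4) by linarith),
    st_one (show 0 < 1 / 2 + v - (3 / 8) by linarith),
    st_congr (show 1 / 2 + v - (-φ / 2 + 13 / 8) = v - (-φ / 2 + 9 / 8) by ring),
    st_congr (show 1 / 2 + v - (-φ / 2 + 7 / 4) = v - (-φ / 2 + 5 / 4) by ring),
    st_one (show 0 < 1 / 2 + v - (φ / 2 - 9 / 8) by linarith),
    st_one (show 0 < 1 / 2 + v - (φ / 2 - 5 / 4) by linarith)]

lemma kite_shortLeft_8 {v : ℝ} (h0 : 0 ≤ v) :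
    kiteStep2 (1 / 2 - v) = 1 - profLong v := by
  have := phi_gt; have := phi_lt
  simp only [kiteStep2, profLong]
  linarith [st_flip (show 1 / 2 - v - (1 / 8) + (v - (3 / 8)) = 0 by ring),
    st_flip (show 1 / 2 - v - (1 / 4) + (v - (1 / 4)) = 0 by ring),
    st_flip (show 1 / 2 - v - (3 / 8) + (v - (1 / 8)) = 0 by ring),
    st_zero (show 1 / 2 - v - (-φ / 2 + 13 / 8) < 0 by linarith),
    st_zero (show 1 / 2 - v - (-φ / 2 + 7 / 4) < 0 by linarith),
    st_flip (show 1 / 2 - v - (φ / 2 - 9 / 8) + (v - (-φ / 2 + 13 / 8)) = 0 by ring),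
    st_flip (show 1 / 2 - v - (φ / 2 - 5 / 4) + (v - (-φ / 2 + 7 / 4)) = 0 by ring)]

lemma kite_shortLeft_9 {v : ℝ} (h0 : 0 ≤ v) (h1 : v ≤ φ / 2) :
    profParallel (φ / 2 + 1 / 2 - v) = 0 - profShort v := by
  have := phi_gt; have := phi_lt
  simp only [profParallel, profShort]
  linarith [st_one (show 0 < φ / 2 + 1 / 2 - v - (-φ / 2 + 9 / 8) by linarith),
    st_one (show 0 < φ / 2 + 1 / 2 - v - (-φ / 2 + 5 / 4) by linarith),
    st_flip (show φ / 2 + 1 / 2 - v - (φ - 3 / 4) + (v - (-φ / 2 + 5 / 4)) = 0 by ring),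
    st_flip (show φ / 2 + 1 / 2 - v - (φ - 5 / 8) + (v - (-φ / 2 + 9 / 8)) = 0 by ring),
    st_zero (show φ / 2 + 1 / 2 - v - (φ / 2 + 5 / 8) < 0 by linarith),
    st_zero (show φ / 2 + 1 / 2 - v - (φ / 2 + 3 / 4) < 0 by linarith)]

lemma dart_longLeft_0 {v : ℝ} :
    dartStep0 (φ / 2 + 1 / 2 - v) = 1 - profLong v := by
  have := phi_gt; have := phi_lt
  simp only [dartStep0, profLong]
  linarith [st_flip (show φ / 2 + 1 / 2 - v - (φ - 5 / 4) + (v - (-φ / 2 + 7 / 4)) = 0 by ring),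
    st_flip (show φ / 2 + 1 / 2 - v - (φ - 9 / 8) + (v - (-φ / 2 + 13 / 8)) = 0 by ring),
    st_flip (show φ / 2 + 1 / 2 - v - (φ / 2 + 1 / 8) + (v - (3 / 8)) = 0 by ring),
    st_flip (show φ / 2 + 1 / 2 - v - (φ / 2 + 1 / 4) + (v - (1 / 4)) = 0 by ring),
    st_flip (show φ / 2 + 1 / 2 - v - (φ / 2 + 3 / 8) + (v - (1 / 8)) = 0 by ring)]

lemma dart_longLeft_1 {v : ℝ} :
    dartStep1 (φ - v) = 0 - profParallel v := by
  have := phi_gt; have := phi_lt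
  simp only [dartStep1, profParallel]
  linarith [st_flip (show φ - v - (φ / 2 - 3 / 4) + (v - (φ / 2 + 3 / 4)) = 0 by ring),
    st_flip (show φ - v - (φ / 2 - 5 / 8) + (v - (φ / 2 + 5 / 8)) = 0 by ring),
    st_flip (show φ - v - (5 / 8) + (v - (φ - 5 / 8)) = 0 by ring),
    st_flip (show φ - v - (3 / 4) + (v - (φ - 3 / 4)) = 0 by ring),
    st_flip (show φ - v - (3 * φ / 2 - 5 / 4) + (v - (-φ / 2 + 5 / 4)) = 0 by ring),
    st_flip (show φ - v - (3 * φ / 2 - 9 / 8) + (v - (-φ / 2 + 9 / 8)) = 0 by ring)]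

lemma dart_longLeft_2 {v : ℝ} (h1 : v ≤ φ / 2 + 1 / 2) :
    dartStep2 (φ / 2 + 1 / 2 - v) = 1 - profLong v := by
  have := phi_gt; have := phi_lt
  simp only [dartStep2, profLong]
  linarith [st_flip (show φ / 2 + 1 / 2 - v - (φ - 5 / 4) + (v - (-φ / 2 + 7 / 4)) = 0 by ring),
    st_flip (show φ / 2 + 1 / 2 - v - (φ - 9 / 8) + (v - (-φ / 2 + 13 / 8)) = 0 by ring),
    st_flip (show φ / 2 + 1 / 2 - v - (φ / 2 + 1 / 8) + (v - (3 / 8)) = 0 by ring),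
    st_flip (show φ / 2 + 1 / 2 - v - (φ / 2 + 1 / 4) + (v - (1 / 4)) = 0 by ring),
    st_flip (show φ / 2 + 1 / 2 - v - (φ / 2 + 3 / 8) + (v - (1 / 8)) = 0 by ring),
    st_one (show 0 < φ / 2 + 1 / 2 - v - (-φ / 2 + 5 / 8) by linarith),
    st_one (show 0 < φ / 2 + 1 / 2 - v - (-φ / 2 + 3 / 4) by linarith)]

lemma dart_longLeft_8 {v : ℝ} (h1 : v ≤ 1 / 2) :
    dartStep2 (-1 / 2 + v) = 0 + profShort v := by
  have := phi_gt; have := phi_lt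
  simp only [dartStep2, profShort]
  linarith [st_zero (show -1 / 2 + v - (φ - 5 / 4) < 0 by linarith),
    st_zero (show -1 / 2 + v - (φ - 9 / 8) < 0 by linarith),
    st_zero (show -1 / 2 + v - (φ / 2 + 1 / 8) < 0 by linarith),
    st_zero (show -1 / 2 + v - (φ / 2 + 1 / 4) < 0 by linarith),
    st_zero (show -1 / 2 + v - (φ / 2 + 3 / 8) < 0 by linarith),
    st_congr (show -1 / 2 + v - (-φ / 2 + 5 / 8) = v - (-φ / 2 + 9 / 8) by ring),
    st_congr (show -1 / 2 + v - (-φ / 2 + 3 / 4) = v - (-φ / 2 + 5 / 4) by ring)]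

lemma dart_longLeft_9 {v : ℝ} (h0 : 0 ≤ v) :
    dartStep1 (1 / 2 - v) = 0 - profShort v := by
  have := phi_gt; have := phi_lt
  simp only [dartStep1, profShort]
  linarith [st_flip (show 1 / 2 - v - (φ / 2 - 3 / 4) + (v - (-φ / 2 + 5 / 4)) = 0 by ring),
    st_flip (show 1 / 2 - v - (φ / 2 - 5 / 8) + (v - (-φ / 2 + 9 / 8)) = 0 by ring),
    st_zero (show 1 / 2 - v - (5 / 8) < 0 by linarith),
    st_zero (show 1 / 2 - v - (3 / 4) < 0 by linarith),
    st_zero (show 1 / 2 - v - (3 * φ / 2 - 5 / 4) < 0 by linarith),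
    st_zero (show 1 / 2 - v - (3 * φ / 2 - 9 / 8) < 0 by linarith)]

lemma dart_shortLeft_0 {v : ℝ} (h1 : v ≤ φ / 2 - 1 / 2) :
    dartStep0 (φ / 2 + 1 / 2 - v) = 1 - profCross v := by
  have := phi_gt; have := phi_lt
  simp only [dartStep0, profCross]
  linarith [st_one (show 0 < φ / 2 + 1 / 2 - v - (φ - 5 / 4) by linarith),
    st_one (show 0 < φ / 2 + 1 / 2 - v - (φ - 9 / 8) by linarith),
    st_one (show 0 < φ / 2 + 1 / 2 - v - (φ / 2 + 1 / 8) by linarith),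
    st_flip (show φ / 2 + 1 / 2 - v - (φ / 2 + 1 / 4) + (v - (1 / 4)) = 0 by ring),
    st_flip (show φ / 2 + 1 / 2 - v - (φ / 2 + 3 / 8) + (v - (1 / 8)) = 0 by ring)]

lemma dart_shortLeft_1 {v : ℝ} (h1 : v ≤ φ / 2) :
    dartStep1 (φ - v) = 0 - profShort v := by
  have := phi_gt; have := phi_lt
  simp only [dartStep1, profShort]
  linarith [st_one (show 0 < φ - v - (φ / 2 - 3 / 4) by linarith),
    st_one (show 0 < φ - v - (φ / 2 - 5 / 8) by linarith),
    st_one (show 0 < φ - v - (5 / 8) by linarith),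
    st_one (show 0 < φ - v - (3 / 4) by linarith),
    st_flip (show φ - v - (3 * φ / 2 - 5 / 4) + (v - (-φ / 2 + 5 / 4)) = 0 by ring),
    st_flip (show φ - v - (3 * φ / 2 - 9 / 8) + (v - (-φ / 2 + 9 / 8)) = 0 by ring)]

lemma dart_shortLeft_2 {v : ℝ} (h1 : v ≤ 1) :
    dartStep2 (φ / 2 + 1 / 2 - v) = 1 - profLong v := by
  have := phi_gt; have := phi_lt
  simp only [dartStep2, profLong]
  linarith [st_flip (show φ / 2 + 1 / 2 - v - (φ - 5 / 4) + (v - (-φ / 2 + 7 / 4)) = 0 by ring),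
    st_flip (show φ / 2 + 1 / 2 - v - (φ - 9 / 8) + (v - (-φ / 2 + 13 / 8)) = 0 by ring),
    st_flip (show φ / 2 + 1 / 2 - v - (φ / 2 + 1 / 8) + (v - (3 / 8)) = 0 by ring),
    st_flip (show φ / 2 + 1 / 2 - v - (φ / 2 + 1 / 4) + (v - (1 / 4)) = 0 by ring),
    st_flip (show φ / 2 + 1 / 2 - v - (φ / 2 + 3 / 8) + (v - (1 / 8)) = 0 by ring),
    st_one (show 0 < φ / 2 + 1 / 2 - v - (-φ / 2 + 5 / 8) by linarith),
    st_one (show 0 < φ / 2 + 1 / 2 - v - (-φ / 2 + 3 / 4) by linarith)]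

lemma dart_shortLeft_8 {v : ℝ} (h1 : v ≤ φ / 2) :
    dartStep2 (-1 / 2 + v) = 0 + profShort v := by
  have := phi_gt; have := phi_lt
  simp only [dartStep2, profShort]
  linarith [st_zero (show -1 / 2 + v - (φ - 5 / 4) < 0 by linarith),
    st_zero (show -1 / 2 + v - (φ - 9 / 8) < 0 by linarith),
    st_zero (show -1 / 2 + v - (φ / 2 + 1 / 8) < 0 by linarith),
    st_zero (show -1 / 2 + v - (φ / 2 + 1 / 4) < 0 by linarith),
    st_zero (show -1 / 2 + v - (φ / 2 + 3 / 8) < 0 by linarith),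
    st_congr (show -1 / 2 + v - (-φ / 2 + 5 / 8) = v - (-φ / 2 + 9 / 8) by ring),
    st_congr (show -1 / 2 + v - (-φ / 2 + 3 / 4) = v - (-φ / 2 + 5 / 4) by ring)]

lemma dart_shortLeft_9 {v : ℝ} (h0 : 0 ≤ v) (h1 : v ≤ φ / 2 - 1 / 2) :
    dartStep1 (1 / 2 + v) = 0 + profCross v := by
  have := phi_gt; have := phi_lt
  simp only [dartStep1, profCross]
  linarith [st_one (show 0 < 1 / 2 + v - (φ / 2 - 3 / 4) by linarith),
    st_one (show 0 < 1 / 2 + v - (φ / 2 - 5 / 8) by linarith),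
    st_congr (show 1 / 2 + v - (5 / 8) = v - (1 / 8) by ring),
    st_congr (show 1 / 2 + v - (3 / 4) = v - (1 / 4) by ring),
    st_zero (show 1 / 2 + v - (3 * φ / 2 - 5 / 4) < 0 by linarith),
    st_zero (show 1 / 2 + v - (3 * φ / 2 - 9 / 8) < 0 by linarith)]

/-- Extends functions attached to the angles 0°, 36° and 72° to all directions, by the symmetry
`F (-j) = F j` and the antisymmetry `F (j + 5) x = -F j (-x)`. -/
def symFun (g0 g1 g2 : ℝ → ℝ) (j : ZMod 10) : ℝ → ℝ :=
  if j = 0 then g0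
  else if j = 1 ∨ j = 9 then g1
  else if j = 2 ∨ j = 8 then g2
  else if j = 5 then fun x => -g0 (-x)
  else if j = 4 ∨ j = 6 then fun x => -g1 (-x)
  else fun x => -g2 (-x)

lemma symFun_neg (g0 g1 g2 : ℝ → ℝ) (j : ZMod 10) : symFun g0 g1 g2 (-j) = symFun g0 g1 g2 j := by
  revert j
  apply forall_zmod_ten <;> rfl

lemma symFun_add_five (g0 g1 g2 : ℝ → ℝ) (j : ZMod 10) (x : ℝ) :
    symFun g0 g1 g2 (j + 5) x = -symFun g0 g1 g2 j (-x) := by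
  have h : ∀ g : ℝ → ℝ, g x = - -g (- -x) := fun g => by rw [neg_neg, neg_neg]
  revert j
  apply forall_zmod_ten
  · rfl
  · rfl
  · rfl
  · exact h _
  · exact h _
  · exact h _
  · exact h _
  · exact h _
  · rfl
  · rfl

/-- The step function of a tile in the direction `j`. -/
def tileStep : Kind → ZMod 10 → ℝ → ℝ
  | .kite => symFun kiteStep0 profParallel kiteStep2
  | .dart => symFun dartStep0 dartStep1 dartStep2

/-- The profile of the step function along an edge that makes the angle `j` with the direction. -/
def prof : Bool → ZMod 10 → ℝ → ℝ
  | true => symFun profParallel profLong profShort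
  | false => symFun profLong profShort profCross

lemma tileStep_neg (κ : Kind) (j : ZMod 10) : tileStep κ (-j) = tileStep κ j := by
  cases κ <;> exact symFun_neg _ _ _ _

lemma tileStep_add_five (κ : Kind) (j : ZMod 10) (x : ℝ) :
    tileStep κ (j + 5) x = -tileStep κ j (-x) := by
  cases κ <;> exact symFun_add_five _ _ _ _ _

lemma prof_neg (b : Bool) (j : ZMod 10) : prof b (-j) = prof b j := by
  cases b <;> exact symFun_neg _ _ _ _

lemma prof_add_five (b : Bool) (j : ZMod 10) (x : ℝ) : prof b (j + 5) x = -prof b j (-x) := by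
  cases b <;> exact symFun_add_five _ _ _ _ _

lemma abs_symFun_le {g0 g1 g2 : ℝ → ℝ} {C : ℝ} (h0 : ∀ x, |g0 x| ≤ C) (h1 : ∀ x, |g1 x| ≤ C)
    (h2 : ∀ x, |g2 x| ≤ C) (j : ZMod 10) (x : ℝ) : |symFun g0 g1 g2 j x| ≤ C := by
  unfold symFun
  split_ifs <;> simp only [abs_neg, h0, h1, h2]

/-- Each step function has at most four jumps of each sign. -/
lemma abs_tileStep_le (κ : Kind) (j : ZMod 10) (x : ℝ) : |tileStep κ j x| ≤ 4 := by
  cases κ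
  · refine abs_symFun_le (fun x => ?_) (fun x => ?_) (fun x => ?_) j x <;>
    · simp only [kiteStep0, profParallel, kiteStep2]
      rw [abs_le]
      constructor <;> linarith [st_mem (x - (1 / 8)), st_mem (x - (1 / 4)), st_mem (x - (3 / 8)),
        st_mem (x - (-φ / 2 + 13 / 8)), st_mem (x - (-φ / 2 + 7 / 4)), st_mem (x - (φ - 1 / 4)),
        st_mem (x - (φ - 1 / 8)), st_mem (x - (φ / 2 - 9 / 8)), st_mem (x - (φ / 2 - 5 / 4)),
        st_mem (x - (-φ / 2 + 9 / 8)), st_mem (x - (-φ / 2 + 5 / 4)), st_mem (x - (φ - 3 / 4)),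
        st_mem (x - (φ - 5 / 8)), st_mem (x - (φ / 2 + 5 / 8)), st_mem (x - (φ / 2 + 3 / 4))]
  · refine abs_symFun_le (fun x => ?_) (fun x => ?_) (fun x => ?_) j x <;>
    · simp only [dartStep0, dartStep1, dartStep2]
      rw [abs_le]
      constructor <;> linarith [st_mem (x - (φ - 5 / 4)), st_mem (x - (φ - 9 / 8)),
        st_mem (x - (φ / 2 + 1 / 8)), st_mem (x - (φ / 2 + 1 / 4)), st_mem (x - (φ / 2 + 3 / 8)),
        st_mem (x - (-φ / 2 + 5 / 8)), st_mem (x - (-φ / 2 + 3 / 4)), st_mem (x - (φ / 2 - 3 / 4)),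
        st_mem (x - (φ / 2 - 5 / 8)), st_mem (x - (5 / 8)), st_mem (x - (3 / 4)),
        st_mem (x - (3 * φ / 2 - 5 / 4)), st_mem (x - (3 * φ / 2 - 9 / 8))]

/-! ### Compatibility of tile steps and edge profiles -/

/-- Along an edge, the step function of the tile is the profile of the edge. -/
def EdgeProfile (κ : Kind) (e : Edge) (r : ℝ) (j : ZMod 10) : Prop :=
  tileStep κ j ((protoCorner κ (whiteC κ e) + r * om (off κ e)) * om (-j)).re
    = cl κ (whiteC κ e) 0 j + prof e.isLong (j - off κ e) (r * (om (j - off κ e)).re)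

lemma om_neg_re (j : ZMod 10) : (om (-j)).re = (om j).re := by
  rw [← conj_om, Complex.conj_re]

lemma re_edge (p : ℂ) (r : ℝ) (j d : ZMod 10) :
    ((p + r * om d) * om (-j)).re = (p * om (-j)).re + r * (om (j - d)).re := by
  rw [add_mul, mul_assoc, ← om_add, Complex.add_re, Complex.re_ofReal_mul, ← om_neg_re (j - d)]
  congr 4; ring

lemma edgeProfile_of_pos {κ : Kind} {e : Edge} {r x c : ℝ} {i j : ZMod 10} {N : ℤ} {f g : ℝ → ℝ}
    (hi : j - off κ e = i) (hx : (protoCorner κ (whiteC κ e) * om (-j)).re = x)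
    (hc : (om i).re = c) (hN : cl κ (whiteC κ e) 0 j = N) (hf : tileStep κ j = f)
    (hg : prof e.isLong i = g) (h : f (x + r * c) = N + g (r * c)) : EdgeProfile κ e r j := by
  rw [EdgeProfile, re_edge, hi, hx, hc, hN, hf, hg, h]

/-- The case of an obtuse angle: the coordinate decreases along the edge, and the antisymmetric
extension turns the profile into `-g (-y)`. -/
lemma edgeProfile_of_neg {κ : Kind} {e : Edge} {r x c : ℝ} {i j : ZMod 10} {N : ℤ} {f g : ℝ → ℝ}
    (hi : j - off κ e = i) (hx : (protoCorner κ (whiteC κ e) * om (-j)).re = x)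
    (hc : (om i).re = -c) (hN : cl κ (whiteC κ e) 0 j = N) (hf : tileStep κ j = f)
    (hg : prof e.isLong i = fun y => -g (-y)) (h : f (x - r * c) = N - g (r * c)) :
    EdgeProfile κ e r j := by
  rw [EdgeProfile, re_edge, hi, hx, hc, hN, hf, hg]
  simp only [mul_neg, neg_neg, ← sub_eq_add_neg]
  exact h

/-- In each case `i` is the direction relative to the edge, `x` the coordinate of the white end, `c`
the absolute cosine, and `N` the lift coordinate of the white end. -/
lemma kite_longLeft_profile {r : ℝ} (hr0 : 0 ≤ r) (hr1 : r ≤ len true) (j : ZMod 10)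
    (hj : j = 0 ∨ j = 1 ∨ j = 2 ∨ j = 8 ∨ j = 9) :
    EdgeProfile .kite .longLeft r j := by
  have hp := phi_gt; have hq := phi_sq
  rw [len] at hr1
  rcases hj with rfl | rfl | rfl | rfl | rfl
  · refine edgeProfile_of_pos (i := 9) (x := 0) (c := (φ / 2)) (N := 0) (f := kiteStep0) (g := profLong)
      rfl ?_ ?_ rfl rfl rfl ?_
    · rw [whiteC, protoCorner_tail, show (-0 : ZMod 10) = 0 from rfl, om_zero]; simp
    · rw [om_nine]
    · exact_mod_cast kite_longLeft_0 (v := r * (φ / 2)) (by nlinarith)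
  · refine edgeProfile_of_pos (i := 0) (x := 0) (c := 1) (N := 0) (f := profParallel) (g := profParallel)
      rfl ?_ ?_ rfl rfl rfl ?_
    · rw [whiteC, protoCorner_tail, show (-1 : ZMod 10) = 9 from rfl, om_nine]; simp
    · rw [om_zero]; simp
    · exact_mod_cast kite_longLeft_1 (v := r * 1)
  · refine edgeProfile_of_pos (i := 1) (x := 0) (c := (φ / 2)) (N := 0) (f := kiteStep2) (g := profLong)
      rfl ?_ ?_ rfl rfl rfl ?_
    · rw [whiteC, protoCorner_tail, show (-2 : ZMod 10) = 8 from rfl, om_eight]; simp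
    · rw [om_one]
    · exact_mod_cast kite_longLeft_2 (v := r * (φ / 2)) (by nlinarith)
  · refine edgeProfile_of_neg (i := 7) (x := 0) (c := ((φ - 1) / 2)) (N := 0) (f := kiteStep2) (g := profShort)
      rfl ?_ ?_ rfl rfl rfl ?_
    · rw [whiteC, protoCorner_tail, show (-8 : ZMod 10) = 2 from rfl, om_two]; simp
    · rw [om_seven]; simp; ring
    · exact_mod_cast kite_longLeft_8 (v := r * ((φ - 1) / 2)) (by nlinarith)
  · refine edgeProfile_of_pos (i := 8) (x := 0) (c := ((φ - 1) / 2)) (N := 0) (f := profParallel) (g := profShort)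
      rfl ?_ ?_ rfl rfl rfl ?_
    · rw [whiteC, protoCorner_tail, show (-9 : ZMod 10) = 1 from rfl, om_one]; simp
    · rw [om_eight]
    · exact_mod_cast kite_longLeft_9 (v := r * ((φ - 1) / 2)) (by nlinarith)
lemma kite_shortLeft_profile {r : ℝ} (hr0 : 0 ≤ r) (hr1 : r ≤ len false) (j : ZMod 10)
    (hj : j = 0 ∨ j = 1 ∨ j = 2 ∨ j = 8 ∨ j = 9) :
    EdgeProfile .kite .shortLeft r j := by
  have hp := phi_gt; have hq := phi_sq
  rw [len] at hr1
  rcases hj with rfl | rfl | rfl | rfl | rfl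
  · refine edgeProfile_of_neg (i := 7) (x := φ) (c := ((φ - 1) / 2)) (N := 1) (f := kiteStep0) (g := profCross)
      rfl ?_ ?_ rfl rfl rfl ?_
    · rw [whiteC, protoCorner_front, axis, show (-0 : ZMod 10) = 0 from rfl, om_zero]; simp
    · rw [om_seven]; simp; ring
    · exact_mod_cast kite_shortLeft_0 (v := r * ((φ - 1) / 2)) (by nlinarith)
  · refine edgeProfile_of_pos (i := 8) (x := φ / 2 + 1 / 2) (c := ((φ - 1) / 2)) (N := 0) (f := profParallel) (g := profCross)
      rfl ?_ ?_ rfl rfl rfl ?_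
    · rw [whiteC, protoCorner_front, axis, show (-1 : ZMod 10) = 9 from rfl, om_nine]; simp; linarith
    · rw [om_eight]
    · exact_mod_cast kite_shortLeft_1 (v := r * ((φ - 1) / 2)) (by nlinarith)
  · refine edgeProfile_of_pos (i := 9) (x := 1 / 2) (c := (φ / 2)) (N := 1) (f := kiteStep2) (g := profShort)
      rfl ?_ ?_ rfl rfl rfl ?_
    · rw [whiteC, protoCorner_front, axis, show (-2 : ZMod 10) = 8 from rfl, om_eight]; simp; linarith
    · rw [om_nine]
    · exact_mod_cast kite_shortLeft_2 (v := r * (φ / 2)) (by nlinarith)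
  · refine edgeProfile_of_neg (i := 5) (x := 1 / 2) (c := 1) (N := 1) (f := kiteStep2) (g := profLong)
      rfl ?_ ?_ rfl rfl rfl ?_
    · rw [whiteC, protoCorner_front, axis, show (-8 : ZMod 10) = 2 from rfl, om_two]; simp; linarith
    · rw [om_five]; simp
    · exact_mod_cast kite_shortLeft_8 (v := r * 1) (by nlinarith)
  · refine edgeProfile_of_neg (i := 6) (x := φ / 2 + 1 / 2) (c := (φ / 2)) (N := 0) (f := profParallel) (g := profShort)
      rfl ?_ ?_ rfl rfl rfl ?_
    · rw [whiteC, protoCorner_front, axis, show (-9 : ZMod 10) = 1 from rfl, om_one]; simp; linarith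
    · rw [om_six]; simp; ring
    · exact_mod_cast kite_shortLeft_9 (v := r * (φ / 2)) (by nlinarith) (by nlinarith)
lemma dart_longLeft_profile {r : ℝ} (hr0 : 0 ≤ r) (hr1 : r ≤ len true) (j : ZMod 10)
    (hj : j = 0 ∨ j = 1 ∨ j = 2 ∨ j = 8 ∨ j = 9) :
    EdgeProfile .dart .longLeft r j := by
  have hp := phi_gt; have hq := phi_sq
  rw [len] at hr1
  rcases hj with rfl | rfl | rfl | rfl | rfl
  · refine edgeProfile_of_neg (i := 4) (x := φ / 2 + 1 / 2) (c := (φ / 2)) (N := 1) (f := dartStep0) (g := profLong)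
      rfl ?_ ?_ rfl rfl rfl ?_
    · rw [whiteC, protoCorner_left, show (-0 : ZMod 10) = 0 from rfl, om_zero]; simp; linarith
    · rw [om_four]; simp; ring
    · exact_mod_cast dart_longLeft_0 (v := r * (φ / 2))
  · refine edgeProfile_of_neg (i := 5) (x := φ) (c := 1) (N := 0) (f := dartStep1) (g := profParallel)
      rfl ?_ ?_ rfl rfl rfl ?_
    · rw [whiteC, protoCorner_left, show (-1 : ZMod 10) = 9 from rfl, om_nine]; simp; linear_combination (φ - 1) * sg_sq + (1 / 2 : ℝ) * phi_sq
    · rw [om_five]; simp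
    · exact_mod_cast dart_longLeft_1 (v := r * 1)
  · refine edgeProfile_of_neg (i := 6) (x := φ / 2 + 1 / 2) (c := (φ / 2)) (N := 1) (f := dartStep2) (g := profLong)
      rfl ?_ ?_ rfl rfl rfl ?_
    · rw [whiteC, protoCorner_left, show (-2 : ZMod 10) = 8 from rfl, om_eight]; simp; linear_combination sg_sq + (1 / 4 : ℝ) * phi_sq
    · rw [om_six]; simp; ring
    · exact_mod_cast dart_longLeft_2 (v := r * (φ / 2)) (by nlinarith)
  · refine edgeProfile_of_pos (i := 2) (x := -1 / 2) (c := ((φ - 1) / 2)) (N := 0) (f := dartStep2) (g := profShort)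
      rfl ?_ ?_ rfl rfl rfl ?_
    · rw [whiteC, protoCorner_left, show (-8 : ZMod 10) = 2 from rfl, om_two]; simp; linear_combination (1 / 4 : ℝ) * phi_sq - sg_sq
    · rw [om_two]
    · exact_mod_cast dart_longLeft_8 (v := r * ((φ - 1) / 2)) (by nlinarith)
  · refine edgeProfile_of_neg (i := 3) (x := 1 / 2) (c := ((φ - 1) / 2)) (N := 0) (f := dartStep1) (g := profShort)
      rfl ?_ ?_ rfl rfl rfl ?_
    · rw [whiteC, protoCorner_left, show (-9 : ZMod 10) = 1 from rfl, om_one]; simp; linear_combination -(φ - 1) * sg_sq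
    · rw [om_three]; simp; ring
    · exact_mod_cast dart_longLeft_9 (v := r * ((φ - 1) / 2)) (by nlinarith)
lemma dart_shortLeft_profile {r : ℝ} (hr0 : 0 ≤ r) (hr1 : r ≤ len false) (j : ZMod 10)
    (hj : j = 0 ∨ j = 1 ∨ j = 2 ∨ j = 8 ∨ j = 9) :
    EdgeProfile .dart .shortLeft r j := by
  have hp := phi_gt; have hq := phi_sq
  rw [len] at hr1
  rcases hj with rfl | rfl | rfl | rfl | rfl
  · refine edgeProfile_of_neg (i := 3) (x := φ / 2 + 1 / 2) (c := ((φ - 1) / 2)) (N := 1) (f := dartStep0) (g := profCross)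
      rfl ?_ ?_ rfl rfl rfl ?_
    · rw [whiteC, protoCorner_left, show (-0 : ZMod 10) = 0 from rfl, om_zero]; simp; linarith
    · rw [om_three]; simp; ring
    · exact_mod_cast dart_shortLeft_0 (v := r * ((φ - 1) / 2)) (by nlinarith)
  · refine edgeProfile_of_neg (i := 4) (x := φ) (c := (φ / 2)) (N := 0) (f := dartStep1) (g := profShort)
      rfl ?_ ?_ rfl rfl rfl ?_
    · rw [whiteC, protoCorner_left, show (-1 : ZMod 10) = 9 from rfl, om_nine]; simp; linear_combination (φ - 1) * sg_sq + (1 / 2 : ℝ) * phi_sq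
    · rw [om_four]; simp; ring
    · exact_mod_cast dart_shortLeft_1 (v := r * (φ / 2)) (by nlinarith)
  · refine edgeProfile_of_neg (i := 5) (x := φ / 2 + 1 / 2) (c := 1) (N := 1) (f := dartStep2) (g := profLong)
      rfl ?_ ?_ rfl rfl rfl ?_
    · rw [whiteC, protoCorner_left, show (-2 : ZMod 10) = 8 from rfl, om_eight]; simp; linear_combination sg_sq + (1 / 4 : ℝ) * phi_sq
    · rw [om_five]; simp
    · exact_mod_cast dart_shortLeft_2 (v := r * 1) (by nlinarith)
  · refine edgeProfile_of_pos (i := 1) (x := -1 / 2) (c := (φ / 2)) (N := 0) (f := dartStep2) (g := profShort)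
      rfl ?_ ?_ rfl rfl rfl ?_
    · rw [whiteC, protoCorner_left, show (-8 : ZMod 10) = 2 from rfl, om_two]; simp; linear_combination (1 / 4 : ℝ) * phi_sq - sg_sq
    · rw [om_one]
    · exact_mod_cast dart_shortLeft_8 (v := r * (φ / 2)) (by nlinarith)
  · refine edgeProfile_of_pos (i := 2) (x := 1 / 2) (c := ((φ - 1) / 2)) (N := 0) (f := dartStep1) (g := profCross)
      rfl ?_ ?_ rfl rfl rfl ?_
    · rw [whiteC, protoCorner_left, show (-9 : ZMod 10) = 1 from rfl, om_one]; simp; linear_combination -(φ - 1) * sg_sq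
    · rw [om_two]
    · exact_mod_cast dart_shortLeft_9 (v := r * ((φ - 1) / 2)) (by nlinarith) (by nlinarith)

/-- The mirror image of an edge. -/
def Edge.mirror : Edge → Edge
  | .longLeft => .longRight
  | .longRight => .longLeft
  | .shortLeft => .shortRight
  | .shortRight => .shortLeft

/-- The reflection in the axis is complex conjugation; it exchanges left and right edges and negates
the directions. -/
lemma EdgeProfile.mirror {κ : Kind} {e : Edge} {r : ℝ} {j : ZMod 10} (h : EdgeProfile κ e r (-j)) :
    EdgeProfile κ e.mirror r j := by
  have ho : off κ e.mirror = -off κ e := by cases κ <;> cases e <;> rfl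
  have hl : e.mirror.isLong = e.isLong := by cases e <;> rfl
  have hc : cl κ (whiteC κ e.mirror) 0 j = cl κ (whiteC κ e) 0 (-j) := by
    clear h
    cases κ <;> cases e <;> simp only [cl, whiteC, Edge.mirror] <;> revert j <;> decide
  have hp : protoCorner κ (whiteC κ e.mirror)
      = (starRingEnd ℂ) (protoCorner κ (whiteC κ e)) := by
    cases κ <;> cases e <;> simp [whiteC, Edge.mirror, protoCorner_tail, protoCorner_front,
      protoCorner_left, protoCorner_right, Complex.ext_iff]
  have hre : ∀ z : ℂ, ((starRingEnd ℂ) z).re = z.re := Complex.conj_re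
  unfold EdgeProfile at h ⊢
  rw [ho, hl, hc, hp, sub_neg_eq_add, ← tileStep_neg κ j]
  have e1 : -j - off κ e = -(j + off κ e) := by ring
  rw [e1, om_neg_re, prof_neg] at h
  rw [← h, ← hre, map_mul, map_add, map_mul, Complex.conj_ofReal, conj_om, conj_om,
    Complex.conj_conj, neg_neg]

/-- Reversing the direction negates coordinates, lifts and heights alike. -/
lemma EdgeProfile.add_five {κ : Kind} {e : Edge} {r : ℝ} {j : ZMod 10} (h : EdgeProfile κ e r j) :
    EdgeProfile κ e r (j + 5) := by
  unfold EdgeProfile at h ⊢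
  have e1 : om (-(j + 5)) = -om (-j) := by
    rw [← om_add_five]; apply om_eq_of_eq; clear h; revert j; decide
  have e2 : j + 5 - off κ e = (j - off κ e) + 5 := by ring
  rw [e1, e2, om_add_five, tileStep_add_five, prof_add_five, mul_neg, Complex.neg_re, neg_neg, h,
    anti_cl κ _ 0 j, Complex.neg_re, mul_neg, neg_neg]
  push_cast
  ring

lemma edgeProfile (κ : Kind) (e : Edge) {r : ℝ} (h0 : 0 ≤ r) (h1 : r ≤ len e.isLong)
    (j : ZMod 10) : EdgeProfile κ e r j := by
  have key : ∀ (κ : Kind) (e : Edge), e = .longLeft ∨ e = .shortLeft → r ≤ len e.isLong →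
      ∀ j : ZMod 10, EdgeProfile κ e r j := by
    intro κ e he h1 j
    -- Every direction, or its opposite, is within 72° of the axis.
    have hj : (j = 0 ∨ j = 1 ∨ j = 2 ∨ j = 8 ∨ j = 9) ∨
      (j - 5 = 0 ∨ j - 5 = 1 ∨ j - 5 = 2 ∨ j - 5 = 8 ∨ j - 5 = 9) := by revert j; decide
    have base : ∀ j : ZMod 10, (j = 0 ∨ j = 1 ∨ j = 2 ∨ j = 8 ∨ j = 9) → EdgeProfile κ e r j := by
      intro j hj
      rcases he with rfl | rfl <;> cases κ
      · exact kite_longLeft_profile h0 h1 j hj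
      · exact dart_longLeft_profile h0 h1 j hj
      · exact kite_shortLeft_profile h0 h1 j hj
      · exact dart_shortLeft_profile h0 h1 j hj
    rcases hj with hj | hj
    · exact base j hj
    · have := (base _ hj).add_five
      rwa [sub_add_cancel] at this
  cases e
  · exact key κ _ (Or.inl rfl) h1 j
  · exact (key κ .longLeft (Or.inl rfl) h1 (-j)).mirror
  · exact key κ _ (Or.inr rfl) h1 j
  · exact (key κ .shortLeft (Or.inr rfl) h1 (-j)).mirror

/-! ### The shape of a tile -/

/-- Nonnegative on the side of the long edges on which the tile lies. -/
def longForm (w : ℂ) : ℝ := w.re * sg - |w.im| * ((φ + 1) / 2)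

/-- Nonnegative on the side of the short edges on which the tile lies. -/
def shortForm (κ : Kind) (w : ℂ) : ℝ :=
  axis κ * sg + |w.im| * ((φ + 1) / 2 - axis κ) - w.re * sg

/-- The region of a prototile, by inequalities. -/
def protoRegion (κ : Kind) : Set ℂ := {w | 0 ≤ longForm w ∧ 0 ≤ shortForm κ w}

/-- The interior of a prototile, by inequalities. -/
def protoInt (κ : Kind) : Set ℂ := {w | 0 < longForm w ∧ 0 < shortForm κ w}

lemma continuous_longForm : Continuous longForm := by unfold longForm; fun_prop

lemma continuous_shortForm (κ : Kind) : Continuous (shortForm κ) := by unfold shortForm; fun_prop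

lemma isClosed_protoRegion (κ : Kind) : IsClosed (protoRegion κ) :=
  (isClosed_le continuous_const continuous_longForm).inter
    (isClosed_le continuous_const (continuous_shortForm κ))

lemma isOpen_protoInt (κ : Kind) : IsOpen (protoInt κ) :=
  (isOpen_lt continuous_const continuous_longForm).inter
    (isOpen_lt continuous_const (continuous_shortForm κ))

lemma protoInt_subset (κ : Kind) : protoInt κ ⊆ protoRegion κ := fun _ h => ⟨h.1.le, h.2.le⟩

lemma one_le_axis (κ : Kind) : 1 ≤ axis κ := by
  have := phi_gt
  cases κ <;> simp only [axis] <;> linarith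

lemma axis_le (κ : Kind) : axis κ ≤ φ := by
  have := phi_gt
  cases κ <;> simp only [axis] <;> linarith

lemma mem_convexHull_triple {a b c z : ℂ} :
    z ∈ convexHull ℝ {a, b, c} ↔ ∃ α β γ : ℝ, 0 ≤ α ∧ 0 ≤ β ∧ 0 ≤ γ ∧ α + β + γ = 1 ∧
      (α : ℂ) * a + β * b + γ * c = z := by
  rw [convexHull_insert (by simp), convexHull_pair]
  simp only [mem_convexJoin, Set.mem_singleton_iff, exists_eq_left]
  constructor
  · rintro ⟨y, ⟨s, t, hs, ht, hst, rfl⟩, u, v, hu, hv, huv, rfl⟩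
    refine ⟨u, v * s, v * t, hu, mul_nonneg hv hs, mul_nonneg hv ht, ?_, ?_⟩
    · rw [add_assoc, ← mul_add, hst, mul_one, huv]
    · simp only [Complex.real_smul]; push_cast; ring
  · rintro ⟨α, β, γ, hα, hβ, hγ, hs, rfl⟩
    rcases eq_or_lt_of_le (add_nonneg hβ hγ) with h | h
    · have h1 : β = 0 := by linarith
      have h2 : γ = 0 := by linarith
      have h3 : α = 1 := by linarith
      subst h1 h2 h3
      exact ⟨b, left_mem_segment _ _ _, by simpa using left_mem_segment ℝ a b⟩
    · refine ⟨((β / (β + γ) : ℝ) : ℂ) * b + ((γ / (β + γ) : ℝ) : ℂ) * c,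
        ⟨β / (β + γ), γ / (β + γ), by positivity, by positivity, by field_simp, ?_⟩,
        α, β + γ, hα, h.le, by linarith, ?_⟩
      · simp only [Complex.real_smul]
      · have h' : ((β : ℂ) + γ) ≠ 0 := by exact_mod_cast h.ne'
        simp only [Complex.real_smul]; push_cast; field_simp; ring

/-- The barycentric weights are `τ * w.im / sg` at the side corner and then the remaining real part
divided by the axis length at the front. With `|w.im|` in the forms, the same two inequalities
describe both halves, also for the non-convex dart. -/
lemma mem_half_iff {κ : Kind} {w : ℂ} {τ : ℝ} (hτ : τ = 1 ∨ τ = -1) :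
    w ∈ convexHull ℝ {(0 : ℂ), ⟨(φ + 1) / 2, τ * sg⟩, (axis κ : ℂ)} ↔
      0 ≤ τ * w.im ∧ w ∈ protoRegion κ := by
  have hs := sg_pos
  have ha := one_le_axis κ
  have ha' : 0 < axis κ := by linarith
  have hττ : τ * τ = 1 := by rcases hτ with rfl | rfl <;> norm_num
  rw [mem_convexHull_triple]
  change _ ↔ _ ∧ 0 ≤ longForm w ∧ 0 ≤ shortForm κ w
  have habs : ∀ y : ℝ, 0 ≤ τ * y → |y| = τ * y := by
    intro y hy
    rcases hτ with rfl | rfl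
    · rw [one_mul] at hy ⊢; exact abs_of_nonneg hy
    · rw [abs_of_nonpos (by linarith)]; ring
  constructor
  · rintro ⟨α, β, γ, hα, hβ, hγ, hsum, rfl⟩
    have hre : ((α : ℂ) * 0 + β * (⟨(φ + 1) / 2, τ * sg⟩ : ℂ) + γ * (axis κ : ℂ)).re
        = β * ((φ + 1) / 2) + γ * axis κ := by simp
    have him : ((α : ℂ) * 0 + β * (⟨(φ + 1) / 2, τ * sg⟩ : ℂ) + γ * (axis κ : ℂ)).im
        = β * (τ * sg) := by simp
    have hnn : τ * (β * (τ * sg)) = β * sg := by linear_combination β * sg * hττ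
    have h0 : 0 ≤ τ * (β * (τ * sg)) := by rw [hnn]; positivity
    refine ⟨by rw [him]; exact h0, ?_, ?_⟩
    · rw [longForm, hre, him, habs _ h0, hnn]
      have : 0 ≤ γ * axis κ * sg := by positivity
      linarith
    · rw [shortForm, hre, him, habs _ h0, hnn]
      have : 0 ≤ α * (axis κ * sg) := by positivity
      have e : α = 1 - β - γ := by linarith
      rw [e] at this
      linarith
  · rintro ⟨h0, h1, h2⟩
    rw [longForm, habs _ h0] at h1
    rw [shortForm, habs _ h0] at h2
    have hβ : 0 ≤ τ * w.im / sg := by positivity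
    have hγ : 0 ≤ (w.re - τ * w.im / sg * ((φ + 1) / 2)) / axis κ := by
      apply div_nonneg _ ha'.le
      have : w.re - τ * w.im / sg * ((φ + 1) / 2)
        = (w.re * sg - τ * w.im * ((φ + 1) / 2)) / sg := by field_simp
      rw [this]; positivity
    refine ⟨1 - τ * w.im / sg - (w.re - τ * w.im / sg * ((φ + 1) / 2)) / axis κ, _, _, ?_, hβ, hγ,
      by ring, ?_⟩
    · have : 1 - τ * w.im / sg - (w.re - τ * w.im / sg * ((φ + 1) / 2)) / axis κ
        = (axis κ * sg + τ * w.im * ((φ + 1) / 2 - axis κ) - w.re * sg) / (sg * axis κ) := by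
        field_simp; ring
      rw [this]; positivity
    · apply Complex.ext
      · simp only [mul_zero, Complex.add_re, Complex.zero_re, Complex.re_ofReal_mul,
          Complex.ofReal_re]
        field_simp; ring
      · simp only [mul_zero, Complex.add_im, Complex.zero_im, Complex.im_ofReal_mul,
          Complex.ofReal_im]
        field_simp
        linear_combination w.im * hττ

namespace Tile

/-- The coordinate of a point in the frame of a tile. -/
def loc (t : Tile) (z : ℂ) : ℂ := (starRingEnd ℂ) (t.rot : ℂ) * (z - t.shift)

lemma rot_mul_conj (t : Tile) : (t.rot : ℂ) * (starRingEnd ℂ) (t.rot : ℂ) = 1 := by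
  rw [Complex.mul_conj, Complex.normSq_eq_norm_sq, Circle.norm_coe]; simp

lemma conj_mul_rot (t : Tile) : (starRingEnd ℂ) (t.rot : ℂ) * (t.rot : ℂ) = 1 := by
  rw [mul_comm, rot_mul_conj]

lemma rot_mul_loc (t : Tile) (z : ℂ) : (t.rot : ℂ) * t.loc z + t.shift = z := by
  rw [loc, ← mul_assoc, rot_mul_conj]; ring

lemma loc_mul (t : Tile) (w : ℂ) : t.loc ((t.rot : ℂ) * w + t.shift) = w := by
  rw [loc, add_sub_cancel_right, ← mul_assoc, conj_mul_rot, one_mul]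

lemma loc_corner (t : Tile) (c : Corner) : t.loc (t.corner c) = protoCorner t.kind c :=
  loc_mul _ _

lemma continuous_loc (t : Tile) : Continuous t.loc := by unfold loc; fun_prop

lemma mem_half (t : Tile) (z : ℂ) (c : Corner) :
    z ∈ convexHull ℝ {t.corner .tail, t.corner c, t.corner .front} ↔
      t.loc z ∈ convexHull ℝ {(0 : ℂ), protoCorner t.kind c, (axis t.kind : ℂ)} := by
  rw [mem_convexHull_triple, mem_convexHull_triple]
  have ht : protoCorner t.kind .tail = 0 := protoCorner_tail _
  have hf : protoCorner t.kind .front = axis t.kind := protoCorner_front _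
  simp only [corner, ht, hf]
  refine exists_congr fun α => exists_congr fun β => exists_congr fun γ => ?_
  refine and_congr_right fun _ => and_congr_right fun _ => and_congr_right fun _ =>
    and_congr_right fun hs => ?_
  have hs' : (α : ℂ) + β + γ = 1 := by exact_mod_cast hs
  constructor
  · intro h
    rw [← h, ← loc_mul t ((α : ℂ) * 0 + β * protoCorner t.kind c + γ * (axis t.kind : ℂ))]
    congr 1
    linear_combination (-t.shift) * hs'
  · intro h
    rw [← rot_mul_loc t z, ← h]
    linear_combination t.shift * hs'

lemma mem_region {t : Tile} {z : ℂ} : z ∈ t.region ↔ t.loc z ∈ protoRegion t.kind := by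
  rw [region, Set.mem_union, mem_half, mem_half, protoCorner_left, protoCorner_right]
  have h1 := mem_half_iff (κ := t.kind) (w := t.loc z) (τ := 1) (Or.inl rfl)
  have h2 := mem_half_iff (κ := t.kind) (w := t.loc z) (τ := -1) (Or.inr rfl)
  rw [one_mul, one_mul] at h1
  rw [neg_one_mul, neg_one_mul] at h2
  rw [h1, h2, ← or_and_right]
  refine and_iff_right ?_
  rcases le_total 0 (t.loc z).im with h | h
  · exact Or.inl h
  · exact Or.inr (by linarith)

lemma isClosed_region (t : Tile) : IsClosed t.region := by
  have : t.region = t.loc ⁻¹' protoRegion t.kind := by ext z; exact mem_region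
  rw [this]
  exact (isClosed_protoRegion _).preimage t.continuous_loc

lemma mem_interior {t : Tile} {z : ℂ} (h : t.loc z ∈ protoInt t.kind) : z ∈ interior t.region := by
  rw [_root_.mem_interior]
  exact ⟨t.loc ⁻¹' protoInt t.kind, fun z hz => mem_region.2 (protoInt_subset _ hz),
    (isOpen_protoInt _).preimage t.continuous_loc, h⟩

lemma norm_loc_sub (t : Tile) (z w : ℂ) : ‖t.loc z - t.loc w‖ = ‖z - w‖ := by
  rw [loc, loc, ← mul_sub, norm_mul, RCLike.norm_conj, Circle.norm_coe, one_mul]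
  congr 1; ring

/-- The midpoint of the axis. -/
def center (t : Tile) : ℂ := (t.rot : ℂ) * ((axis t.kind / 2 : ℝ) : ℂ) + t.shift

lemma loc_center (t : Tile) : t.loc t.center = ((axis t.kind / 2 : ℝ) : ℂ) := loc_mul _ _

/-- A tile is star-shaped about the midpoint of its axis: sliding a point towards it makes both
defining inequalities strict. -/
lemma mem_closure_interior {t : Tile} {z : ℂ} (h : z ∈ t.region) :
    z ∈ closure (interior t.region) := by
  have hs := sg_pos
  have ha := one_le_axis t.kind
  rw [mem_region] at h
  have hc : Continuous fun ε : ℝ => ((1 - ε : ℝ) : ℂ) * z + (ε : ℂ) * t.center := by fun_prop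
  have ht : Tendsto (fun ε : ℝ => ((1 - ε : ℝ) : ℂ) * z + (ε : ℂ) * t.center) (𝓝[>] 0) (𝓝 z) := by
    have := hc.tendsto 0
    simp only [sub_zero, Complex.ofReal_one, one_mul, Complex.ofReal_zero, zero_mul,
      add_zero] at this
    exact this.mono_left nhdsWithin_le_nhds
  refine mem_closure_of_tendsto ht ?_
  filter_upwards [Ioo_mem_nhdsGT (show (0 : ℝ) < 1 by norm_num)] with ε hε
  apply mem_interior
  have e : t.loc (((1 - ε : ℝ) : ℂ) * z + (ε : ℂ) * t.center)
      = ((1 - ε : ℝ) : ℂ) * t.loc z + (ε : ℂ) * ((axis t.kind / 2 : ℝ) : ℂ) := by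
    rw [← loc_center]; simp only [loc]; push_cast; ring
  have e1 : 0 < 1 - ε := by linarith [hε.2]
  have him : (((1 - ε : ℝ) : ℂ) * t.loc z + (ε : ℂ) * ((axis t.kind / 2 : ℝ) : ℂ)).im
      = (1 - ε) * (t.loc z).im := by
    simp only [Complex.add_im, Complex.im_ofReal_mul, Complex.ofReal_im]; ring
  have hre : (((1 - ε : ℝ) : ℂ) * t.loc z + (ε : ℂ) * ((axis t.kind / 2 : ℝ) : ℂ)).re
      = (1 - ε) * (t.loc z).re + ε * (axis t.kind / 2) := by
    simp only [Complex.add_re, Complex.re_ofReal_mul, Complex.ofReal_re]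
  have hp : 0 < ε * (axis t.kind * sg / 2) := by
    have := hε.1; positivity
  rw [e]
  constructor
  · have := mul_nonneg e1.le h.1
    rw [longForm] at this ⊢
    rw [him, hre, abs_mul, abs_of_pos e1]
    linarith
  · have := mul_nonneg e1.le h.2
    rw [shortForm] at this ⊢
    rw [him, hre, abs_mul, abs_of_pos e1]
    linarith

/-- In the frame of the tile, `0 ≤ re ≤ φ` and `|im| ≤ sg`, and `φ² + sg² < 4`. -/
lemma dist_shift_le {t : Tile} {z : ℂ} (h : z ∈ t.region) : dist z t.shift ≤ 2 := by
  rw [mem_region] at h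
  have h1 := sg_gt; have h2 := sg_lt; have h3 := phi_gt; have h4 := phi_lt
  have hn : ‖t.loc z‖ = dist z t.shift := by
    rw [loc, norm_mul, RCLike.norm_conj, Circle.norm_coe, one_mul, dist_eq_norm]
  rw [← hn]
  obtain ⟨a, b⟩ := h
  have ha := one_le_axis t.kind
  have ha' := axis_le t.kind
  simp only [longForm, shortForm] at a b
  have hy : |(t.loc z).im| ≤ sg := by
    have : |(t.loc z).im| * axis t.kind ≤ sg * axis t.kind := by linarith
    exact le_of_mul_le_mul_right this (by linarith)
  have hy0 := abs_nonneg (t.loc z).im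
  have hx : (t.loc z).re ≤ φ := by
    have : (t.loc z).re * sg ≤ φ * sg := by nlinarith
    exact le_of_mul_le_mul_right this (by linarith)
  have hx0 : 0 ≤ (t.loc z).re := by
    have : 0 ≤ (t.loc z).re * sg := by nlinarith
    exact nonneg_of_mul_nonneg_left this (by linarith)
  rw [← abs_of_nonneg (norm_nonneg (t.loc z)), ← abs_of_pos (show (0 : ℝ) < 2 by norm_num),
    ← sq_le_sq, ← Complex.normSq_eq_norm_sq, Complex.normSq_apply]
  have : (t.loc z).im * (t.loc z).im = |(t.loc z).im| * |(t.loc z).im| := (abs_mul_abs_self _).symm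
  rw [this]
  nlinarith

lemma ball_subset_interior (t : Tile) : Metric.ball t.center (1 / 8) ⊆ interior t.region := by
  intro z hz
  apply mem_interior
  have h1 := sg_gt; have h2 := sg_lt; have h3 := phi_gt; have h4 := phi_lt
  rw [Metric.mem_ball, dist_eq_norm, ← norm_loc_sub t, loc_center] at hz
  have ha := one_le_axis t.kind
  have ha' := axis_le t.kind
  have hre := (Complex.abs_re_le_norm (t.loc z - ((axis t.kind / 2 : ℝ) : ℂ))).trans_lt hz
  have him := (Complex.abs_im_le_norm (t.loc z - ((axis t.kind / 2 : ℝ) : ℂ))).trans_lt hz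
  rw [Complex.sub_re, Complex.ofReal_re, abs_lt] at hre
  rw [Complex.sub_im, Complex.ofReal_im, sub_zero] at him
  have hy0 := abs_nonneg (t.loc z).im
  constructor
  · rw [longForm]; nlinarith
  · rw [shortForm]; nlinarith

end Tile

/-! ### The edges of a tile -/

/-- The point at distance `r` from the white end of an edge of a prototile. -/
def protoEdge (κ : Kind) (e : Edge) (r : ℝ) : ℂ := protoCorner κ (whiteC κ e) + r * om (off κ e)

/-- `1` on the left side of the axis, `-1` on the right side. -/
def Edge.side : Edge → ℝ
  | .longLeft => 1
  | .longRight => -1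
  | .shortLeft => 1
  | .shortRight => -1

/-- The parameter of a point of an edge, from the axis to the side corner. -/
def edgeParam : Kind → Edge → ℝ → ℝ
  | .kite, .longLeft, r => r * (φ - 1)
  | .kite, .longRight, r => r * (φ - 1)
  | .kite, .shortLeft, r => r
  | .kite, .shortRight, r => r
  | .dart, .longLeft, r => 1 - r * (φ - 1)
  | .dart, .longRight, r => 1 - r * (φ - 1)
  | .dart, .shortLeft, r => 1 - r
  | .dart, .shortRight, r => 1 - r

lemma protoEdge_im (κ : Kind) (e : Edge) (r : ℝ) :
    (protoEdge κ e r).im = e.side * (edgeParam κ e r * sg) := by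
  cases κ <;> cases e <;> simp only [protoEdge, whiteC, off, protoCorner_tail, protoCorner_front,
    protoCorner_left, protoCorner_right, om_one, om_nine, om_three, om_seven, om_six, om_four,
    Edge.side, edgeParam] <;> simp <;> ring

lemma protoEdge_re_long (κ : Kind) {e : Edge} (he : e.isLong = true) (r : ℝ) :
    (protoEdge κ e r).re = edgeParam κ e r * ((φ + 1) / 2) := by
  cases κ <;> cases e <;> simp only [Edge.isLong, Bool.false_eq_true] at he <;>
    simp only [protoEdge, whiteC, off, protoCorner_tail, protoCorner_left, protoCorner_right,
      om_one, om_nine, om_six, om_four, edgeParam] <;> simp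
  · linear_combination (-r / 2) * phi_sq
  · linear_combination (-r / 2) * phi_sq
  · linear_combination (r / 2) * phi_sq
  · linear_combination (r / 2) * phi_sq

lemma protoEdge_re_short (κ : Kind) {e : Edge} (he : e.isLong = false) (r : ℝ) :
    (protoEdge κ e r).re = axis κ + edgeParam κ e r * ((φ + 1) / 2 - axis κ) := by
  cases κ <;> cases e <;> simp only [Edge.isLong, Bool.true_eq_false] at he <;>
    simp only [protoEdge, whiteC, off, protoCorner_front, protoCorner_left, protoCorner_right,
      om_three, om_seven, edgeParam, axis, Complex.add_re, Complex.re_ofReal_mul,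
      Complex.ofReal_re] <;> ring

lemma edgeParam_mem {κ : Kind} {e : Edge} {r : ℝ} (h0 : 0 ≤ r) (h1 : r ≤ len e.isLong) :
    0 ≤ edgeParam κ e r ∧ edgeParam κ e r ≤ 1 := by
  have h3 := phi_gt; have h4 := phi_sq
  cases κ <;> cases e <;> simp only [edgeParam, Edge.isLong, len] at h1 ⊢ <;>
    constructor <;> nlinarith

lemma edgeParam_mem_open {κ : Kind} {e : Edge} {r : ℝ} (h0 : 0 < r) (h1 : r < len e.isLong) :
    0 < edgeParam κ e r ∧ edgeParam κ e r < 1 := by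
  have h3 := phi_gt; have h4 := phi_sq
  cases κ <;> cases e <;> simp only [edgeParam, Edge.isLong, len] at h1 ⊢ <;>
    constructor <;> nlinarith

lemma exists_edgeParam {κ : Kind} {e : Edge} {s : ℝ} (h0 : 0 ≤ s) (h1 : s ≤ 1) :
    ∃ r, 0 ≤ r ∧ r ≤ len e.isLong ∧ edgeParam κ e r = s := by
  have h3 := phi_gt; have h4 := phi_sq
  have a : s * φ * (φ - 1) = s := by linear_combination s * h4
  have b : 1 - (1 - s) * φ * (φ - 1) = s := by linear_combination (s - 1) * h4
  cases κ <;> cases e <;> simp only [edgeParam, Edge.isLong, len]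
  · exact ⟨s * φ, by positivity, by nlinarith, a⟩
  · exact ⟨s * φ, by positivity, by nlinarith, a⟩
  · exact ⟨s, h0, h1, rfl⟩
  · exact ⟨s, h0, h1, rfl⟩
  · exact ⟨(1 - s) * φ, by nlinarith, by nlinarith, b⟩
  · exact ⟨(1 - s) * φ, by nlinarith, by nlinarith, b⟩
  · exact ⟨1 - s, by linarith, by linarith, by ring⟩
  · exact ⟨1 - s, by linarith, by linarith, by ring⟩

lemma Edge.side_eq (e : Edge) : e.side = 1 ∨ e.side = -1 := by cases e <;> simp [Edge.side]

lemma abs_protoEdge_im {κ : Kind} {e : Edge} {r : ℝ} (h : 0 ≤ edgeParam κ e r) :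
    |(protoEdge κ e r).im| = edgeParam κ e r * sg := by
  have := sg_pos
  rw [protoEdge_im, abs_mul]
  rcases e.side_eq with h1 | h1 <;> rw [h1] <;> simp [abs_of_nonneg, h, this.le]

lemma protoEdge_mem {κ : Kind} {e : Edge} {r : ℝ} (h0 : 0 ≤ r) (h1 : r ≤ len e.isLong) :
    protoEdge κ e r ∈ protoRegion κ := by
  have hp := edgeParam_mem (κ := κ) h0 h1
  have hs := sg_pos
  have ha := one_le_axis κ
  have hx : 0 ≤ (1 - edgeParam κ e r) * (axis κ * sg) := by
    have := hp.2; apply mul_nonneg <;> nlinarith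
  cases h : e.isLong
  · constructor
    · rw [longForm, abs_protoEdge_im hp.1, protoEdge_re_short κ h]; linarith
    · rw [shortForm, abs_protoEdge_im hp.1, protoEdge_re_short κ h]; apply le_of_eq; ring
  · constructor
    · rw [longForm, abs_protoEdge_im hp.1, protoEdge_re_long κ h]; apply le_of_eq; ring
    · rw [shortForm, abs_protoEdge_im hp.1, protoEdge_re_long κ h]; linarith

/-- A point of a prototile is an interior point or lies on an edge. -/
lemma protoRegion_cases {κ : Kind} {w : ℂ} (h : w ∈ protoRegion κ) :
    w ∈ protoInt κ ∨ ∃ e r, 0 ≤ r ∧ r ≤ len e.isLong ∧ w = protoEdge κ e r := by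
  have hs := sg_pos
  have ha := one_le_axis κ
  obtain ⟨h1, h2⟩ := h
  by_cases h3 : w ∈ protoInt κ
  · exact Or.inl h3
  right
  have hy : |w.im| ≤ sg := by
    rw [longForm] at h1; rw [shortForm] at h2
    have : |w.im| * axis κ ≤ sg * axis κ := by linarith
    exact le_of_mul_le_mul_right this (by linarith)
  have hs0 : 0 ≤ |w.im| / sg := by positivity
  have hs1 : |w.im| / sg ≤ 1 := by rwa [div_le_one hs]
  have hc : longForm w = 0 ∨ shortForm κ w = 0 := by
    by_contra hc
    rw [not_or] at hc
    exact h3 ⟨lt_of_le_of_ne h1 (Ne.symm hc.1), lt_of_le_of_ne h2 (Ne.symm hc.2)⟩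
  have hsd : ∀ b, ∃ e : Edge, e.isLong = b ∧ e.side * |w.im| = w.im := by
    intro b
    rcases le_total 0 w.im with h | h
    · cases b
      · exact ⟨.shortLeft, rfl, by rw [abs_of_nonneg h, Edge.side, one_mul]⟩
      · exact ⟨.longLeft, rfl, by rw [abs_of_nonneg h, Edge.side, one_mul]⟩
    · cases b
      · exact ⟨.shortRight, rfl, by rw [abs_of_nonpos h, Edge.side]; ring⟩
      · exact ⟨.longRight, rfl, by rw [abs_of_nonpos h, Edge.side]; ring⟩
  rcases hc with hc | hc
  · obtain ⟨e, he, hi⟩ := hsd true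
    obtain ⟨r, hr0, hr1, hr⟩ := exists_edgeParam (κ := κ) (e := e) hs0 hs1
    refine ⟨e, r, hr0, hr1, Complex.ext ?_ ?_⟩
    · rw [protoEdge_re_long κ he, hr]; rw [longForm] at hc; field_simp; linarith
    · rw [protoEdge_im, hr]; field_simp; linarith
  · obtain ⟨e, he, hi⟩ := hsd false
    obtain ⟨r, hr0, hr1, hr⟩ := exists_edgeParam (κ := κ) (e := e) hs0 hs1
    refine ⟨e, r, hr0, hr1, Complex.ext ?_ ?_⟩
    · rw [protoEdge_re_short κ he, hr]; rw [shortForm] at hc; field_simp; linarith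
    · rw [protoEdge_im, hr]; field_simp; linarith

/-- The distance from the axis is strictly between 0 and `sg`, while at corners it is one of these
two values. -/
lemma protoEdge_ne_corner {κ : Kind} {e : Edge} {r : ℝ} (h0 : 0 < r) (h1 : r < len e.isLong)
    (c : Corner) : protoEdge κ e r ≠ protoCorner κ c := by
  have hp := edgeParam_mem_open (κ := κ) h0 h1
  have hs := sg_pos
  intro h
  have h2 := abs_protoEdge_im hp.1.le
  rw [h] at h2
  have h3 : 0 < edgeParam κ e r * sg := mul_pos hp.1 hs
  have h4 : edgeParam κ e r * sg < sg := by nlinarith [hp.2]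
  rw [← h2] at h3 h4
  cases c
  · rw [protoCorner_tail] at h3; simp at h3
  · rw [protoCorner_left] at h4; simp [abs_of_pos hs] at h4
  · rw [protoCorner_front] at h3; simp at h3
  · rw [protoCorner_right] at h4; simp [abs_of_pos hs] at h4

/-- On each side of the axis, the linear form defining the long edge measures the side of the edge;
the factor `φ` is the length of the edge vector. -/
lemma sgn_cross_long (κ : Kind) {e : Edge} (he : e.isLong = true) (v : ℂ) :
    φ * (sgn κ e * cross (om (off κ e)) v) = v.re * sg - e.side * v.im * ((φ + 1) / 2) := by
  cases κ <;> cases e <;> simp only [Edge.isLong, Bool.false_eq_true] at he <;>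
    simp only [sgn, off, cross, om_one, om_nine, om_six, om_four, Edge.side]
  · push_cast; linear_combination (-v.im / 2 + v.re * sg) * phi_sq
  · push_cast; linear_combination (v.im / 2 + v.re * sg) * phi_sq
  · push_cast; linear_combination (-v.im / 2 + v.re * sg) * phi_sq
  · push_cast; linear_combination (v.im / 2 + v.re * sg) * phi_sq

lemma sgn_cross_short (κ : Kind) {e : Edge} (he : e.isLong = false) (v : ℂ) :
    sgn κ e * cross (om (off κ e)) v
      = e.side * v.im * ((φ + 1) / 2 - axis κ) - v.re * sg := by
  cases κ <;> cases e <;> simp only [Edge.isLong, Bool.true_eq_false] at he <;>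
    simp only [sgn, off, cross, om_three, om_seven, Edge.side, axis] <;> push_cast <;> ring

/-- The interior of an edge avoids the axis, so near it `|im|` is linear and the defining forms of
the tile are too. -/
lemma eventually_abs_im {κ : Kind} {e : Edge} {r : ℝ} (h0 : 0 < r) (h1 : r < len e.isLong) (v : ℂ) :
    ∀ᶠ ε : ℝ in 𝓝[>] 0, |(protoEdge κ e r + ε * v).im|
      = edgeParam κ e r * sg + ε * (e.side * v.im) := by
  have hp := edgeParam_mem_open (κ := κ) h0 h1
  have hs := sg_pos
  have hq : 0 < edgeParam κ e r * sg := mul_pos hp.1 hs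
  have hev : ∀ᶠ ε : ℝ in 𝓝[>] 0, 0 < edgeParam κ e r * sg + ε * (e.side * v.im) := by
    have hc : Continuous fun ε : ℝ => edgeParam κ e r * sg + ε * (e.side * v.im) := by fun_prop
    have := hc.tendsto 0
    rw [zero_mul, add_zero] at this
    exact (this.mono_left nhdsWithin_le_nhds).eventually (lt_mem_nhds hq)
  filter_upwards [hev] with ε hε
  have hss : e.side * e.side = 1 := by rcases e.side_eq with h | h <;> rw [h] <;> norm_num
  have habs : |e.side| = 1 := by rcases e.side_eq with h | h <;> rw [h] <;> norm_num
  have : (protoEdge κ e r + ε * v).im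
      = e.side * (edgeParam κ e r * sg + ε * (e.side * v.im)) := by
    rw [Complex.add_im, protoEdge_im, Complex.im_ofReal_mul]
    linear_combination (-ε * v.im) * hss
  rw [this, abs_mul, habs, one_mul, abs_of_pos hε]

/-- Moving from an edge to the side of the tile leads into the interior. -/
lemma eventually_mem_protoInt {κ : Kind} {e : Edge} {r : ℝ} (h0 : 0 < r) (h1 : r < len e.isLong)
    {v : ℂ} (hv : 0 < sgn κ e * cross (om (off κ e)) v) :
    ∀ᶠ ε : ℝ in 𝓝[>] 0, protoEdge κ e r + ε * v ∈ protoInt κ := by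
  have hp := edgeParam_mem_open (κ := κ) h0 h1
  have hs := sg_pos
  have ha := one_le_axis κ
  have hc : Continuous fun ε : ℝ => protoEdge κ e r + ε * v := by fun_prop
  have hx : 0 < (1 - edgeParam κ e r) * (axis κ * sg) := by
    have := hp.2; apply mul_pos <;> nlinarith
  have h00 : protoEdge κ e r + ((0 : ℝ) : ℂ) * v = protoEdge κ e r := by simp
  cases h : e.isLong
  · have h2 : ∀ᶠ ε : ℝ in 𝓝[>] 0, 0 < longForm (protoEdge κ e r + ε * v) := by
      have hl : 0 < longForm (protoEdge κ e r + ((0 : ℝ) : ℂ) * v) := by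
        rw [h00, longForm, abs_protoEdge_im hp.1.le, protoEdge_re_short κ h]; linarith
      exact (((continuous_longForm.comp hc).tendsto 0).mono_left
        nhdsWithin_le_nhds).eventually (lt_mem_nhds hl)
    filter_upwards [h2, eventually_abs_im h0 h1 v, self_mem_nhdsWithin] with ε h2 h3 hε
    refine ⟨h2, ?_⟩
    rw [sgn_cross_short κ h] at hv
    have := mul_pos (Set.mem_Ioi.1 hε) hv
    rw [shortForm, h3, Complex.add_re, protoEdge_re_short κ h, Complex.re_ofReal_mul]
    linarith
  · have h2 : ∀ᶠ ε : ℝ in 𝓝[>] 0, 0 < shortForm κ (protoEdge κ e r + ε * v) := by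
      have hl : 0 < shortForm κ (protoEdge κ e r + ((0 : ℝ) : ℂ) * v) := by
        rw [h00, shortForm, abs_protoEdge_im hp.1.le, protoEdge_re_long κ h]; linarith
      exact ((((continuous_shortForm κ).comp hc).tendsto 0).mono_left
        nhdsWithin_le_nhds).eventually (lt_mem_nhds hl)
    filter_upwards [h2, eventually_abs_im h0 h1 v, self_mem_nhdsWithin] with ε h2 h3 hε
    refine ⟨?_, h2⟩
    have hv' := mul_pos phi_pos hv
    rw [sgn_cross_long κ h] at hv'
    have := mul_pos (Set.mem_Ioi.1 hε) hv'
    rw [longForm, h3, Complex.add_re, protoEdge_re_long κ h, Complex.re_ofReal_mul]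
    linarith

/-- Moving from an edge to the side opposite to the tile leads out of the tile. -/
lemma eventually_notMem_protoRegion {κ : Kind} {e : Edge} {r : ℝ} (h0 : 0 < r)
    (h1 : r < len e.isLong) {v : ℂ} (hv : sgn κ e * cross (om (off κ e)) v < 0) :
    ∀ᶠ ε : ℝ in 𝓝[>] 0, protoEdge κ e r + ε * v ∉ protoRegion κ := by
  filter_upwards [eventually_abs_im h0 h1 v, self_mem_nhdsWithin] with ε h3 hε
  rintro ⟨hl, hsf⟩
  cases h : e.isLong
  · rw [sgn_cross_short κ h] at hv
    have := mul_neg_of_pos_of_neg (Set.mem_Ioi.1 hε) hv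
    rw [shortForm, h3, Complex.add_re, protoEdge_re_short κ h, Complex.re_ofReal_mul] at hsf
    linarith
  · have hv' := mul_neg_of_pos_of_neg phi_pos hv
    rw [sgn_cross_long κ h] at hv'
    have := mul_neg_of_pos_of_neg (Set.mem_Ioi.1 hε) hv'
    rw [longForm, h3, Complex.add_re, protoEdge_re_long κ h, Complex.re_ofReal_mul] at hl
    linarith

namespace Tile

/-- The white end of an edge. -/
def wpt (t : Tile) (e : Edge) : ℂ := t.corner (whiteC t.kind e)

/-- The black end of an edge. -/
def bpt (t : Tile) (e : Edge) : ℂ := t.corner (blackC t.kind e)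

/-- The direction of an edge, from its white to its black end. -/
def edir (t : Tile) (e : Edge) : ℂ := (t.rot : ℂ) * om (off t.kind e)

/-- The point at distance `r` from the white end of an edge. -/
def edgePt (t : Tile) (e : Edge) (r : ℝ) : ℂ := t.wpt e + r * t.edir e

lemma edgePt_eq (t : Tile) (e : Edge) (r : ℝ) :
    t.edgePt e r = (t.rot : ℂ) * protoEdge t.kind e r + t.shift := by
  simp only [edgePt, wpt, corner, edir, protoEdge]; ring

lemma loc_edgePt (t : Tile) (e : Edge) (r : ℝ) : t.loc (t.edgePt e r) = protoEdge t.kind e r := by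
  rw [edgePt_eq, loc_mul]

lemma bpt_eq (t : Tile) (e : Edge) : t.bpt e = t.edgePt e (len e.isLong) := by
  rw [edgePt_eq, bpt, corner, protoCorner_black, protoEdge]

lemma wpt_eq (t : Tile) (e : Edge) : t.wpt e = t.edgePt e 0 := by
  simp [edgePt]

lemma norm_edir (t : Tile) (e : Edge) : ‖t.edir e‖ = 1 := by
  rw [edir, norm_mul, Circle.norm_coe, norm_om, one_mul]

lemma edgePt_mem {t : Tile} {e : Edge} {r : ℝ} (h0 : 0 ≤ r) (h1 : r ≤ len e.isLong) :
    t.edgePt e r ∈ t.region := by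
  rw [mem_region, loc_edgePt]; exact protoEdge_mem h0 h1

lemma exists_edgePt_eq_corner (t : Tile) (c : Corner) :
    ∃ e r, 0 ≤ r ∧ r ≤ len e.isLong ∧ t.corner c = t.edgePt e r := by
  have h : ∃ e, c = whiteC t.kind e ∨ c = blackC t.kind e := by
    cases t.kind <;> cases c
    · exact ⟨.longLeft, Or.inl rfl⟩
    · exact ⟨.longLeft, Or.inr rfl⟩
    · exact ⟨.shortLeft, Or.inl rfl⟩
    · exact ⟨.longRight, Or.inr rfl⟩
    · exact ⟨.longLeft, Or.inr rfl⟩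
    · exact ⟨.longLeft, Or.inl rfl⟩
    · exact ⟨.shortLeft, Or.inr rfl⟩
    · exact ⟨.longRight, Or.inl rfl⟩
  obtain ⟨e, rfl | rfl⟩ := h
  · exact ⟨e, 0, le_rfl, (len_pos _).le, wpt_eq t e⟩
  · exact ⟨e, _, (len_pos _).le, le_rfl, bpt_eq t e⟩

lemma corner_mem (t : Tile) (c : Corner) : t.corner c ∈ t.region := by
  obtain ⟨e, r, h0, h1, h⟩ := t.exists_edgePt_eq_corner c
  rw [h]; exact edgePt_mem h0 h1

lemma edgePt_ne_corner {t : Tile} {e : Edge} {r : ℝ} (h0 : 0 < r) (h1 : r < len e.isLong)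
    (c : Corner) : t.edgePt e r ≠ t.corner c := by
  intro h
  have := congrArg t.loc h
  rw [loc_edgePt, loc_corner] at this
  exact protoEdge_ne_corner h0 h1 c this

lemma loc_edgePt_add (t : Tile) (e : Edge) (r ε : ℝ) (v : ℂ) :
    t.loc (t.edgePt e r + ε * v)
      = protoEdge t.kind e r + ε * ((starRingEnd ℂ) (t.rot : ℂ) * v) := by
  rw [← loc_edgePt]; simp only [loc]; ring

lemma cross_edir (t : Tile) (e : Edge) (v : ℂ) :
    cross (om (off t.kind e)) ((starRingEnd ℂ) (t.rot : ℂ) * v) = cross (t.edir e) v := by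
  simp only [cross, edir, Complex.mul_re, Complex.mul_im, Complex.conj_re, Complex.conj_im]
  ring

lemma eventually_mem_interior {t : Tile} {e : Edge} {r : ℝ} (h0 : 0 < r) (h1 : r < len e.isLong)
    {v : ℂ} (hv : 0 < sgn t.kind e * cross (t.edir e) v) :
    ∀ᶠ ε : ℝ in 𝓝[>] 0, t.edgePt e r + ε * v ∈ interior t.region := by
  rw [← cross_edir] at hv
  filter_upwards [eventually_mem_protoInt h0 h1 hv] with ε h
  apply mem_interior
  rwa [loc_edgePt_add]

lemma eventually_notMem_region {t : Tile} {e : Edge} {r : ℝ} (h0 : 0 < r) (h1 : r < len e.isLong)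
    {v : ℂ} (hv : sgn t.kind e * cross (t.edir e) v < 0) :
    ∀ᶠ ε : ℝ in 𝓝[>] 0, t.edgePt e r + ε * v ∉ t.region := by
  rw [← cross_edir] at hv
  filter_upwards [eventually_notMem_protoRegion h0 h1 hv] with ε h
  rwa [mem_region, loc_edgePt_add]

lemma center_ne_corner (t : Tile) (c : Corner) : t.center ≠ t.corner c := by
  intro h
  have h := congrArg t.loc h
  have hs := sg_pos
  have ha := one_le_axis t.kind
  rw [loc_center, loc_corner] at h
  cases c
  · rw [protoCorner_tail] at h
    have := congrArg Complex.re h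
    simp only [Complex.ofReal_re, Complex.zero_re] at this
    linarith
  · rw [protoCorner_left] at h
    have := congrArg Complex.im h
    simp only [Complex.ofReal_im] at this
    linarith
  · rw [protoCorner_front] at h
    have := congrArg Complex.re h
    simp only [Complex.ofReal_re] at this
    linarith
  · rw [protoCorner_right] at h
    have := congrArg Complex.im h
    simp only [Complex.ofReal_im] at this
    linarith

lemma center_mem (t : Tile) : t.center ∈ t.region :=
  interior_subset (t.ball_subset_interior (Metric.mem_ball_self (by norm_num)))

end Tile

/-! ### How two tiles of a tiling can meet -/

/-- Two tiles have an edge in common. -/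
def Shares (s : Tile) (e : Edge) (t : Tile) (e' : Edge) : Prop :=
  e.isLong = e'.isLong ∧ s.wpt e = t.wpt e' ∧ s.edir e = t.edir e'

lemma Shares.symm {s t : Tile} {e e' : Edge} (h : Shares s e t e') : Shares t e' s e :=
  ⟨h.1.symm, h.2.1.symm, h.2.2.symm⟩

lemma Shares.edgePt_eq {s t : Tile} {e e' : Edge} (h : Shares s e t e') (r : ℝ) :
    s.edgePt e r = t.edgePt e' r := by
  rw [Tile.edgePt, Tile.edgePt, h.2.1, h.2.2]

lemma Shares.bpt_eq {s t : Tile} {e e' : Edge} (h : Shares s e t e') : s.bpt e = t.bpt e' := by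
  rw [Tile.bpt_eq, Tile.bpt_eq, h.edgePt_eq, h.1]

lemma cross_self_I {u : ℂ} (hu : ‖u‖ = 1) (a : ℝ) : cross u (a * (Complex.I * u)) = a := by
  have : u.re * u.re + u.im * u.im = 1 := by
    rw [← Complex.normSq_apply, Complex.normSq_eq_norm_sq, hu]; norm_num
  simp [cross]
  linear_combination a * this

lemma cross_self_I' {u w : ℂ} (a : ℝ) : cross w (a * (Complex.I * u))
    = a * (u.re * w.re + u.im * w.im) := by
  simp [cross]
  ring

lemma exists_mem_region {T : Set Tile} (hT : IsPenroseTiling T)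
    (z : ℂ) : ∃ t ∈ T, z ∈ t.region := by
  have : z ∈ ⋃ t ∈ T, t.region := by rw [hT.cover]; trivial
  simpa using this

/-- Points of `t` are limits of interior points of `t`, which an open part of `s` cannot contain. -/
lemma notMem_interior_of_ne {T : Set Tile} (hT : IsPenroseTiling T)
    {s t : Tile} (hs : s ∈ T) (ht : t ∈ T) (hst : s ≠ t) {z : ℂ}
    (hz : z ∈ t.region) : z ∉ interior s.region := by
  intro h
  have h2 := Tile.mem_closure_interior hz
  rw [_root_.mem_closure_iff] at h2
  obtain ⟨y, hy1, hy2⟩ := h2 _ isOpen_interior h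
  exact (Set.disjoint_left.1 (hT.disjoint_interior s hs t ht hst)) hy1 hy2

/-- A direction `v` pointing into both tiles at a common edge point would produce a common interior
point. -/
lemma not_overlap {T : Set Tile} (hT : IsPenroseTiling T)
    {s t : Tile} (hs : s ∈ T) (ht : t ∈ T) (hst : s ≠ t) {e e' : Edge} {r r' : ℝ}
    (h0 : 0 < r) (h1 : r < len e.isLong) (h0' : 0 < r') (h1' : r' < len e'.isLong)
    (hz : s.edgePt e r = t.edgePt e' r') {v : ℂ} (hv : 0 < sgn s.kind e * cross (s.edir e) v)
    (hv' : 0 < sgn t.kind e' * cross (t.edir e') v) : False := by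
  have h2 := Tile.eventually_mem_interior h0 h1 hv
  have h3 := Tile.eventually_mem_interior h0' h1' hv'
  rw [← hz] at h3
  obtain ⟨ε, h4, h5⟩ := (h2.and h3).exists
  exact Set.disjoint_left.1 (hT.disjoint_interior s hs t ht hst) h4 h5

/-- Different tiles with a common edge lie on different sides of it. -/
lemma Shares.sgn_eq {T : Set Tile} (hT : IsPenroseTiling T)
    {s t : Tile} (hs : s ∈ T) (ht : t ∈ T) (hst : s ≠ t) {e e' : Edge}
    (h : Shares s e t e') : sgn t.kind e' = -sgn s.kind e := by
  by_contra hne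
  have heq : sgn t.kind e' = sgn s.kind e := by
    rcases Penrose.sgn_eq s.kind e with h1 | h1 <;> rcases Penrose.sgn_eq t.kind e' with h2 | h2 <;>
      omega
  have hl := len_pos e.isLong
  have hss : ((sgn s.kind e : ℤ) : ℝ) * (sgn s.kind e : ℤ) = 1 := by
    rcases Penrose.sgn_eq s.kind e with h1 | h1 <;> rw [h1] <;> norm_num
  have hv : 0 < sgn s.kind e * cross (s.edir e)
      (((sgn s.kind e : ℝ) : ℂ) * (Complex.I * s.edir e)) := by
    rw [cross_self_I (Tile.norm_edir _ _), hss]; norm_num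
  refine not_overlap hT hs ht hst (r := len e.isLong / 2) (r' := len e.isLong / 2) (by linarith)
    (by linarith) (by linarith) (by rw [← h.1]; linarith) (h.edgePt_eq _) hv ?_
  rwa [heq, ← h.2.2]

/-- If an interior point of an edge lies in another tile, then it is an edge of that tile. -/
lemma exists_shares {T : Set Tile} (hT : IsPenroseTiling T)
    {s t : Tile} (hs : s ∈ T) (ht : t ∈ T) (hst : s ≠ t) {e : Edge} {r : ℝ}
    (h0 : 0 < r) (h1 : r < len e.isLong) (hz : s.edgePt e r ∈ t.region) :
    ∃ e', Shares s e t e' := by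
  -- an interior point of an edge of one tile is not a corner of another one
  have hnc : ∀ s ∈ T, ∀ t ∈ T, ∀ e r, 0 < r → r < len e.isLong → ∀ c,
      s.edgePt e r ≠ t.corner c := by
    intro s hs t ht e r h0 h1 c h
    obtain ⟨d, hd⟩ := hT.edge_to_edge t ht s hs c (h ▸ Tile.edgePt_mem h0.le h1.le)
    exact Tile.edgePt_ne_corner h0 h1 d (h.trans hd.symm)
  obtain ⟨e', r', hr0, hr1, hr⟩ : ∃ e' r', 0 ≤ r' ∧ r' ≤ len e'.isLong ∧
      s.edgePt e r = t.edgePt e' r' := by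
    rcases protoRegion_cases (Tile.mem_region.1 hz) with h | ⟨e', r', h0', h1', h⟩
    · exact absurd (Tile.mem_interior h)
        (notMem_interior_of_ne hT ht hs hst.symm (Tile.edgePt_mem h0.le h1.le))
    · refine ⟨e', r', h0', h1', ?_⟩
      rw [Tile.edgePt_eq t, ← h, Tile.rot_mul_loc]
  have h0' : 0 < r' := by
    refine lt_of_le_of_ne hr0 fun h => hnc s hs t ht e r h0 h1 (whiteC t.kind e') ?_
    rw [hr, ← h, ← Tile.wpt_eq]; rfl
  have h1' : r' < len e'.isLong := by
    refine lt_of_le_of_ne hr1 fun h => hnc s hs t ht e r h0 h1 (blackC t.kind e') ?_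
    rw [hr, h, ← Tile.bpt_eq]; rfl
  -- Two unit inward normals that are not opposite have a sum that makes a positive product with
  -- each of them, so it would point into both tiles. Hence the inward normals are opposite and the
  -- edges collinear.
  have hopp : ((sgn t.kind e' : ℝ) : ℂ) * t.edir e' = -(((sgn s.kind e : ℝ) : ℂ) * s.edir e) := by
    by_contra hne
    have hu := Tile.norm_edir s e
    have hu' := Tile.norm_edir t e'
    have hss : ((sgn s.kind e : ℤ) : ℝ) = 1 ∨ ((sgn s.kind e : ℤ) : ℝ) = -1 := by
      rcases Penrose.sgn_eq s.kind e with h1 | h1 <;> rw [h1] <;> norm_num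
    have htt : ((sgn t.kind e' : ℤ) : ℝ) = 1 ∨ ((sgn t.kind e' : ℤ) : ℝ) = -1 := by
      rcases Penrose.sgn_eq t.kind e' with h1 | h1 <;> rw [h1] <;> norm_num
    have hov := not_overlap hT hs ht hst h0 h1 h0' h1' hr
      (v := ((sgn s.kind e : ℝ) : ℂ) * (Complex.I * s.edir e)
        + ((sgn t.kind e' : ℝ) : ℂ) * (Complex.I * t.edir e'))
    generalize ((sgn s.kind e : ℤ) : ℝ) = σ at *
    generalize ((sgn t.kind e' : ℤ) : ℝ) = σ' at *
    generalize s.edir e = u at *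
    generalize t.edir e' = u' at *
    have hadd : ∀ a b c : ℂ, cross a (b + c) = cross a b + cross a c := by
      intro a b c; simp [cross]; ring
    rw [hadd, hadd, cross_self_I hu, cross_self_I hu', cross_self_I', cross_self_I'] at hov
    have hn : u.re * u.re + u.im * u.im = 1 := by
      rw [← Complex.normSq_apply, Complex.normSq_eq_norm_sq, hu]; norm_num
    have hn' : u'.re * u'.re + u'.im * u'.im = 1 := by
      rw [← Complex.normSq_apply, Complex.normSq_eq_norm_sq, hu']; norm_num
    have hσ : σ * σ = 1 := by rcases hss with h | h <;> rw [h] <;> norm_num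
    have hσ' : σ' * σ' = 1 := by rcases htt with h | h <;> rw [h] <;> norm_num
    have hpos : 0 < 1 + σ * σ' * (u.re * u'.re + u.im * u'.im) := by
      have hsq : 0 < (σ' * u'.re + σ * u.re) * (σ' * u'.re + σ * u.re)
          + (σ' * u'.im + σ * u.im) * (σ' * u'.im + σ * u.im) := by
        by_contra hle
        have a1 := mul_self_nonneg (σ' * u'.re + σ * u.re)
        have a2 := mul_self_nonneg (σ' * u'.im + σ * u.im)
        apply hne
        apply Complex.ext
        · have : σ' * u'.re + σ * u.re = 0 := mul_self_eq_zero.1 (by linarith)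
          simp; linarith
        · have : σ' * u'.im + σ * u.im = 0 := mul_self_eq_zero.1 (by linarith)
          simp; linarith
      have hexp : (σ' * u'.re + σ * u.re) * (σ' * u'.re + σ * u.re)
          + (σ' * u'.im + σ * u.im) * (σ' * u'.im + σ * u.im)
          = 2 * (1 + σ * σ' * (u.re * u'.re + u.im * u'.im)) := by
        linear_combination σ' * σ' * hn' + σ * σ * hn + hσ + hσ'
      linarith
    refine hov ?_ ?_
    · have : σ * (σ + σ' * (u'.re * u.re + u'.im * u.im))
        = 1 + σ * σ' * (u.re * u'.re + u.im * u'.im) := by linear_combination hσ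
      rw [this]; exact hpos
    · have : σ' * (σ * (u.re * u'.re + u.im * u'.im) + σ')
        = 1 + σ * σ' * (u.re * u'.re + u.im * u'.im) := by linear_combination hσ'
      rw [this]; exact hpos
  have hdir : t.edir e' = s.edir e ∨ t.edir e' = -s.edir e := by
    rcases Penrose.sgn_eq s.kind e with h1 | h1 <;> rcases Penrose.sgn_eq t.kind e' with h2 | h2 <;>
      rw [h1, h2] at hopp <;> push_cast at hopp
    · right; linear_combination hopp
    · left; linear_combination -hopp
    · left; linear_combination hopp
    · right; linear_combination -hopp
  rw [Tile.edgePt, Tile.edgePt] at hr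
  rcases hdir with hd | hd
  · rw [hd] at hr
    -- With equal orientation, a difference of the white ends, or below of the lengths, would put a
    -- corner of one tile inside an edge of the other.
    have hrr : r = r' := by
      rcases lt_trichotomy r r' with h | h | h
      · refine absurd ?_ (hnc t ht s hs e' (r' - r) (by linarith) (by linarith) (whiteC s.kind e))
        change _ = s.wpt e
        rw [Tile.edgePt, hd]; push_cast; linear_combination -hr
      · exact h
      · refine absurd ?_ (hnc s hs t ht e (r - r') (by linarith) (by linarith) (whiteC t.kind e'))
        change _ = t.wpt e'
        rw [Tile.edgePt]; push_cast; linear_combination hr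
    subst hrr
    have hw : s.wpt e = t.wpt e' := by linear_combination hr
    refine ⟨e', ?_, hw, hd.symm⟩
    apply len_injective
    rcases lt_trichotomy (len e.isLong) (len e'.isLong) with h | h | h
    · refine absurd ?_ (hnc t ht s hs e' (len e.isLong) (len_pos _) h (blackC s.kind e))
      change _ = s.bpt e
      rw [Tile.bpt_eq, Tile.edgePt, Tile.edgePt, hd, hw]
    · exact h
    · refine absurd ?_ (hnc s hs t ht e (len e'.isLong) (len_pos _) h (blackC t.kind e'))
      change _ = t.bpt e'
      rw [Tile.bpt_eq, Tile.edgePt, Tile.edgePt, hd, hw]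
  -- With opposite orientation, either a corner lies inside an edge or a white end meets a black
  -- end; the latter contradicts the matching rule.
  · exfalso
    rw [hd] at hr
    rcases lt_trichotomy r (len e'.isLong - r') with h | h | h
    · refine hnc t ht s hs e' (r' + r) (by linarith) (by linarith) (whiteC s.kind e) ?_
      change _ = s.wpt e
      rw [Tile.edgePt, hd]; push_cast; linear_combination -hr
    · have hwb : s.corner (whiteC s.kind e) = t.corner (blackC t.kind e') := by
        change s.wpt e = t.bpt e'
        rw [Tile.bpt_eq, Tile.edgePt, hd, show len e'.isLong = r + r' by linarith]
        push_cast; linear_combination hr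
      have := hT.matching s hs t ht _ _ hwb
      rw [color_white, color_black] at this
      exact Bool.false_ne_true this
    · refine hnc s hs t ht e (r - (len e'.isLong - r')) (by linarith) (by linarith)
        (blackC t.kind e') ?_
      change _ = t.bpt e'
      rw [Tile.bpt_eq, Tile.edgePt, Tile.edgePt, hd]; push_cast; linear_combination hr

/-- Two tiles meet in common corners and common edges. -/
lemma inter_cases {T : Set Tile} (hT : IsPenroseTiling T)
    {s t : Tile} (hs : s ∈ T) (ht : t ∈ T) (hst : s ≠ t) {z : ℂ}
    (hz : z ∈ s.region) (hz' : z ∈ t.region) :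
    (∃ c d, s.corner c = z ∧ t.corner d = z) ∨
      ∃ e e' r, Shares s e t e' ∧ 0 < r ∧ r < len e.isLong ∧ z = s.edgePt e r := by
  rcases protoRegion_cases (Tile.mem_region.1 hz) with h | ⟨e, r, h0, h1, h⟩
  · exact absurd (Tile.mem_interior h) (notMem_interior_of_ne hT hs ht hst hz')
  have hzr : z = s.edgePt e r := by rw [Tile.edgePt_eq, ← h, Tile.rot_mul_loc]
  by_cases hc : ∃ c, s.corner c = z
  · obtain ⟨c, rfl⟩ := hc
    obtain ⟨d, hd⟩ := hT.edge_to_edge s hs t ht c hz'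
    exact Or.inl ⟨c, d, rfl, hd⟩
  · right
    have h0' : 0 < r := by
      refine lt_of_le_of_ne h0 fun h => hc ⟨whiteC s.kind e, ?_⟩
      rw [hzr, ← h, ← Tile.wpt_eq]; rfl
    have h1' : r < len e.isLong := by
      refine lt_of_le_of_ne h1 fun h => hc ⟨blackC s.kind e, ?_⟩
      rw [hzr, h, ← Tile.bpt_eq]; rfl
    obtain ⟨e', he'⟩ := exists_shares hT hs ht hst h0' h1' (hzr ▸ hz')
    exact ⟨e, e', r, he', h0', h1', hzr⟩

/-! ### Local finiteness -/

/-- The tiles contain disjoint discs of radius `1/8`, each of area `π / 64`. -/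
lemma card_mul_le_volume {T : Set Tile} (hT : IsPenroseTiling T)
    {F : Finset Tile} (hF : ∀ t ∈ F, t ∈ T) {A : Set ℂ}
    (hA : ∀ t ∈ F, t.region ⊆ A) : (F.card : ℝ) * (π / 64) ≤ (volume A).toReal ∨ volume A = ⊤ := by
  by_cases htop : volume A = ⊤
  · exact Or.inr htop
  left
  have h1 : volume (⋃ t ∈ F, Metric.ball t.center (1 / 8))
      = ∑ t ∈ F, volume (Metric.ball t.center (1 / 8)) := by
    refine measure_biUnion_finset ?_ fun t _ => measurableSet_ball
    intro s hs t ht hst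
    exact (hT.disjoint_interior s (hF s hs) t (hF t ht) hst).mono (s.ball_subset_interior)
      (t.ball_subset_interior)
  have h2 : volume (⋃ t ∈ F, Metric.ball t.center (1 / 8)) ≤ volume A := by
    refine measure_mono (Set.iUnion₂_subset fun t ht => ?_)
    exact (t.ball_subset_interior.trans interior_subset).trans (hA t ht)
  have h3 := ENNReal.toReal_mono htop h2
  rw [h1, ENNReal.toReal_sum (fun t _ => measure_ball_lt_top.ne)] at h3
  refine le_trans (le_of_eq ?_) h3
  have : ∀ t : Tile, (volume (Metric.ball t.center (1 / 8))).toReal = π / 64 := by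
    intro t
    rw [Complex.volume_ball]
    simp
    ring
  simp only [this, Finset.sum_const, nsmul_eq_mul]

lemma finite_near {T : Set Tile} (hT : IsPenroseTiling T)
    (x : ℂ) (R : ℝ) : {t ∈ T | ∃ z ∈ t.region, dist z x ≤ R}.Finite := by
  by_contra hinf
  obtain ⟨m, hm⟩ := exists_nat_gt ((volume (Metric.closedBall x (R + 4))).toReal / (π / 64))
  obtain ⟨F, hF, hcard⟩ := Set.Infinite.exists_subset_card_eq hinf m
  have hb : ∀ t ∈ F, t.region ⊆ Metric.closedBall x (R + 4) := by
    intro t ht z hz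
    obtain ⟨-, y, hy, hyx⟩ := hF ht
    have h1 := Tile.dist_shift_le hz
    have h2 := Tile.dist_shift_le hy
    rw [Metric.mem_closedBall]
    have h3 := dist_triangle z y x
    have h4 := dist_triangle_right z y t.shift
    linarith
  rcases card_mul_le_volume hT (fun t ht => (hF ht).1) hb with h | h
  · rw [hcard] at h
    rw [div_lt_iff₀ (by positivity)] at hm
    linarith
  · exact measure_closedBall_lt_top.ne h

/-- Near a point there are only points of the tiles that contain it. -/
lemma eventually_mem_of_mem {T : Set Tile} (hT : IsPenroseTiling T)
    (x : ℂ) : ∀ᶠ y in 𝓝 x, ∀ t ∈ T, y ∈ t.region → x ∈ t.region := by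
  have hfin := finite_near hT x 1
  have h1 : ∀ᶠ y in 𝓝 x, ∀ t ∈ {t ∈ T | ∃ z ∈ t.region, dist z x ≤ 1},
      y ∈ t.region → x ∈ t.region := by
    rw [eventually_all_finite hfin]
    intro t _
    by_cases hx : x ∈ t.region
    · exact Eventually.of_forall fun _ _ => hx
    · filter_upwards [t.isClosed_region.isOpen_compl.mem_nhds hx] with y hy hy'
      exact absurd hy' hy
  filter_upwards [h1, Metric.closedBall_mem_nhds x one_pos] with y h2 h3 t ht hy
  exact h2 t ⟨ht, y, hy, h3⟩ hy

lemma countable_tiling {T : Set Tile} (hT : IsPenroseTiling T) : T.Countable := by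
  have : T = ⋃ m : ℕ, {t ∈ T | ∃ z ∈ t.region, dist z 0 ≤ m} := by
    ext t
    simp only [Set.mem_iUnion, Set.mem_sep_iff]
    constructor
    · intro ht
      obtain ⟨m, hm⟩ := exists_nat_ge (dist t.center 0)
      exact ⟨m, ht, _, t.center_mem, hm⟩
    · rintro ⟨_, h, _⟩; exact h
  rw [this]
  exact Set.countable_iUnion fun m => (finite_near hT 0 m).countable

/-! ### Neighbours and connectedness -/

/-- Every edge of a tile belongs to another tile. -/
lemma exists_neighbor {T : Set Tile} (hT : IsPenroseTiling T) {t : Tile} (ht : t ∈ T) (e : Edge) :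
    ∃ s ∈ T, s ≠ t ∧ ∃ e', Shares t e s e' := by
  have hl := len_pos e.isLong
  have h0 : 0 < len e.isLong / 2 := by linarith
  have h1 : len e.isLong / 2 < len e.isLong := by linarith
  -- Points just outside `t` near the midpoint of the edge are covered by other tiles, which by
  -- local finiteness contain the midpoint too.
  have hv : sgn t.kind e * cross (t.edir e)
      (((-sgn t.kind e : ℝ) : ℂ) * (Complex.I * t.edir e)) < 0 := by
    rw [cross_self_I (Tile.norm_edir _ _)]
    rcases Penrose.sgn_eq t.kind e with h1 | h1 <;> rw [h1] <;> norm_num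
  have h2 := Tile.eventually_notMem_region h0 h1 hv
  have hc : Continuous fun ε : ℝ => t.edgePt e (len e.isLong / 2)
      + ε * (((-sgn t.kind e : ℝ) : ℂ) * (Complex.I * t.edir e)) := by fun_prop
  have ht0 := hc.tendsto 0
  simp only [Complex.ofReal_zero, zero_mul, add_zero] at ht0
  have h3 := (ht0.mono_left (nhdsWithin_le_nhds (s := Set.Ioi 0))).eventually
    (eventually_mem_of_mem hT _)
  obtain ⟨ε, h4, h5⟩ := (h2.and h3).exists
  obtain ⟨s, hs, hs'⟩ := exists_mem_region hT (t.edgePt e (len e.isLong / 2)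
      + ε * (((-sgn t.kind e : ℝ) : ℂ) * (Complex.I * t.edir e)))
  have hst : s ≠ t := by rintro rfl; exact h4 hs'
  exact ⟨s, hs, hst, exists_shares hT ht hs hst.symm h0 h1 (h5 s hs hs')⟩

/-- An edge has only two sides, so three different tiles cannot share it. -/
lemma neighbor_unique {T : Set Tile} (hT : IsPenroseTiling T)
    {t s s' : Tile} (ht : t ∈ T) (hs : s ∈ T) (hs' : s' ∈ T) (hst : s ≠ t)
    (hst' : s' ≠ t) {e e1 e2 : Edge} (h1 : Shares t e s e1) (h2 : Shares t e s' e2) : s = s' := by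
  by_contra hne
  have a := h1.sgn_eq hT ht hs hst.symm
  have b := h2.sgn_eq hT ht hs' hst'.symm
  have c := Shares.sgn_eq hT hs hs' hne
    (⟨h1.1.symm.trans h2.1, h1.2.1.symm.trans h2.2.1, h1.2.2.symm.trans h2.2.2⟩ : Shares s e1 s' e2)
  rcases Penrose.sgn_eq t.kind e with h | h <;> omega

/-- The tiles are connected through common edges. -/
lemma tile_induction {T : Set Tile} (hT : IsPenroseTiling T)
    {Q : Tile → Prop} {t₀ : Tile} (ht₀ : t₀ ∈ T) (h₀ : Q t₀)
    (step : ∀ s ∈ T, ∀ t ∈ T, ∀ e e', Shares s e t e' → Q s → Q t) : ∀ t ∈ T, Q t := by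
  by_contra! hne
  obtain ⟨t₁, ht₁, h₁⟩ := hne
  have hclosed : ∀ Q : Tile → Prop, IsClosed {z : ℂ | ∃ t ∈ T, Q t ∧ z ∈ t.region} := by
    intro Q
    rw [← isOpen_compl_iff, isOpen_iff_mem_nhds]
    intro x hx
    filter_upwards [eventually_mem_of_mem hT x] with y hy
    rintro ⟨t, ht, hQ, hyt⟩
    exact hx ⟨t, ht, hQ, hy t ht hyt⟩
  set V : Set ℂ := ⋃ t ∈ T, Set.range t.corner with hV
  have hVc : V.Countable := by
    refine (countable_tiling hT).biUnion fun t _ => ?_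
    have : Finite Corner := by
      refine Finite.of_injective (fun c : Corner => (match c with
        | .tail => 0 | .left => 1 | .front => 2 | .right => 3 : Fin 4)) ?_
      intro a b; cases a <;> cases b <;> simp
    exact (Set.finite_range _).countable
  have hcenter : ∀ t ∈ T, t.center ∉ V := by
    intro t ht h
    simp only [hV, Set.mem_iUnion, Set.mem_range] at h
    obtain ⟨s, hs, c, hc⟩ := h
    obtain ⟨d, hd⟩ := hT.edge_to_edge s hs t ht c (hc ▸ t.center_mem)
    exact t.center_ne_corner d (hc.symm.trans hd.symm)
  -- The plane without the countably many corners is connected. The tiles with `Q` and those without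
  -- cover it by two closed sets, which therefore meet away from the corners, that is, inside a
  -- common edge.
  have hconn := (hVc.isConnected_compl_of_one_lt_rank
    (by rw [Complex.rank_real_complex]; exact Nat.one_lt_ofNat)).isPreconnected
  rw [isPreconnected_closed_iff] at hconn
  obtain ⟨z, hzV, ⟨s, hs, hQs, hzs⟩, ⟨t, ht, hQt, hzt⟩⟩ := hconn _ _ (hclosed Q)
    (hclosed fun t => ¬Q t)
    (fun z _ => by
      obtain ⟨t, ht, hz⟩ := exists_mem_region hT z
      by_cases hQ : Q t
      · exact Or.inl ⟨t, ht, hQ, hz⟩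
      · exact Or.inr ⟨t, ht, hQ, hz⟩)
    ⟨t₀.center, hcenter t₀ ht₀, t₀, ht₀, h₀, t₀.center_mem⟩
    ⟨t₁.center, hcenter t₁ ht₁, t₁, ht₁, h₁, t₁.center_mem⟩
  have hst : s ≠ t := by rintro rfl; exact hQt hQs
  rcases inter_cases hT hs ht hst hzs hzt with ⟨c, d, hc, hd⟩ | ⟨e, e', r, hsh, -⟩
  · apply hzV
    simp only [hV, Set.mem_iUnion, Set.mem_range]
    exact ⟨s, hs, c, hc⟩
  · exact hQt (step s hs t ht e e' hsh hQs)

/-! ### Values of the profiles at the ends of the edges -/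

lemma profParallel_zero : profParallel 0 = 0 := by
  have := phi_gt; have := phi_lt
  simp only [profParallel]
  linarith [st_zero (show 0 - (-φ / 2 + 9 / 8) < 0 by linarith),
    st_zero (show 0 - (-φ / 2 + 5 / 4) < 0 by linarith),
    st_zero (show 0 - (φ - 3 / 4) < 0 by linarith),
    st_zero (show 0 - (φ - 5 / 8) < 0 by linarith),
    st_zero (show 0 - (φ / 2 + 5 / 8) < 0 by linarith),
    st_zero (show 0 - (φ / 2 + 3 / 4) < 0 by linarith)]

lemma profLong_zero : profLong 0 = 0 := by
  have := phi_gt; have := phi_lt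
  simp only [profLong]
  linarith [st_zero (show 0 - (1 / 8) < 0 by linarith),
    st_zero (show 0 - (1 / 4) < 0 by linarith),
    st_zero (show 0 - (3 / 8) < 0 by linarith),
    st_zero (show 0 - (-φ / 2 + 13 / 8) < 0 by linarith),
    st_zero (show 0 - (-φ / 2 + 7 / 4) < 0 by linarith)]

lemma profShort_zero : profShort 0 = 0 := by
  have := phi_gt; have := phi_lt
  simp only [profShort]
  linarith [st_zero (show 0 - (-φ / 2 + 9 / 8) < 0 by linarith),
    st_zero (show 0 - (-φ / 2 + 5 / 4) < 0 by linarith)]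

lemma profCross_zero : profCross 0 = 0 := by
  have := phi_gt; have := phi_lt
  simp only [profCross]
  linarith [st_zero (show 0 - (1 / 8) < 0 by linarith),
    st_zero (show 0 - (1 / 4) < 0 by linarith)]

lemma profParallel_end : profParallel (φ) = 0 := by
  have := phi_gt; have := phi_lt
  simp only [profParallel]
  linarith [st_one (show 0 < φ - (-φ / 2 + 9 / 8) by linarith),
    st_one (show 0 < φ - (-φ / 2 + 5 / 4) by linarith),
    st_one (show 0 < φ - (φ - 3 / 4) by linarith),
    st_one (show 0 < φ - (φ - 5 / 8) by linarith),
    st_one (show 0 < φ - (φ / 2 + 5 / 8) by linarith),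
    st_one (show 0 < φ - (φ / 2 + 3 / 4) by linarith)]

lemma profLong_end : profLong (φ / 2 + 1 / 2) = 1 := by
  have := phi_gt; have := phi_lt
  simp only [profLong]
  linarith [st_one (show 0 < φ / 2 + 1 / 2 - (1 / 8) by linarith),
    st_one (show 0 < φ / 2 + 1 / 2 - (1 / 4) by linarith),
    st_one (show 0 < φ / 2 + 1 / 2 - (3 / 8) by linarith),
    st_one (show 0 < φ / 2 + 1 / 2 - (-φ / 2 + 13 / 8) by linarith),
    st_one (show 0 < φ / 2 + 1 / 2 - (-φ / 2 + 7 / 4) by linarith)]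

lemma profShort_end : profShort (1 / 2) = 0 := by
  have := phi_gt; have := phi_lt
  simp only [profShort]
  linarith [st_one (show 0 < 1 / 2 - (-φ / 2 + 9 / 8) by linarith),
    st_one (show 0 < 1 / 2 - (-φ / 2 + 5 / 4) by linarith)]

lemma profLong_one : profLong (1) = 1 := by
  have := phi_gt; have := phi_lt
  simp only [profLong]
  linarith [st_one (show 0 < 1 - (1 / 8) by linarith),
    st_one (show 0 < 1 - (1 / 4) by linarith),
    st_one (show 0 < 1 - (3 / 8) by linarith),
    st_one (show 0 < 1 - (-φ / 2 + 13 / 8) by linarith),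
    st_one (show 0 < 1 - (-φ / 2 + 7 / 4) by linarith)]

lemma profShort_half : profShort (φ / 2) = 0 := by
  have := phi_gt; have := phi_lt
  simp only [profShort]
  linarith [st_one (show 0 < φ / 2 - (-φ / 2 + 9 / 8) by linarith),
    st_one (show 0 < φ / 2 - (-φ / 2 + 5 / 4) by linarith)]

lemma profCross_end : profCross (φ / 2 - 1 / 2) = 0 := by
  have := phi_gt; have := phi_lt
  simp only [profCross]
  linarith [st_one (show 0 < φ / 2 - 1 / 2 - (1 / 8) by linarith),
    st_one (show 0 < φ / 2 - 1 / 2 - (1 / 4) by linarith)]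

lemma om_re_add_five (j : ZMod 10) : (om (j + 5)).re = -(om j).re := by
  rw [om_add_five, Complex.neg_re]

lemma zmod_ten_cases {P : ZMod 10 → Prop} (hneg : ∀ j, P j → P (-j)) (hadd : ∀ j, P j → P (j + 5))
    (h0 : P 0) (h1 : P 1) (h2 : P 2) (j : ZMod 10) : P j := by
  have h9 : P 9 := hneg 1 h1
  have h8 : P 8 := hneg 2 h2
  revert j
  exact forall_zmod_ten h0 h1 h2 (hadd 8 h8) (hadd 9 h9) (hadd 0 h0) (hadd 1 h1) (hadd 2 h2) h8 h9

lemma prof_zero (b : Bool) (j : ZMod 10) : prof b j 0 = 0 := by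
  refine zmod_ten_cases (P := fun j => prof b j 0 = 0) ?_ ?_ ?_ ?_ ?_ j
  · intro j h; rw [prof_neg, h]
  · intro j h; rw [prof_add_five, neg_zero, h, neg_zero]
  · cases b
    · exact profLong_zero
    · exact profParallel_zero
  · cases b
    · exact profShort_zero
    · exact profLong_zero
  · cases b
    · exact profCross_zero
    · exact profShort_zero

lemma inc_neg (b : Bool) (j : ZMod 10) : inc b 0 (-j) = inc b 0 j := by
  cases b <;> simp only [inc] <;> revert j <;> decide

lemma inc_add_five (b : Bool) (j : ZMod 10) : inc b 0 (j + 5) = -inc b 0 j := by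
  cases b <;> simp only [inc] <;> revert j <;> decide

/-- The total jump along an edge is the increment of the lift coordinate. Hence heights at corners
are exactly lift coordinates. -/
lemma prof_end (b : Bool) (j : ZMod 10) : prof b j (len b * (om j).re) = inc b 0 j := by
  have hq := phi_sq
  refine zmod_ten_cases (P := fun j => prof b j (len b * (om j).re) = inc b 0 j) ?_ ?_ ?_ ?_ ?_ j
  · intro j h; rw [prof_neg, om_neg_re, h, inc_neg]
  · intro j h
    rw [prof_add_five, om_re_add_five, mul_neg, neg_neg, h, inc_add_five]; push_cast; rfl
  · rw [om_zero]
    cases b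
    · rw [show len false * (1 : ℂ).re = 1 by simp [len], show inc false 0 0 = 1 by rfl]
      exact_mod_cast profLong_one
    · rw [show len true * (1 : ℂ).re = φ by simp [len], show inc true 0 0 = 0 by rfl]
      exact_mod_cast profParallel_end
  · rw [om_one]
    cases b
    · rw [show len false * (φ / 2) = φ / 2 by simp [len], show inc false 0 1 = 0 by rfl]
      exact_mod_cast profShort_half
    · rw [show len true * (φ / 2) = φ / 2 + 1 / 2 by simp only [len]; linarith,
        show inc true 0 1 = 1 by rfl]
      exact_mod_cast profLong_end
  · rw [om_two]
    cases b
    · rw [show len false * ((φ - 1) / 2) = φ / 2 - 1 / 2 by simp only [len]; ring,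
        show inc false 0 2 = 0 by rfl]
      exact_mod_cast profCross_end
    · rw [show len true * ((φ - 1) / 2) = 1 / 2 by simp only [len]; linarith,
        show inc true 0 2 = 0 by rfl]
      exact_mod_cast profShort_end

lemma cl_shift (κ : Kind) (c : Corner) (k m : ZMod 10) : cl κ c k m = cl κ c 0 (m - k) := by
  cases κ <;> cases c <;> simp only [cl] <;> revert k m <;> decide

lemma inc_shift (b : Bool) (d m : ZMod 10) : inc b d m = inc b 0 (m - d) := by
  cases b <;> simp only [inc] <;> revert d m <;> decide

/-! ### Placed tiles -/

lemma om_injective {a b : ZMod 10} (h : om a = om b) : a = b :=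
  ZMod.injective_toCircle (Subtype.coe_injective h)

lemma om_ne_zero (a : ZMod 10) : om a ≠ 0 := by
  rw [← norm_ne_zero_iff, norm_om]; norm_num

/-- A tile is placed in the frame `(r₀, c₀)` with the rotation `k` and the lift `n` of its tail. -/
structure Placed (r₀ : Circle) (c₀ : ℂ) (t : Tile) (k : ZMod 10) (n : ZMod 10 → ℤ) : Prop where
  anti : Anti n
  rot : (t.rot : ℂ) = r₀ * om k
  shift : t.shift = c₀ + r₀ * L n
  idx_eq : idx n 0 = tailIdx t.kind k

section Frame

variable {r₀ : Circle} {c₀ : ℂ}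

lemma Placed.corner {t : Tile} {k : ZMod 10} {n : ZMod 10 → ℤ} (h : Placed r₀ c₀ t k n)
    (c : Corner) : t.corner c = c₀ + r₀ * L (n + cl t.kind c k) := by
  rw [Tile.corner, h.rot, h.shift, L_add, L_cl]; ring

lemma Placed.edir {t : Tile} {k : ZMod 10} {n : ZMod 10 → ℤ} (h : Placed r₀ c₀ t k n)
    (e : Edge) : t.edir e = r₀ * om (k + off t.kind e) := by
  rw [Tile.edir, h.rot, om_add]; ring

lemma Placed.idx_corner {t : Tile} {k : ZMod 10} {n : ZMod 10 → ℤ} (h : Placed r₀ c₀ t k n)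
    (c : Corner) : 0 ≤ idx (n + cl t.kind c k) 0 ∧ idx (n + cl t.kind c k) 0 ≤ 3 := by
  rw [idx_add, h.idx_eq]; exact Penrose.idx_corner _ _ _

/-- The lift of a corner does not depend on the tile. -/
lemma Placed.lift_eq {s t : Tile} {k k' : ZMod 10} {n n' : ZMod 10 → ℤ} (hs : Placed r₀ c₀ s k n)
    (ht : Placed r₀ c₀ t k' n') {c d : Corner} (h : s.corner c = t.corner d) :
    n + cl s.kind c k = n' + cl t.kind d k' := by
  rw [hs.corner, ht.corner] at h
  have h2 : L (n + cl s.kind c k) = L (n' + cl t.kind d k') :=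
    mul_left_cancel₀ (Circle.coe_ne_zero r₀) (add_left_cancel h)
  exact lift_unique (hs.anti.add (anti_cl _ _ _)) (ht.anti.add (anti_cl _ _ _)) h2
    (hs.idx_corner c) (ht.idx_corner d)

lemma Placed.dir_eq {s t : Tile} {k k' : ZMod 10} {n n' : ZMod 10 → ℤ} (hs : Placed r₀ c₀ s k n)
    (ht : Placed r₀ c₀ t k' n') {e e' : Edge} (h : Shares s e t e') :
    k + off s.kind e = k' + off t.kind e' := by
  have h2 := h.2.2
  rw [hs.edir, ht.edir] at h2
  exact om_injective (mul_left_cancel₀ (Circle.coe_ne_zero r₀) h2)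

/-- The common direction fixes the rotation, the common white end fixes the lift of the tail, and
`idx_white` gives the index that the new tile requires. -/
lemma Placed.of_shares {s t : Tile} {k : ZMod 10} {n : ZMod 10 → ℤ} (hs : Placed r₀ c₀ s k n)
    {e e' : Edge} (h : Shares s e t e') : ∃ k' n', Placed r₀ c₀ t k' n' := by
  obtain ⟨h1, h2, h3⟩ := h
  obtain ⟨k', hk'⟩ : ∃ k', k' + off t.kind e' = k + off s.kind e :=
    ⟨k + off s.kind e - off t.kind e', by ring⟩
  have hrot : (t.rot : ℂ) = r₀ * om k' := by
    rw [hs.edir, Tile.edir, ← hk', om_add, ← mul_assoc] at h3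
    exact (mul_right_cancel₀ (om_ne_zero _) h3).symm
  refine ⟨k', n + cl s.kind (whiteC s.kind e) k - cl t.kind (whiteC t.kind e') k',
    (hs.anti.add (anti_cl _ _ _)).sub (anti_cl _ _ _), hrot, ?_, ?_⟩
  · rw [Tile.wpt, Tile.wpt, hs.corner, Tile.corner, hrot] at h2
    rw [L_sub, L_cl]
    linear_combination -h2
  · have a := idx_white s.kind e k
    have b := idx_white t.kind e' k'
    rw [hk', ← h1] at b
    rw [idx_sub, idx_add, hs.idx_eq]
    omega

/-! ### Heights of a tiling in the ten directions -/

/-- The coordinate of a point in the direction `m`. -/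
def sc (r₀ : Circle) (c₀ : ℂ) (m : ZMod 10) (z : ℂ) : ℝ :=
  ((starRingEnd ℂ) (r₀ : ℂ) * (z - c₀) * om (-m)).re

/-- The height of the points of a tile with the coordinate `s` in the direction `m`. -/
def tileHeight (κ : Kind) (k : ZMod 10) (n : ZMod 10 → ℤ) (m : ZMod 10) (s : ℝ) : ℝ :=
  n m + tileStep κ (m - k) (s - (L n * om (-m)).re)

lemma conj_mul_self (r₀ : Circle) : (starRingEnd ℂ) (r₀ : ℂ) * r₀ = 1 := by
  rw [mul_comm, Complex.mul_conj, Complex.normSq_eq_norm_sq, Circle.norm_coe]; simp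

lemma Placed.sc_sub {t : Tile} {k : ZMod 10} {n : ZMod 10 → ℤ} (h : Placed r₀ c₀ t k n)
    (m : ZMod 10) (z : ℂ) :
    sc r₀ c₀ m z - (L n * om (-m)).re = (t.loc z * om (-(m - k))).re := by
  have e : (starRingEnd ℂ) (r₀ : ℂ) * (z - c₀) * om (-m) - L n * om (-m)
      = t.loc z * om (-(m - k)) := by
    rw [Tile.loc, h.rot, h.shift, map_mul, conj_om, show -(m - k) = k + -m by ring, om_add]
    linear_combination (L n * om (-m)) * conj_mul_self r₀ - (starRingEnd ℂ) (r₀ : ℂ)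
      * (z - c₀ - r₀ * L n) * om (-m) * om_neg_mul k
  rw [sc, ← Complex.sub_re, e]

/-- Only the lift of the white end and the type and direction of the edge enter, all of which are
common to both tiles at the edge. -/
lemma Placed.height_edgePt {t : Tile} {k : ZMod 10} {n : ZMod 10 → ℤ} (h : Placed r₀ c₀ t k n)
    (m : ZMod 10) {e : Edge} {r : ℝ} (h0 : 0 ≤ r) (h1 : r ≤ len e.isLong) :
    tileHeight t.kind k n m (sc r₀ c₀ m (t.edgePt e r))
      = ((n + cl t.kind (whiteC t.kind e) k) m : ℤ)
        + prof e.isLong (m - (k + off t.kind e)) (r * (om (m - (k + off t.kind e))).re) := by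
  have key := edgeProfile t.kind e h0 h1 (m - k)
  rw [EdgeProfile] at key
  rw [tileHeight, h.sc_sub, Tile.loc_edgePt, protoEdge, key, Pi.add_apply, cl_shift _ _ k,
    sub_sub]
  push_cast; ring

lemma Placed.height_corner {t : Tile} {k : ZMod 10} {n : ZMod 10 → ℤ} (h : Placed r₀ c₀ t k n)
    (m : ZMod 10) (c : Corner) :
    tileHeight t.kind k n m (sc r₀ c₀ m (t.corner c)) = ((n + cl t.kind c k) m : ℤ) := by
  have hc : ∃ e, c = whiteC t.kind e ∨ c = blackC t.kind e := by
    cases t.kind <;> cases c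
    · exact ⟨.longLeft, Or.inl rfl⟩
    · exact ⟨.longLeft, Or.inr rfl⟩
    · exact ⟨.shortLeft, Or.inl rfl⟩
    · exact ⟨.longRight, Or.inr rfl⟩
    · exact ⟨.longLeft, Or.inr rfl⟩
    · exact ⟨.longLeft, Or.inl rfl⟩
    · exact ⟨.shortLeft, Or.inr rfl⟩
    · exact ⟨.longRight, Or.inl rfl⟩
  obtain ⟨e, rfl | rfl⟩ := hc
  · change tileHeight t.kind k n m (sc r₀ c₀ m (t.wpt e)) = _
    rw [Tile.wpt_eq, h.height_edgePt m le_rfl (len_pos _).le, zero_mul, prof_zero, add_zero]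
  · change tileHeight t.kind k n m (sc r₀ c₀ m (t.bpt e)) = _
    rw [Tile.bpt_eq, h.height_edgePt m (len_pos _).le le_rfl, prof_end, ← inc_shift, cl_black]
    simp only [Pi.add_apply]
    push_cast; ring

/-- The heights of two tiles agree on their intersection. -/
lemma height_eq {T : Set Tile} (hT : IsPenroseTiling T) {s t : Tile} (hs : s ∈ T) (ht : t ∈ T)
    {k k' : ZMod 10} {n n' : ZMod 10 → ℤ} (hps : Placed r₀ c₀ s k n) (hpt : Placed r₀ c₀ t k' n')
    {z : ℂ} (hz : z ∈ s.region) (hz' : z ∈ t.region) (m : ZMod 10) :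
    tileHeight s.kind k n m (sc r₀ c₀ m z) = tileHeight t.kind k' n' m (sc r₀ c₀ m z) := by
  have hcorner : ∀ c d, s.corner c = z → t.corner d = z →
      tileHeight s.kind k n m (sc r₀ c₀ m z) = tileHeight t.kind k' n' m (sc r₀ c₀ m z) := by
    intro c d hc hd
    have h1 := hps.height_corner m c
    have h2 := hpt.height_corner m d
    rw [hc] at h1
    rw [hd] at h2
    rw [h1, h2, hps.lift_eq hpt (hc.trans hd.symm)]
  by_cases hst : s = t
  · subst hst
    have hn := hps.lift_eq hpt (c := .tail) (d := .tail) rfl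
    have hk : k = k' := by
      have := hps.rot.symm.trans hpt.rot
      exact om_injective (mul_left_cancel₀ (Circle.coe_ne_zero r₀) this)
    have e : ∀ κ k, cl κ .tail k = 0 := fun κ k => by cases κ <;> rfl
    rw [e, e, add_zero, add_zero] at hn
    rw [hk, hn]
  · rcases inter_cases hT hs ht hst hz hz' with ⟨c, d, hc, hd⟩ | ⟨e, e', r, hsh, h0, h1, rfl⟩
    · exact hcorner c d hc hd
    · have hd := hps.dir_eq hpt hsh
      have hl := hps.lift_eq hpt (c := whiteC s.kind e) (d := whiteC t.kind e') hsh.2.1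
      rw [hps.height_edgePt m h0.le h1.le, hl, hd, hsh.edgePt_eq,
        hpt.height_edgePt m h0.le (by rw [← hsh.1]; exact h1.le), hsh.1]

lemma sc_line (m : ZMod 10) (s : ℝ) : sc r₀ c₀ m (c₀ + r₀ * om m * s) = s := by
  have : (starRingEnd ℂ) (r₀ : ℂ) * (c₀ + r₀ * om m * s - c₀) * om (-m) = s := by
    linear_combination (om m * om (-m) * s) * conj_mul_self r₀ + s * om_mul_neg m
  rw [sc, this, Complex.ofReal_re]

lemma abs_sc_sub_le (m : ZMod 10) (z w : ℂ) : |sc r₀ c₀ m z - sc r₀ c₀ m w| ≤ dist z w := by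
  have : (starRingEnd ℂ) (r₀ : ℂ) * (z - c₀) * om (-m) - (starRingEnd ℂ) (r₀ : ℂ) * (w - c₀) * om (-m)
      = (starRingEnd ℂ) (r₀ : ℂ) * (z - w) * om (-m) := by ring
  rw [sc, sc, ← Complex.sub_re, this]
  refine (Complex.abs_re_le_norm _).trans (le_of_eq ?_)
  rw [norm_mul, norm_mul, norm_om, RCLike.norm_conj, Circle.norm_coe, dist_eq_norm]; ring

/-- In a tiling with placed tiles, the height is a function of the coordinate. -/
lemma exists_height {T : Set Tile} (hT : IsPenroseTiling T) {k : Tile → ZMod 10}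
    {n : Tile → ZMod 10 → ℤ} (hp : ∀ t ∈ T, Placed r₀ c₀ t (k t) (n t)) :
    ∃ F : ZMod 10 → ℝ → ℝ, ∀ t ∈ T, ∀ z ∈ t.region, ∀ m,
      F m (sc r₀ c₀ m z) = tileHeight t.kind (k t) (n t) m (sc r₀ c₀ m z) := by
  choose τ hτ hτz using exists_mem_region hT
  let H : ZMod 10 → ℂ → ℝ := fun m z =>
    tileHeight (τ z).kind (k (τ z)) (n (τ z)) m (sc r₀ c₀ m z)
  have hH : ∀ m, ∀ t ∈ T, ∀ z ∈ t.region,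
      H m z = tileHeight t.kind (k t) (n t) m (sc r₀ c₀ m z) := fun m t ht z hz =>
    height_eq hT (hτ z) ht (hp _ (hτ z)) (hp t ht) (hτz z) hz m
  have hconst : ∀ m z w, sc r₀ c₀ m z = sc r₀ c₀ m w → H m z = H m w := by
    intro m z w hzw
    have hsc : ∀ x : ℝ, sc r₀ c₀ m (z + x * (w - z)) = sc r₀ c₀ m z := by
      intro x
      have e : (starRingEnd ℂ) (r₀ : ℂ) * (z + x * (w - z) - c₀) * om (-m)
          = (starRingEnd ℂ) (r₀ : ℂ) * (z - c₀) * om (-m)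
            + x * ((starRingEnd ℂ) (r₀ : ℂ) * (w - c₀) * om (-m)
              - (starRingEnd ℂ) (r₀ : ℂ) * (z - c₀) * om (-m)) := by ring
      rw [sc, e, Complex.add_re, Complex.re_ofReal_mul, Complex.sub_re]
      change sc r₀ c₀ m z + x * (sc r₀ c₀ m w - sc r₀ c₀ m z) = _
      rw [hzw]; ring
    have hcont : Continuous fun x : ℝ => z + x * (w - z) := by fun_prop
    -- Along a line perpendicular to `m` the coordinate is constant, and nearby points lie in tiles
    -- that also contain the given point, where the heights agree.
    have hloc : IsLocallyConstant fun x : ℝ => H m (z + x * (w - z)) := by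
      rw [IsLocallyConstant.iff_eventually_eq]
      intro x
      filter_upwards [(hcont.tendsto x).eventually (eventually_mem_of_mem hT _)] with y hy
      have hxt := hy _ (hτ (z + y * (w - z))) (hτz _)
      rw [hH m _ (hτ (z + y * (w - z))) _ hxt, hsc x, ← hsc y]
    have := hloc.apply_eq_of_preconnectedSpace 0 1
    simpa using this
  refine ⟨fun m s => H m (c₀ + r₀ * om m * s), fun t ht z hz m => ?_⟩
  rw [← hH m t ht z hz]
  exact hconst m _ _ (sc_line m _)

end Frame

/-- A tile contains a neighbourhood of the origin of a suitable frame. -/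
lemma exists_frame (t : Tile) : ∃ (r₀ : Circle) (c₀ : ℂ) (n : ZMod 10 → ℤ),
    Placed r₀ c₀ t 0 n ∧ c₀ ∈ interior t.region ∧ ∀ m, |n m| ≤ 2 := by
  have h3 := phi_gt; have h4 := phi_lt; have hs := sg_pos
  have hL : L (dir 2 + dir 8) = ((φ - 1 : ℝ) : ℂ) := by
    rw [L_add, L_dir, L_dir, om_two, om_eight]
    apply Complex.ext <;> simp
  obtain ⟨n, x, ha, hi, hb, hLn, hx0, hx1⟩ : ∃ (n : ZMod 10 → ℤ) (x : ℝ), Anti n ∧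
      idx n 0 = tailIdx t.kind 0 ∧ (∀ m, |n m| ≤ 2) ∧ L n = -(x : ℂ) ∧ 0 < x ∧ x < axis t.kind := by
    cases t.kind
    -- The origin is put inside the tile, on its axis, at distance `3 - φ` from the tail of a kite
    -- or `2 - φ` from that of a dart; these lengths have small lifts with the required index 0 or
    -- 1.
    · refine ⟨dir 2 + dir 8 - (dir 0 + dir 0), 3 - φ,
        ((anti_dir _).add (anti_dir _)).sub ((anti_dir _).add (anti_dir _)), rfl, by decide, ?_,
        by linarith, by simp only [axis]; linarith⟩
      rw [L_sub, hL, L_add, L_dir, om_zero]; push_cast; ring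
    · refine ⟨dir 2 + dir 8 - dir 0, 2 - φ, ((anti_dir _).add (anti_dir _)).sub (anti_dir _), rfl,
        by decide, ?_, by linarith, by simp only [axis]; linarith⟩
      rw [L_sub, hL, L_dir, om_zero]; push_cast; ring
  refine ⟨t.rot, t.shift - t.rot * L n, n, ⟨ha, by rw [om_zero, mul_one], by ring, hi⟩, ?_, hb⟩
  apply Tile.mem_interior
  have : t.loc (t.shift - t.rot * L n) = x := by
    rw [Tile.loc, hLn]; linear_combination (x : ℂ) * t.conj_mul_rot
  rw [this]
  constructor
  · simp only [longForm, Complex.ofReal_re, Complex.ofReal_im, abs_zero, zero_mul, sub_zero]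
    positivity
  · simp only [shortForm, Complex.ofReal_re, Complex.ofReal_im, abs_zero, zero_mul, add_zero]
    nlinarith

/-! ### Boundedness of the conjugate positions -/

/-- The index at `m` is that at 0, up to sign. -/
lemma abs_idx_le {n : ZMod 10 → ℤ} (h : Anti n) (h0 : |idx n 0| ≤ 3) (m : ZMod 10) :
    |idx n m| ≤ 3 := by
  have a0 : n 5 = -n 0 := h 0
  have a2 : n 7 = -n 2 := h 2
  have a4 : n 9 = -n 4 := h 4
  have a6 : n 1 = -n 6 := h 6
  have a8 : n 3 = -n 8 := h 8
  have e0 : idx n 0 = n 0 + n 2 + n 4 + n 6 + n 8 := rfl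
  rw [abs_le] at h0 ⊢
  revert m
  apply forall_zmod_ten
  · exact h0
  · rw [show idx n 1 = n 1 + n 3 + n 5 + n 7 + n 9 from rfl]; omega
  · rw [show idx n 2 = n 2 + n 4 + n 6 + n 8 + n 0 from rfl]; omega
  · rw [show idx n 3 = n 3 + n 5 + n 7 + n 9 + n 1 from rfl]; omega
  · rw [show idx n 4 = n 4 + n 6 + n 8 + n 0 + n 2 from rfl]; omega
  · rw [show idx n 5 = n 5 + n 7 + n 9 + n 1 + n 3 from rfl]; omega
  · rw [show idx n 6 = n 6 + n 8 + n 0 + n 2 + n 4 from rfl]; omega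
  · rw [show idx n 7 = n 7 + n 9 + n 1 + n 3 + n 5 from rfl]; omega
  · rw [show idx n 8 = n 8 + n 0 + n 2 + n 4 + n 6 from rfl]; omega
  · rw [show idx n 9 = n 9 + n 1 + n 3 + n 5 + n 7 from rfl]; omega

/-- Approximate solutions of a functional equation that relates each function to its two
neighbours at the scale `φ` are bounded. -/
lemma bounded_of_functional_equation {G : ZMod 10 → ℝ → ℝ}
    (h : ∀ m a b, |φ * G m (φ * (a + b)) + G (m + 2) a + G (m - 2) b| ≤ 21)
    (h0 : ∀ m, |G m 0| ≤ 6) {ε : ℝ} (hε : 0 < ε) (hG : ∀ m s, |s| < ε → |G m s| ≤ 44)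
    (m : ZMod 10) (s : ℝ) : |G m s| ≤ 44 := by
  have hp := phi_gt; have hp' := phi_lt; have hq := phi_sq
  have h1 : ∀ m a, |φ * G m (φ * a) + G (m + 2) a| ≤ 27 := by
    intro m a
    have e1 := abs_le.1 (h m a 0)
    have e2 := abs_le.1 (h0 (m - 2))
    rw [add_zero] at e1
    rw [abs_le]
    constructor <;> linarith
  have h2 : ∀ m b, |φ * G m (φ * b) + G (m - 2) b| ≤ 27 := by
    intro m b
    have e1 := abs_le.1 (h m 0 b)
    have e2 := abs_le.1 (h0 (m + 2))
    rw [zero_add] at e1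
    rw [abs_le]
    constructor <;> linarith
  -- The equations with one argument 0 have error 27, that is `21 + 6`. Applied twice, through `m +
  -- 2` and back to `m`, they give `|G m (φ² s)| ≤ 27/φ + 27/φ² + 44/φ² = 27 + 44/φ²`, which is at
  -- most 44 because `44 ≥ 27 φ`.
  have step : ∀ m s, |G m s| ≤ 44 → |G m (φ * (φ * s))| ≤ 44 := by
    intro m s hs
    have e1 := abs_le.1 (h1 m (φ * s))
    have e2 := abs_le.1 (h2 (m + 2) s)
    rw [add_sub_cancel_right] at e2
    rw [abs_le] at hs ⊢
    constructor <;> nlinarith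
  -- Each round enlarges the interval where the bound holds by the factor `φ²`.
  have hk : ∀ k : ℕ, ∀ m s, |s| < ε * (φ * φ) ^ k → |G m s| ≤ 44 := by
    intro k
    induction k with
    | zero => intro m s hs; exact hG m s (by simpa using hs)
    | succ k ih =>
      intro m s hs
      have hpp : (0 : ℝ) < φ * φ := by positivity
      have e : φ * (φ * (s / (φ * φ))) = s := by field_simp
      rw [← e]
      apply step
      apply ih
      rw [abs_div, abs_of_pos hpp, div_lt_iff₀ hpp]
      rw [pow_succ] at hs
      linarith
  obtain ⟨k, hk'⟩ := pow_unbounded_of_one_lt (|s| / ε) (show (1 : ℝ) < φ * φ by nlinarith)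
  apply hk k
  rw [div_lt_iff₀ hε] at hk'
  linarith

/-- The coordinates in the directions `m + 2` and `m - 2` can be prescribed freely. They determine
the one in direction `m`, as `om (m + 2) + om (m - 2) = (φ - 1) * om m` and `φ * (φ - 1) = 1`. -/
lemma exists_re_om (a b : ℝ) (m : ZMod 10) : ∃ y : ℂ, (y * om (-m)).re = φ * (a + b) ∧
    (y * om (-(m + 2))).re = a ∧ (y * om (-(m - 2))).re = b := by
  have hs := sg_pos
  refine ⟨om m * ⟨φ * (a + b), (a - b) / (2 * sg)⟩, ?_, ?_, ?_⟩
  · rw [mul_right_comm, om_mul_neg, one_mul]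
  · rw [mul_right_comm, ← om_add, show m + -(m + 2) = 8 by ring_nf; rfl, om_eight, Complex.mul_re]
    field_simp
    linear_combination (a + b) * phi_sq
  · rw [mul_right_comm, ← om_add, show m + -(m - 2) = 2 by ring_nf, om_two, Complex.mul_re]
    field_simp
    linear_combination (a + b) * phi_sq

lemma norm_Ls_dir (d : ZMod 10) : ‖Ls (dir d)‖ = 1 := by rw [Ls_dir, norm_om]

lemma norm_Ls_cl (κ : Kind) (c : Corner) (k : ZMod 10) : ‖Ls (cl κ c k)‖ ≤ 3 := by
  have h1 : ∀ a b, ‖Ls (dir a + dir b)‖ ≤ 2 := by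
    intro a b
    rw [Ls_add]
    refine (norm_add_le _ _).trans ?_
    rw [norm_Ls_dir, norm_Ls_dir]; norm_num
  have h2 : ∀ a b c, ‖Ls (dir a + dir b + dir c)‖ ≤ 3 := by
    intro a b c
    rw [Ls_add]
    refine (norm_add_le _ _).trans ?_
    rw [norm_Ls_dir]; linarith [h1 a b]
  have h3 : ‖Ls 0‖ ≤ 3 := by rw [Ls_zero, norm_zero]; norm_num
  have h4 : ∀ a, ‖Ls (dir a)‖ ≤ 3 := fun a => by rw [norm_Ls_dir]; norm_num
  have h5 : ∀ a b, ‖Ls (dir a + dir b)‖ ≤ 3 := fun a b => (h1 a b).trans (by norm_num)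
  cases c
  · cases κ <;> exact h3
  · cases κ <;> exact h5 _ _
  · cases κ
    · exact h2 _ _ _
    · exact h4 _
  · cases κ <;> exact h5 _ _

/-- One tile is placed by `exists_frame`, and the placement spreads through common edges. The chosen
lift of the first tile is still the small one, by uniqueness of lifts. -/
lemma IsPenroseTiling.exists_placed {T : Set Tile} (hT : IsPenroseTiling T) :
    ∃ (r₀ : Circle) (c₀ : ℂ) (k : Tile → ZMod 10) (n : Tile → ZMod 10 → ℤ),
      (∀ t ∈ T, Placed r₀ c₀ t (k t) (n t)) ∧
        ∃ t₀ ∈ T, c₀ ∈ interior t₀.region ∧ ∀ m, |n t₀ m| ≤ 2 := by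
  obtain ⟨t₀, ht₀, -⟩ := exists_mem_region hT 0
  obtain ⟨r₀, c₀, n₀, hp₀, hc₀, hn₀⟩ := exists_frame t₀
  have hall : ∀ t ∈ T, ∃ k n, Placed r₀ c₀ t k n :=
    tile_induction hT (Q := fun t => ∃ k n, Placed r₀ c₀ t k n) ht₀ ⟨0, n₀, hp₀⟩
      fun s _ t _ e e' hsh ⟨k, n, hp⟩ => hp.of_shares hsh
  have hall' : ∀ t, ∃ k n, t ∈ T → Placed r₀ c₀ t k n := by
    intro t
    by_cases ht : t ∈ T
    · obtain ⟨k, n, h⟩ := hall t ht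
      exact ⟨k, n, fun _ => h⟩
    · exact ⟨0, 0, fun h => absurd h ht⟩
  choose k n hkn using hall'
  refine ⟨r₀, c₀, k, n, hkn, t₀, ht₀, hc₀, ?_⟩
  have hn := (hkn t₀ ht₀).lift_eq hp₀ (c := .tail) (d := .tail) rfl
  have e : ∀ κ k, cl κ .tail k = 0 := fun κ k => by cases κ <;> rfl
  rw [e, e, add_zero, add_zero] at hn
  rw [hn]; exact hn₀

lemma abs_tileHeight_sub_le (κ : Kind) (k : ZMod 10) (n : ZMod 10 → ℤ) (m : ZMod 10) (s : ℝ) :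
    |tileHeight κ k n m s - n m| ≤ 4 := by
  rw [tileHeight, add_sub_cancel_left]; exact abs_tileStep_le _ _ _

/-- The conjugate positions of the tiles of a Penrose tiling are bounded. -/
lemma norm_Ls_le_of_placed {T : Set Tile} (hT : IsPenroseTiling T) {r₀ : Circle} {c₀ : ℂ}
    {k : Tile → ZMod 10} {n : Tile → ZMod 10 → ℤ} (hp : ∀ t ∈ T, Placed r₀ c₀ t (k t) (n t))
    {t₀ : Tile} (ht₀ : t₀ ∈ T) (hc₀ : c₀ ∈ interior t₀.region) (hn₀ : ∀ m, |n t₀ m| ≤ 2)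
    {t : Tile} (ht : t ∈ T) : ‖Ls (n t)‖ ≤ 240 := by
  have hphi := phi_gt; have hphi' := phi_lt; have hq := phi_sq
  obtain ⟨F, hF⟩ := exists_height hT hp
  have hFn : ∀ t ∈ T, ∀ z ∈ t.region, ∀ m, |F m (sc r₀ c₀ m z) - n t m| ≤ 4 := by
    intro t ht z hz m
    rw [hF t ht z hz m]; exact abs_tileHeight_sub_le _ _ _ _ _
  have hscn : ∀ t ∈ T, ∀ z ∈ t.region, ∀ m, |sc r₀ c₀ m z - (L (n t) * om (-m)).re| ≤ 2 := by
    intro t ht z hz m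
    have e : (L (n t) * om (-m)).re = sc r₀ c₀ m t.shift := by
      rw [sc, (hp t ht).shift]
      congr 1
      linear_combination (-L (n t) * om (-m)) * conj_mul_self r₀
    rw [e]
    exact (abs_sc_sub_le m _ _).trans (Tile.dist_shift_le hz)
  have hsc : ∀ (m : ZMod 10) (y : ℂ), sc r₀ c₀ m (c₀ + r₀ * y) = (y * om (-m)).re := by
    intro m y
    rw [sc]; congr 1
    linear_combination (y * om (-m)) * conj_mul_self r₀
  -- The slope `2/5` makes the linear part solve the exact equation: `c (φ² + 1) = 2 φ / √5` with
  -- `φ² + 1 = √5 φ`.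
  obtain ⟨G, hG⟩ : ∃ G : ZMod 10 → ℝ → ℝ, ∀ m s, G m s = F m s - 2 / 5 * s := ⟨_, fun _ _ => rfl⟩
  have hfe : ∀ m a b, |φ * G m (φ * (a + b)) + G (m + 2) a + G (m - 2) b| ≤ 21 := by
    intro m a b
    obtain ⟨y, e0, e1, e2⟩ := exists_re_om a b m
    obtain ⟨t, ht, hz⟩ := exists_mem_region hT (c₀ + r₀ * y)
    have f0 := hFn t ht _ hz m
    have f1 := hFn t ht _ hz (m + 2)
    have f2 := hFn t ht _ hz (m - 2)
    have g0 := hscn t ht _ hz m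
    rw [hsc, e0] at f0 g0
    rw [hsc, e1] at f1
    rw [hsc, e2] at f2
    have hrel := lift_relation (hp t ht).anti m
    have hidx : |(idx (n t) m : ℝ)| ≤ 3 := by
      have h := (hp t ht).idx_corner .tail
      have e : cl t.kind .tail (k t) = 0 := by cases t.kind <;> rfl
      rw [e, add_zero] at h
      have := abs_idx_le (hp t ht).anti (by rw [abs_le]; omega) m
      exact_mod_cast this
    rw [abs_le] at f0 f1 f2 g0 hidx
    rw [hG, hG, hG]
    have key : (2 * φ - 1) * (φ * (F m (φ * (a + b)) - 2 / 5 * (φ * (a + b)))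
        + (F (m + 2) a - 2 / 5 * a) + (F (m - 2) b - 2 / 5 * b))
        = (2 * φ - 1) * (φ * (F m (φ * (a + b)) - n t m) + (F (m + 2) a - n t (m + 2))
          + (F (m - 2) b - n t (m - 2)))
          - 2 * (φ * (a + b) - (L (n t) * om (-m)).re) + φ * idx (n t) m := by
      linear_combination hrel + (a + b) * (-2 / 5 * (2 * φ - 1) - 4 / 5) * hq
    -- Heights differ from lift coordinates by at most 4, so the sum is at most `4 φ + 8 < 14.5`.
    have hD : |φ * (F m (φ * (a + b)) - n t m) + (F (m + 2) a - n t (m + 2))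
          + (F (m - 2) b - n t (m - 2))| ≤ 14.5 := by
      rw [abs_le]; constructor <;> nlinarith
    rw [abs_le] at hD
    have hub : |(2 * φ - 1) * (φ * (F m (φ * (a + b)) - 2 / 5 * (φ * (a + b)))
        + (F (m + 2) a - 2 / 5 * a) + (F (m - 2) b - 2 / 5 * b))| ≤ (2 * φ - 1) * 21 := by
      rw [key, abs_le]
      constructor <;> nlinarith
    rw [abs_mul, abs_of_pos (show (0 : ℝ) < 2 * φ - 1 by linarith)] at hub
    exact le_of_mul_le_mul_left hub (by linarith)
  have hn2 : ∀ m, |(n t₀ m : ℝ)| ≤ 2 := fun m => by exact_mod_cast hn₀ m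
  -- A neighbourhood of the origin lies in `t₀`, whose lift coordinates are at most 2; there the
  -- heights are at most `2 + 4 = 6`.
  obtain ⟨ε, hε, hball⟩ := Metric.isOpen_iff.1 isOpen_interior c₀ hc₀
  have hnear : ∀ m s, |s| < ε → |F m s| ≤ 6 := by
    intro m s hs
    have hz : c₀ + r₀ * om m * s ∈ t₀.region := by
      apply interior_subset
      apply hball
      rw [Metric.mem_ball, dist_eq_norm, add_sub_cancel_left, norm_mul, norm_mul, norm_om,
        Circle.norm_coe, Complex.norm_real]
      simpa using hs
    have h1 := hFn t₀ ht₀ _ hz m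
    rw [sc_line] at h1
    have h2 := hn2 m
    rw [abs_le] at h1 h2 ⊢
    constructor <;> linarith
  have hbd : ∀ m s, |G m s| ≤ 44 := by
    obtain ⟨δ, hδ, hδε, hδ1⟩ : ∃ δ : ℝ, 0 < δ ∧ δ ≤ ε ∧ δ ≤ 1 :=
      ⟨min ε 1, by positivity, min_le_left _ _, min_le_right _ _⟩
    refine bounded_of_functional_equation hfe (fun m => ?_) hδ fun m s hs => ?_
    · rw [hG]; simpa using hnear m 0 (by simpa using hε)
    · have h1 := hnear m s (by linarith)
      rw [hG]
      rw [abs_lt] at hs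
      rw [abs_le] at h1 ⊢
      constructor <;> linarith
  -- 48 is the bound 44 for `G` plus the distance 4 between height and lift coordinate.
  have hfin : ‖Ls (n t)‖ ≤ 5 * 48 := by
    refine norm_Ls_le (z := L (n t)) fun m => ?_
    have hz : t.shift ∈ t.region := by
      have h := t.corner_mem .tail
      rwa [Tile.corner, protoCorner_tail, mul_zero, zero_add] at h
    have h1 := hFn t ht _ hz m
    have e : sc r₀ c₀ m t.shift = (L (n t) * om (-m)).re := by
      rw [(hp t ht).shift, hsc]
    rw [e] at h1
    have h2 := hbd m (L (n t) * om (-m)).re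
    rw [hG] at h2
    rw [abs_le] at h1 h2 ⊢
    constructor <;> linarith
  linarith

/-! ### The conjugate area as a bounded edge form -/

lemma cross_self_add (w u : ℂ) : cross w (w + u) = cross w u := by simp [cross]; ring

lemma abs_cross_le (w u : ℂ) : |cross w u| ≤ ‖w‖ * ‖u‖ := by
  have h : cross w u = ((starRingEnd ℂ) w * u).im := by simp [cross]; ring
  rw [h]
  refine (Complex.abs_im_le_norm _).trans (le_of_eq ?_)
  rw [norm_mul, RCLike.norm_conj]

/-- A bounded function on the edges of the tiles of a Penrose tiling that changes its sign
between the two sides of an edge, and whose sum over the edges of a tile is the conjugate area. -/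
lemma IsPenroseTiling.exists_edgeForm {T : Set Tile} (hT : IsPenroseTiling T) :
    ∃ ω : Tile → Edge → ℝ, (∀ t ∈ T, ∀ e, |ω t e| ≤ 243) ∧
      (∀ s ∈ T, ∀ t ∈ T, ∀ e e', s ≠ t → Shares s e t e' → ω s e + ω t e' = 0) ∧
      ∀ t ∈ T, edgeSum (ω t) = conjArea t.kind := by
  obtain ⟨r₀, c₀, k, n, hp, t₀, ht₀, hc₀, hn₀⟩ := hT.exists_placed
  refine ⟨fun t e => (sgn t.kind e : ℝ) * cross (Ls (n t + cl t.kind (whiteC t.kind e) (k t)))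
    (Ls (n t + cl t.kind (blackC t.kind e) (k t))), ?_, ?_, ?_⟩
  · intro t ht e
    have hs : |((sgn t.kind e : ℤ) : ℝ)| = 1 := by
      rcases sgn_eq t.kind e with h | h <;> rw [h] <;> norm_num
    -- The black end is the white end plus the edge, so the cross product is at most `‖white end‖ *
    -- ‖edge‖`, with bounds `240 + 3` and 1.
    rw [abs_mul, hs, one_mul, cl_black, ← add_assoc, Ls_add (n t + _), cross_self_add]
    refine (abs_cross_le _ _).trans ?_
    have h1 := norm_Ls_inc e.isLong (k t + off t.kind e)
    have h2 : ‖Ls (n t + cl t.kind (whiteC t.kind e) (k t))‖ ≤ 243 := by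
      rw [Ls_add]
      refine (norm_add_le _ _).trans ?_
      have := norm_Ls_le_of_placed hT hp ht₀ hc₀ hn₀ ht
      have := norm_Ls_cl t.kind (whiteC t.kind e) (k t)
      linarith
    have h3 := norm_nonneg (Ls (inc e.isLong (k t + off t.kind e)))
    nlinarith
  · intro s hs t ht e e' hst hsh
    have h1 := (hp s hs).lift_eq (hp t ht) (c := whiteC s.kind e) (d := whiteC t.kind e') hsh.2.1
    have h2 := (hp s hs).lift_eq (hp t ht) (c := blackC s.kind e) (d := blackC t.kind e') hsh.bpt_eq
    have h3 := hsh.sgn_eq hT hs ht hst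
    simp only [h1, h2, h3]
    push_cast; ring
  · intro t ht
    exact edgeSum_cross _ _ _

/-! ### Cancellation along common edges -/

instance : DecidableEq Edge := fun a b => by
  cases a <;> cases b <;> first | exact isTrue rfl | exact isFalse (by intro h; cases h)

instance : Fintype Edge :=
  ⟨{.longLeft, .longRight, .shortLeft, .shortRight}, fun e => by cases e <;> simp⟩

lemma sum_edge {M : Type*} [AddCommMonoid M] (f : Edge → M) : ∑ e, f e = edgeSum f := by
  change ∑ e ∈ {Edge.longLeft, .longRight, .shortLeft, .shortRight}, f e = _
  rw [Finset.sum_insert (by simp), Finset.sum_insert (by simp), Finset.sum_insert (by simp),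
    Finset.sum_singleton, edgeSum]
  simp only [add_assoc]

lemma edge_eq_of_off_eq {κ : Kind} {e e' : Edge} (h : e.isLong = e'.isLong)
    (h' : off κ e = off κ e') : e = e' := by
  cases κ <;> cases e <;> cases e' <;> first
    | rfl
    | (exact absurd h' (by decide))

lemma Shares.edge_unique {s t : Tile} {e e1 e2 : Edge} (h1 : Shares s e t e1)
    (h2 : Shares s e t e2) : e1 = e2 := by
  refine edge_eq_of_off_eq (κ := t.kind) (h1.1.symm.trans h2.1) (om_injective ?_)
  have h := h1.2.2.symm.trans h2.2.2
  rw [Tile.edir, Tile.edir] at h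
  exact mul_left_cancel₀ (Circle.coe_ne_zero t.rot) h

open Classical in
/-- The tiles of a finite set that have an edge in common with a tile outside of it. -/
def outer (T : Set Tile) (P : Finset Tile) : Finset Tile :=
  P.filter fun t => ∃ s ∈ T, s ∉ P ∧ ∃ e e', Shares t e s e'

lemma mem_outer {T : Set Tile} {P : Finset Tile} {t : Tile} :
    t ∈ outer T P ↔ t ∈ P ∧ ∃ s ∈ T, s ∉ P ∧ ∃ e e', Shares t e s e' := by
  classical
  rw [outer, Finset.mem_filter]

-- Sending a tile with an edge to the neighbour across that edge is a fixed-point-free involution,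
-- under which the terms inside `P` cancel. The rest belong to tiles of `outer T P`, with four edges
-- each.
open Classical in
lemma abs_sum_edgeSum_le {T : Set Tile} (hT : IsPenroseTiling T) {ω : Tile → Edge → ℝ} {C : ℝ}
    (hC : ∀ t ∈ T, ∀ e, |ω t e| ≤ C)
    (hω : ∀ s ∈ T, ∀ t ∈ T, ∀ e e', s ≠ t → Shares s e t e' → ω s e + ω t e' = 0)
    {P : Finset Tile} (hP : ∀ t ∈ P, t ∈ T) :
    |∑ t ∈ P, edgeSum (ω t)| ≤ (outer T P).card * (4 * C) := by
  have hnb : ∀ a : Tile × Edge, ∃ b : Tile × Edge,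
      a.1 ∈ T → b.1 ∈ T ∧ b.1 ≠ a.1 ∧ Shares a.1 a.2 b.1 b.2 := by
    rintro ⟨t, e⟩
    by_cases ht : t ∈ T
    · obtain ⟨s, hs, hst, e', h⟩ := exists_neighbor hT ht e
      exact ⟨(s, e'), fun _ => ⟨hs, hst, h⟩⟩
    · exact ⟨(t, e), fun h => absurd h ht⟩
  choose g hg using hnb
  have hgg : ∀ a : Tile × Edge, a.1 ∈ T → g (g a) = a := by
    intro a ha
    obtain ⟨h1, h2, h3⟩ := hg a ha
    obtain ⟨h4, h5, h6⟩ := hg (g a) h1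
    have e1 : (g (g a)).1 = a.1 := neighbor_unique hT h1 h4 ha h5 h2.symm h6 h3.symm
    refine Prod.ext e1 ?_
    rw [e1] at h6
    exact h6.edge_unique h3.symm
  have hsum : ∑ t ∈ P, edgeSum (ω t) = ∑ a ∈ P ×ˢ (Finset.univ : Finset Edge), ω a.1 a.2 := by
    rw [Finset.sum_product]
    exact Finset.sum_congr rfl fun t _ => (sum_edge _).symm
  rw [hsum, ← Finset.sum_filter_add_sum_filter_not _ (fun a => (g a).1 ∈ P)]
  have hzero : ∑ a ∈ (P ×ˢ (Finset.univ : Finset Edge)).filter (fun a => (g a).1 ∈ P),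
      ω a.1 a.2 = 0 := by
    refine Finset.sum_involution (fun a _ => g a) ?_ ?_ ?_ ?_
    · intro a ha
      rw [Finset.mem_filter, Finset.mem_product] at ha
      obtain ⟨h1, h2, h3⟩ := hg a (hP _ ha.1.1)
      exact hω _ (hP _ ha.1.1) _ h1 _ _ h2.symm h3
    · intro a ha _ h
      rw [Finset.mem_filter, Finset.mem_product] at ha
      exact (hg a (hP _ ha.1.1)).2.1 (by rw [h])
    · intro a ha
      rw [Finset.mem_filter, Finset.mem_product] at ha ⊢
      refine ⟨⟨ha.2, Finset.mem_univ _⟩, ?_⟩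
      rw [hgg a (hP _ ha.1.1)]; exact ha.1.1
    · intro a ha
      rw [Finset.mem_filter, Finset.mem_product] at ha
      exact hgg a (hP _ ha.1.1)
  rw [hzero, zero_add]
  have hsub : (P ×ˢ (Finset.univ : Finset Edge)).filter (fun a => ¬(g a).1 ∈ P)
      ⊆ outer T P ×ˢ Finset.univ := by
    intro a ha
    rw [Finset.mem_filter, Finset.mem_product] at ha
    rw [Finset.mem_product, mem_outer]
    obtain ⟨h1, -, h3⟩ := hg a (hP _ ha.1.1)
    exact ⟨⟨ha.1.1, _, h1, ha.2, _, _, h3⟩, Finset.mem_univ _⟩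
  calc |∑ a ∈ (P ×ˢ (Finset.univ : Finset Edge)).filter (fun a => ¬(g a).1 ∈ P), ω a.1 a.2|
      ≤ ∑ a ∈ (P ×ˢ (Finset.univ : Finset Edge)).filter (fun a => ¬(g a).1 ∈ P), |ω a.1 a.2| :=
        Finset.abs_sum_le_sum_abs _ _
    _ ≤ ∑ a ∈ outer T P ×ˢ (Finset.univ : Finset Edge), |ω a.1 a.2| :=
        Finset.sum_le_sum_of_subset_of_nonneg hsub fun _ _ _ => abs_nonneg _
    _ ≤ (outer T P ×ˢ (Finset.univ : Finset Edge)).card • C := by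
        refine Finset.sum_le_card_nsmul _ _ _ fun a ha => ?_
        rw [Finset.mem_product, mem_outer] at ha
        exact hC _ (hP _ ha.1.1) _
    _ = (outer T P).card * (4 * C) := by
        rw [Finset.card_product, show (Finset.univ : Finset Edge).card = 4 from rfl, nsmul_eq_mul]
        push_cast; ring

/-! ### Counting tiles in a square -/

lemma volume_square (a b l : ℝ) (hl : 0 ≤ l) :
    volume (square a b l) = ENNReal.ofReal (l * l) := by
  have h : square a b l
      = Complex.measurableEquivRealProd ⁻¹' (Set.Icc a (a + l) ×ˢ Set.Icc b (b + l)) := by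
    ext z
    simp only [square, Set.mem_ofPred_eq, Set.mem_preimage, Complex.measurableEquivRealProd_apply,
      Set.mem_prod]
  rw [h, Complex.volume_preserving_equiv_real_prod.measure_preimage
    (measurableSet_Icc.prod measurableSet_Icc).nullMeasurableSet, Measure.volume_eq_prod,
    Measure.prod_prod, Real.volume_Icc, Real.volume_Icc, ← ENNReal.ofReal_mul (by linarith)]
  congr 1; ring

lemma measurableSet_square (a b l : ℝ) : MeasurableSet (square a b l) :=
  (measurableSet_Icc.preimage Complex.measurable_re).inter
    (measurableSet_Icc.preimage Complex.measurable_im)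

lemma mem_square_of_dist {a b l r : ℝ} {z w : ℂ} (hz : z ∈ square a b l) (h : dist w z ≤ r) :
    w ∈ square (a - r) (b - r) (l + 2 * r) := by
  rw [dist_eq_norm] at h
  have h1 := abs_le.1 ((Complex.abs_re_le_norm (w - z)).trans h)
  have h2 := abs_le.1 ((Complex.abs_im_le_norm (w - z)).trans h)
  rw [Complex.sub_re] at h1
  rw [Complex.sub_im] at h2
  obtain ⟨⟨a1, a2⟩, a3, a4⟩ := hz
  exact ⟨⟨by linarith, by linarith⟩, by linarith, by linarith⟩

section Net

variable {T : Set Tile} {p : Tile → ℂ}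

/-- The tiles whose points lie in a square. -/
def tilesIn (T : Set Tile) (p : Tile → ℂ) (U : Set ℂ) : Set Tile := {t ∈ T | p t ∈ U}

lemma dist_le_four {t : Tile} {z w : ℂ} (hz : z ∈ t.region) (hw : w ∈ t.region) :
    dist z w ≤ 4 := by
  have h1 := Tile.dist_shift_le hz
  have h2 := Tile.dist_shift_le hw
  have h3 := dist_triangle_right z w t.shift
  linarith

lemma finite_tilesIn (hT : IsPenroseTiling T) (hp : IsNetOfTiling T p) (a b l : ℝ) :
    (tilesIn T p (square a b l)).Finite := by
  refine (finite_near hT (⟨a, b⟩ : ℂ) (2 * l)).subset fun t ht => ⟨ht.1, p t, hp.mem_region t ht.1, ?_⟩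
  obtain ⟨⟨a1, a2⟩, a3, a4⟩ := ht.2
  rw [dist_eq_norm]
  refine (Complex.norm_le_abs_re_add_abs_im _).trans ?_
  rw [Complex.sub_re, Complex.sub_im, abs_of_nonneg (by simpa using a1),
    abs_of_nonneg (by simpa using a3)]
  simp only
  linarith

/-- Different tiles have different points, so counting points is counting tiles. -/
lemma netCount_eq (hp : IsNetOfTiling T p) (κ : Kind) (U : Set ℂ) :
    netCount T p κ U = {t ∈ tilesIn T p U | t.kind = κ}.ncard := by
  have h : U ∩ p '' {t ∈ T | t.kind = κ} = p '' {t ∈ tilesIn T p U | t.kind = κ} := by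
    ext z
    constructor
    · rintro ⟨hz, t, ⟨ht, hk⟩, rfl⟩
      exact ⟨t, ⟨⟨ht, hz⟩, hk⟩, rfl⟩
    · rintro ⟨t, ⟨⟨ht, hz⟩, hk⟩, rfl⟩
      exact ⟨hz, t, ⟨ht, hk⟩, rfl⟩
  rw [netCount, h, Set.InjOn.ncard_image (hp.injOn.mono fun t ht => ht.1.1)]

lemma Shares.exists_mem {s t : Tile} {e e' : Edge} (h : Shares s e t e') :
    ∃ z, z ∈ s.region ∧ z ∈ t.region :=
  ⟨s.wpt e, s.corner_mem _, h.2.1 ▸ t.corner_mem _⟩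

/-- Such tiles lie in a frame around the boundary of the square, of area at most `48 l`; packing
with discs of area `π / 64 > 3 / 64` gives `1024 l`. -/
lemma card_outer_le (hT : IsPenroseTiling T) (hp : IsNetOfTiling T p) {a b l : ℝ} (hl : 16 ≤ l)
    {P : Finset Tile} (hP : (P : Set Tile) = tilesIn T p (square a b l)) :
    ((outer T P).card : ℝ) ≤ 1024 * l := by
  have hPm : ∀ t, t ∈ P ↔ t ∈ T ∧ p t ∈ square a b l := fun t => by
    rw [← Finset.mem_coe, hP]; rfl
  -- Tiles have diameter at most 4, and the point of a neighbour is within two such diameters of any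
  -- point of the tile.
  set A := square (a - 4) (b - 4) (l + 2 * 4) \ square (a + 8) (b + 8) (l - 16) with hA
  have hsub : ∀ t ∈ outer T P, t.region ⊆ A := by
    intro t ht z hz
    rw [mem_outer, hPm] at ht
    obtain ⟨⟨htT, htU⟩, s, hs, hsP, e, e', hsh⟩ := ht
    refine ⟨mem_square_of_dist htU (dist_le_four hz (hp.mem_region t htT)), fun hzi => hsP ?_⟩
    rw [hPm]
    refine ⟨hs, ?_⟩
    obtain ⟨y, hy, hy'⟩ := hsh.exists_mem
    have hd : dist (p s) z ≤ 8 := by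
      have h1 := dist_le_four (hp.mem_region s hs) hy'
      have h2 := dist_le_four hy hz
      have h3 := dist_triangle (p s) y z
      linarith
    have := mem_square_of_dist hzi hd
    rwa [show a + 8 - 8 = a by ring, show b + 8 - 8 = b by ring,
      show l - 16 + 2 * 8 = l by ring] at this
  have hvol : volume A = ENNReal.ofReal ((l + 8) * (l + 8) - (l - 16) * (l - 16)) := by
    have hss : square (a + 8) (b + 8) (l - 16) ⊆ square (a - 4) (b - 4) (l + 2 * 4) := by
      rintro z ⟨⟨h1, h2⟩, h3, h4⟩
      exact ⟨⟨by linarith, by linarith⟩, by linarith, by linarith⟩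
    rw [hA, measure_sdiff hss (measurableSet_square _ _ _).nullMeasurableSet
      (by rw [volume_square _ _ _ (by linarith)]; exact ENNReal.ofReal_ne_top),
      volume_square _ _ _ (by linarith), volume_square _ _ _ (by linarith),
      ← ENNReal.ofReal_sub _ (by nlinarith)]
    congr 1; ring
  have hout : ∀ t ∈ outer T P, t ∈ T := fun t ht => by
    rw [mem_outer, hPm] at ht; exact ht.1.1
  rcases card_mul_le_volume hT hout hsub with h | h
  · rw [hvol, ENNReal.toReal_ofReal (by nlinarith)] at h
    have hpi := pi_gt_three
    have hc : (0 : ℝ) ≤ (outer T P).card := Nat.cast_nonneg _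
    nlinarith
  · rw [hvol] at h; exact absurd h ENNReal.ofReal_ne_top

/-- Tiles meeting the square shrunk by 4 on each side have their points in the square, and each lies
in a disc of area `4 π ≤ 12.6`. -/
lemma le_card_tilesIn (hT : IsPenroseTiling T) (hp : IsNetOfTiling T p) {a b l : ℝ} (hl : 8 ≤ l)
    {P : Finset Tile} (hP : (P : Set Tile) = tilesIn T p (square a b l)) :
    (l - 8) * (l - 8) ≤ 12.6 * P.card := by
  have hcov : square (a + 4) (b + 4) (l - 8) ⊆ ⋃ t ∈ P, Metric.closedBall t.shift 2 := by
    intro z hz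
    obtain ⟨t, ht, hzt⟩ := exists_mem_region hT z
    have htP : t ∈ P := by
      rw [← Finset.mem_coe, hP]
      refine ⟨ht, ?_⟩
      have := mem_square_of_dist hz (dist_le_four (hp.mem_region t ht) hzt)
      rwa [show a + 4 - 4 = a by ring, show b + 4 - 4 = b by ring,
        show l - 8 + 2 * 4 = l by ring] at this
    simp only [Set.mem_iUnion]
    exact ⟨t, htP, Tile.dist_shift_le hzt⟩
  have h1 := (measure_mono (μ := volume) hcov).trans (measure_biUnion_finset_le P _)
  rw [volume_square _ _ _ (by linarith)] at h1
  have h2 : ∀ t : Tile, volume (Metric.closedBall t.shift 2) = ENNReal.ofReal (4 * π) := by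
    intro t
    rw [Complex.volume_closedBall, ENNReal.ofReal_mul (by norm_num), ← ENNReal.ofReal_pow
      (by norm_num), ← NNReal.coe_real_pi, ENNReal.ofReal_coe_nnreal]
    norm_num
  simp only [h2, Finset.sum_const, nsmul_eq_mul] at h1
  rw [← ENNReal.ofReal_natCast, ← ENNReal.ofReal_mul (by positivity),
    ENNReal.ofReal_le_ofReal_iff (by positivity)] at h1
  have hpi := pi_lt_d2
  have hc : (0 : ℝ) ≤ P.card := Nat.cast_nonneg _
  nlinarith

lemma abs_kites_sub_le (hT : IsPenroseTiling T) (hp : IsNetOfTiling T p) {a b l : ℝ} (hl : 16 ≤ l) :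
    |(netCount T p .kite (square a b l) : ℝ) - φ * netCount T p .dart (square a b l)|
      ≤ 1400000 * l ∧
    (l - 8) * (l - 8) ≤
      12.6 * ((netCount T p .kite (square a b l) : ℝ) + netCount T p .dart (square a b l)) := by
  classical
  set P := (finite_tilesIn hT hp a b l).toFinset
  have hP : (P : Set Tile) = tilesIn T p (square a b l) := Set.Finite.coe_toFinset _
  have hPT : ∀ t ∈ P, t ∈ T := fun t ht => by
    rw [← Finset.mem_coe, hP] at ht; exact ht.1
  have hcount : ∀ κ, netCount T p κ (square a b l) = ∑ t ∈ P, if t.kind = κ then 1 else 0 := by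
    intro κ
    rw [netCount_eq hp, ← Finset.card_filter, ← Set.ncard_coe_finset, Finset.coe_filter]
    congr 1
    ext t
    rw [← hP]; rfl
  have hK := hcount .kite
  have hD := hcount .dart
  set K := netCount T p .kite (square a b l)
  set D := netCount T p .dart (square a b l)
  have hcard : (P.card : ℝ) = K + D := by
    rw [hK, hD, ← Nat.cast_add, ← Finset.sum_add_distrib,
      Finset.card_eq_sum_ones]
    congr 1
    refine Finset.sum_congr rfl fun t _ => ?_
    cases t.kind <;> simp
  -- By `φ * (φ - 1) = 1`, the conjugate area of a dart is `-φ` times that of a kite.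
  have hsum : ∑ t ∈ P, conjArea t.kind = 2 * (φ - 1) * (φ - 1) * sg * (K - φ * D) := by
    have h1 : ∀ t : Tile, conjArea t.kind = 2 * (φ - 1) * (φ - 1) * sg *
        (((if t.kind = .kite then 1 else 0 : ℕ) : ℝ)
          - φ * ((if t.kind = .dart then 1 else 0 : ℕ) : ℝ)) := by
      intro t
      cases t.kind
      · simp [conjArea]; ring
      · simp [conjArea]; linear_combination (-2 * (φ - 1) * sg) * phi_sq
    rw [hK, hD, Finset.sum_congr rfl fun t _ => h1 t, ← Finset.mul_sum,
      Finset.sum_sub_distrib, ← Finset.mul_sum, Nat.cast_sum, Nat.cast_sum]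
  obtain ⟨ω, hω1, hω2, hω3⟩ := hT.exists_edgeForm
  have hle := abs_sum_edgeSum_le hT hω1 hω2 hPT
  rw [Finset.sum_congr rfl fun t ht => hω3 t (hPT t ht), hsum, abs_mul] at hle
  refine ⟨?_, hcard ▸ le_card_tilesIn hT hp (by linarith) hP⟩
  have ho := card_outer_le hT hp hl hP
  have h3 := phi_gt; have hs := sg_gt
  -- The constant `1400000` exceeds `1024 * 4 * 243 / 0.72`.
  have hc : (0.72 : ℝ) ≤ 2 * (φ - 1) * (φ - 1) * sg := by
    have : (0.38 : ℝ) ≤ (φ - 1) * (φ - 1) := by nlinarith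
    nlinarith
  rw [abs_of_nonneg (by linarith : (0 : ℝ) ≤ 2 * (φ - 1) * (φ - 1) * sg)] at hle
  have h5 := mul_le_mul_of_nonneg_right hc (abs_nonneg ((K : ℝ) - φ * D))
  linarith

end Net

/-- Since `φ < 2`, it suffices that `27 - i ≤ -i/3`, which holds from `i = 41` on. -/
lemma two_pow_div_le_gold_rpow {i : ℕ} (hi : 50 ≤ i) :
    (2 : ℝ) ^ 27 / 2 ^ i ≤ φ ^ (-((i : ℝ) / 3)) := by
  have hi' : (50 : ℝ) ≤ i := by exact_mod_cast hi
  have h3 := phi_gt; have h4 := phi_lt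
  calc (2 : ℝ) ^ 27 / 2 ^ i = 2 ^ ((27 : ℝ) - i) := by
        rw [Real.rpow_sub (by norm_num), Real.rpow_natCast]; norm_num
    _ ≤ 2 ^ (-((i : ℝ) / 3)) := Real.rpow_le_rpow_of_exponent_le (by norm_num) (by linarith)
    _ ≤ φ ^ (-((i : ℝ) / 3)) :=
        Real.rpow_le_rpow_of_nonpos (by linarith) (by linarith) (by linarith)

end Penrose
end

theorem proposition2p2 (T : Set Penrose.Tile) (hT : Penrose.IsPenroseTiling T)
    (p : Penrose.Tile → ℂ) (hp : Penrose.IsNetOfTiling T p)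
    (i j₁ j₂ : ℕ) (hi : 50 ≤ i) :
    |(Penrose.netCount T p .kite (Penrose.square j₁ j₂ (2 ^ i)) : ℝ) /
        (Penrose.netCount T p .dart (Penrose.square j₁ j₂ (2 ^ i)) : ℝ) - Real.goldenRatio|
      ≤ Real.goldenRatio ^ (-((i : ℝ) / 3)) := by
  have hl : (2 : ℝ) ^ 50 ≤ 2 ^ i := pow_le_pow_right₀ (by norm_num) hi
  refine le_trans ?_ (Penrose.two_pow_div_le_gold_rpow hi)
  generalize (2 : ℝ) ^ i = l at hl ⊢
  norm_num at hl
  obtain ⟨h1, h2⟩ := Penrose.abs_kites_sub_le hT hp (a := j₁) (b := j₂) (l := l) (by linarith)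
  generalize (Penrose.netCount T p .kite (Penrose.square j₁ j₂ l) : ℝ) = K at *
  have hD0 : (0 : ℝ) ≤ Penrose.netCount T p .dart (Penrose.square j₁ j₂ l) := Nat.cast_nonneg _
  generalize (Penrose.netCount T p .dart (Penrose.square j₁ j₂ l) : ℝ) = D at *
  have h4 : Real.goldenRatio < 2 := Real.goldenRatio_lt_two
  change |K - Real.goldenRatio * D| ≤ _ at h1
  have hK := (abs_le.1 h1).2
  have hphiD : Real.goldenRatio * D ≤ 2 * D := mul_le_mul_of_nonneg_right h4.le hD0
  -- From `K ≤ 2 * D + 1400000 * l` the tile count gives `(l - 8)² ≤ 37.8 * D + O(l)`; the slack up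
  -- to 50 absorbs the linear terms, as `l ≥ 2 ^ 50`.
  have hDl : l * l ≤ 50 * D := by nlinarith
  have hD : 0 < D := by nlinarith
  rw [show K / D - Real.goldenRatio = (K - Real.goldenRatio * D) / D by field_simp, abs_div,
    abs_of_pos hD, div_le_div_iff₀ hD (by linarith)]
  have h6 := mul_le_mul_of_nonneg_right h1 (by linarith : 0 ≤ l)
  -- The inequality closes because `1400000 * 50 = 7 * 10 ^ 7 < 2 ^ 27`.
  nlinarith
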